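/- For real $z$ put $P(z)=\prod_{p<z}p$. A sieve density of dimension $\kappa$ with constant $L$ is a multiplicative function $g$ on squarefree integers with $0\le g(p)<1$ for all primes $p$ and $$\prod_{w\le p<z}(1-g(p))^{-1}\le\Bigl(\frac{\log z}{\log w}\Bigr)^{\kappa}\Bigl(1+\frac{L}{\log w}\Bigr)\qquad(2\le w<z).$$ A lower bound sieve of level $D$ (for the primes $p<z$) is a real sequence $(\lambda_d)_{d\mid P(z)}$ with $\lambda_d=0$ for $d\ge D$, $|\lambda_d|\le\tau(d)^B$ for some fixed integer $B\ge 0$, and $\sum_{d\mid n}\lambda_d\le\sum_{d\mid n}\mu(d)$ for all $n\mid P(z)$. The sifting limit $\beta_\kappa$ of the $\kappa$-dimensional sieve is the infimum of all real $s$ such that for every $L$ there are $c>0$, $B$ and $z_0$ with the following property: for every $z\ge z_0$ and every density $g$ of dimension $\kappa$ with constant $L$, some lower bound sieve of level $D=z^s$ with exponent $B$ satisfies $\sum_{d\mid P(z)}\lambda_d\,g(d)\ge c\prod_{p<z}(1-g(p))$. Let $\log_1=\log$, $\log_k=\log\log_{k-1}$ and $\mathrm{Log}_k=\prod_{2\le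 j\le k}\log_j$. For $\delta>0$ let $\mathcal M=\mathcal M_\delta$ be the set of positive integers $m$ that have no prime divisor less than $m^{\delta}$, and for $m\in\mathcal M$ let $m'$ be its successor, the least element of $\mathcal M$ larger than $m$. Given a function $\lambda$, put $y(m)=\lambda(m)\log m$. In the sums below the finitely many $m$ for which $\log_1 m,\dots,\log_k m$ are not all defined and positive are left out. **Proposition.** The sifting limit of the two-dimensional sieve satisfies $\beta_2<10$. Moreover, let $k\ge 2$ be an integer and $\varepsilon>0$ a real number. 1. If $\delta>0$ and $1/\delta>\beta_2$ (for instance $\delta=1/10$), then for $\lambda(m)=1/\mathrm{Log}_k(m)$ we have $$\sum_{\substack{m\in\mathcal M,\ m\le x\\ m'-m\le y(m)}}\frac1m\ \longrightarrow\ \infty\qquad(x\to\infty).$$ 2. For every $\delta>0$, if $\lambda(m)=1/\bigl(\mathrm{Log}_k(m)(\log_k m)^{\varepsilon}\bigr)$, then the sum $$\sum_{\substack{m\in\mathcal M,\ m\le x\\ m'-m\le y(m)}}\frac1m$$ is bounded as $x\to\infty$. 3. The same holds for the primes: with $p'$ denoting the prime following the prime $p$, $\lambda(p)=1/\bigl(\mathrm{Log}_k(p)(\log_k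 p)^{\varepsilon}\bigr)$ and $y(p)=\lambda(p)\log p$, the sum $$\sum_{\substack{p\le x\\ p'-p\le y(p)}}\frac1p$$ is bounded as $x\to\infty$. -/

import Mathlib

noncomputable section

/-! ### Sieves of dimension `κ` and the sifting limit -/

/-- The set of primes `p < z`. -/
def primesBelow (z : ℝ) : Finset ℕ :=
  (Finset.range ⌈z⌉₊).filter Nat.Prime

/-- `P(z)`, the product of all primes `p < z`. -/
def sievePrimorial (z : ℝ) : ℕ :=
  ∏ p ∈ primesBelow z, p

/-- A sieve density: the values `g p` at the primes of a multiplicative function with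
`0 ≤ g p < 1`, which has dimension (at most) `κ`, with constant `L`: for all `2 ≤ w < z`,
`∏_{w ≤ p < z} (1 - g p)⁻¹ ≤ (log z / log w) ^ κ * (1 + L / log w)`. -/
structure IsSieveDensity (κ L : ℝ) (g : ℕ → ℝ) : Prop where
  nonneg : ∀ p : ℕ, p.Prime → 0 ≤ g p
  lt_one : ∀ p : ℕ, p.Prime → g p < 1
  dimension : ∀ w z : ℝ, 2 ≤ w → w < z →
    ∏ p ∈ (primesBelow z).filter (fun p : ℕ => w ≤ (p : ℝ)), (1 - g p)⁻¹
      ≤ (Real.log z / Real.log w) ^ κ * (1 + L / Real.log w)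

/-- `lam` is a lower bound sieve of level `D` for the primes `p < z`: it is supported on `d < D`,
and `∑_{d ∣ n} lam d ≤ ∑_{d ∣ n} μ(d)` for all `n ∣ P(z)` (the right side is `1` if `n = 1`, and `0`
otherwise). As usual the weights do not exceed a fixed power `τ(d) ^ B` of the divisor function
(`B = 0` for combinatorial sieves such as the beta sieve; sieves built from Selberg's
squares need a larger `B`). -/
structure IsLowerBoundSieve (z D : ℝ) (B : ℕ) (lam : ℕ → ℝ) : Prop where
  eq_zero_of_level_le : ∀ d : ℕ, d ∣ sievePrimorial z → D ≤ (d : ℝ) → lam d = 0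
  abs_le : ∀ d : ℕ, d ∣ sievePrimorial z → |lam d| ≤ ((d.divisors.card : ℕ) : ℝ) ^ B
  sum_le : ∀ n : ℕ, n ∣ sievePrimorial z →
    ∑ d ∈ n.divisors, lam d ≤ if n = 1 then 1 else 0

/-- The sieve of dimension `κ` gives a positive lower bound at `s = log D / log z`: for all densities
`g` of dimension `κ` with a given constant `L`, and all large `z` (uniformly in `g`), some lower bound
sieve of level `D = z ^ s` has a main term `∑_{d ∣ P(z)} lam d * g d` which is at least a positive
constant times `V(z) = ∏_{p < z} (1 - g p)`. -/
def SievePositiveAt (κ s : ℝ) : Prop :=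
  ∀ L : ℝ, ∃ c : ℝ, 0 < c ∧ ∃ (B : ℕ) (z₀ : ℝ), ∀ z : ℝ, z₀ ≤ z →
    ∀ g : ℕ → ℝ, IsSieveDensity κ L g →
      ∃ lam : ℕ → ℝ, IsLowerBoundSieve z (z ^ s) B lam ∧
        c * ∏ p ∈ primesBelow z, (1 - g p)
          ≤ ∑ d ∈ (sievePrimorial z).divisors, lam d * ∏ p ∈ d.primeFactors, g p

/-- The sifting limit of the `κ`-dimensional sieve: the infimum of all `s` at which the sieve gives
a positive lower bound (`⊤` if there were no such `s`). -/
def siftingLimit (κ : ℝ) : EReal :=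
  sInf ((fun s : ℝ => (s : EReal)) '' {s : ℝ | SievePositiveAt κ s})

/-! ### Survivors, successors and iterated logarithms -/

/-- The positive integers `m` that have no prime divisor less than `m ^ δ`. -/
def survivors (δ : ℝ) : Set ℕ :=
  {m : ℕ | 1 ≤ m ∧ ∀ p : ℕ, p.Prime → p ∣ m → (m : ℝ) ^ δ ≤ (p : ℝ)}

/-- The successor of `m` in `S`: the least element of `S` that is larger than `m`. -/
def successorIn (S : Set ℕ) (m : ℕ) : ℕ :=
  sInf {n : ℕ | n ∈ S ∧ m < n}

/-- The `k`-th iterated logarithm: `log_1 = log`, `log_k = log log_{k-1}`. -/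
def iterLog (k : ℕ) (x : ℝ) : ℝ :=
  Real.log^[k] x

/-- The logorial function `Log_k = ∏_{2 ≤ j ≤ k} log_j`. -/
def logorial (k : ℕ) (x : ℝ) : ℝ :=
  ∏ j ∈ Finset.Icc 2 k, iterLog j x

/-- `log_1 x, …, log_k x` are all defined and positive, which holds for all large `x`. -/
def IterLogsPos (k : ℕ) (x : ℝ) : Prop :=
  ∀ j ∈ Finset.Icc 1 k, 0 < iterLog j x

open Classical in
/-- The sum of `1 / m` over the `m ≤ x` in `S` whose successor `m'` in `S` satisfies
`m' - m ≤ y m`, where `y m = lam m * log m`. The finitely many small `m` at which one of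
`log_1, …, log_k` is undefined or not positive are left out. -/
def shortGapSum (k : ℕ) (S : Set ℕ) (lam : ℝ → ℝ) (x : ℝ) : ℝ :=
  ∑ m ∈ (Finset.Icc 1 ⌊x⌋₊).filter (fun m : ℕ =>
      m ∈ S ∧ IterLogsPos k (m : ℝ) ∧
        (successorIn S m : ℝ) - (m : ℝ) ≤ lam (m : ℝ) * Real.log (m : ℝ)),
    1 / (m : ℝ)

end

/-!
Both halves of the proposition are read off from the dyadic blocks `(2 ^ j, 2 ^ (j + 1)]`. On such a
block a gap is short if it is at most `Y ≍ j / Log_k (2 ^ j)`, and the number of survivors with a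
short gap turns out to be `≍ (2 ^ j / j ^ 2) Y`, so that the block contributes
`≍ 1 / (j Log_k (2 ^ j))` to the sum. As `j ≍ log (2 ^ j)`, these terms are
`≍ 1 / (log_1 ⋯ log_k) (2 ^ j)`, which dominate the increments of `log_{k+1} (2 ^ j)`, so that their
sum diverges; with the additional factor `(log_k) ^ (-ε)` they are dominated by the increments of
`-(log_k (2 ^ j)) ^ (-ε)`, and the sum converges (`tendsto_sum_inv_logProduct`,
`sum_inv_logProduct_mul_rpow_le`).

The upper bound for the number of short gaps counts the pairs `m, m + h` with `0 < h ≤ Y` which have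
no prime factor below a small power of `2 ^ j`. An upper bound sieve of dimension two gives
`≪ (2 ^ j / j ^ 2) (h / φ(h)) ^ 2` of them (`exists_card_siftedTuples_le`), and `h / φ(h)` has
bounded moments (`exists_sum_eulerFactor_pow_le`). The primes are survivors for `δ = 1`, and the
argument applies to every set of survivors.

For the lower bound, a sieve with a positive main term at some `s < 1 / δ` gives `≫ 2 ^ j / j ^ 2`
pairs of survivors for every even `h` (`exists_le_card_siftedTuples_pair`). A number `m` may occur in
several pairs, but the multiplicity costs at most the number of triples `m, m + h, m + h'`, which by
the upper bound sieve of dimension three is `≪ (2 ^ j / j ^ 3) Y ^ 2`. This is of lower order,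
because `Y / j → 0` (`exists_le_card_short_gaps`).

The sieves are those of Brun and Hooley. The primes below `z` are cut into the blocks
`[z ^ (q ^ (j + 1)), z ^ (q ^ j))` with `q = 3 / 5`. The product of the truncations of the Möbius
function to at most `2 b_j` primes in block `j` is an upper bound sieve, by Bonferroni's
inequalities; subtracting, for each `l`, the product in which the factor of block `l` is replaced by
the indicator of exactly `2 b_l + 1` primes makes it a lower bound sieve. The main term stays
positive if the relative losses in the blocks add up to less than `1`. For
`b_j = 1, 2, 2, 2, 2, 3, …` the level is `z ^ 9.6`, and in dimension two the losses add up to less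
than `19 / 20` (`sievePositiveAt_two`), whence `β₂ ≤ 9.6`. That the densities of pairs and triples
have dimensions two and three is Mertens' second theorem (`exists_isSieveDensity`).
-/

namespace ShortGaps

open Finset

/-! ### Weighted sums over subsets and truncated inclusion–exclusion -/

/-- The sum `∑ w d * ∏_{p ∈ d} g p` over the subsets `d` of `A`: the main term of a sieve with
weights `w`, squarefree integers being encoded by their sets of prime factors. -/
noncomputable def weightedSum (w : Finset ℕ → ℝ) (A : Finset ℕ) (g : ℕ → ℝ) : ℝ :=
  ∑ d ∈ A.powerset, w d * ∏ p ∈ d, g p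

/-- The Möbius weight restricted to sets with at most `k` elements. -/
def truncMoebius (k : ℕ) (d : Finset ℕ) : ℝ := if d.card ≤ k then (-1) ^ d.card else 0

/-- The indicator function of the sets with exactly `m` elements. -/
def cardWeight (m : ℕ) (d : Finset ℕ) : ℝ := if d.card = m then 1 else 0

lemma weightedSum_insert (w : Finset ℕ → ℝ) (A : Finset ℕ) (g : ℕ → ℝ) {p : ℕ} (hp : p ∉ A) :
    weightedSum w (insert p A) g
      = weightedSum w A g + g p * weightedSum (fun d => w (insert p d)) A g := by
  unfold weightedSum
  rw [sum_powerset_insert hp, mul_sum]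
  congr 1
  refine sum_congr rfl fun d hd => ?_
  rw [prod_insert fun h => hp (mem_powerset.1 hd h)]
  ring

lemma weightedSum_congr {w w' : Finset ℕ → ℝ} {A : Finset ℕ} {g : ℕ → ℝ}
    (h : ∀ d ⊆ A, w d = w' d) : weightedSum w A g = weightedSum w' A g :=
  sum_congr rfl fun d hd => by rw [h d (mem_powerset.1 hd)]

lemma weightedSum_neg (w : Finset ℕ → ℝ) (A : Finset ℕ) (g : ℕ → ℝ) :
    weightedSum (fun d => -w d) A g = -weightedSum w A g := by
  simp [weightedSum]

lemma weightedSum_truncMoebius_succ_insert (k : ℕ) {A : Finset ℕ} (g : ℕ → ℝ) {p : ℕ}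
    (hp : p ∉ A) :
    weightedSum (truncMoebius (k + 1)) (insert p A) g
      = weightedSum (truncMoebius (k + 1)) A g - g p * weightedSum (truncMoebius k) A g := by
  have key : weightedSum (fun d => truncMoebius (k + 1) (insert p d)) A g
      = weightedSum (fun d => -truncMoebius k d) A g := by
    refine weightedSum_congr fun d hd => ?_
    have : (insert p d).card = d.card + 1 := card_insert_of_notMem fun h => hp (hd h)
    by_cases h : d.card ≤ k <;> simp [truncMoebius, this, h, pow_succ]
  rw [weightedSum_insert _ _ _ hp, key, weightedSum_neg]
  ring

lemma weightedSum_truncMoebius_zero (A : Finset ℕ) (g : ℕ → ℝ) :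
    weightedSum (truncMoebius 0) A g = 1 := by
  unfold weightedSum truncMoebius
  rw [sum_eq_single ∅]
  · simp
  · intro d _ hd
    simp [hd]
  · simp

lemma weightedSum_cardWeight_zero (A : Finset ℕ) (g : ℕ → ℝ) :
    weightedSum (cardWeight 0) A g = 1 := by
  unfold weightedSum cardWeight
  rw [sum_eq_single ∅]
  · simp
  · intro d _ hd
    simp [hd]
  · simp

lemma weightedSum_cardWeight_succ_insert (m : ℕ) {A : Finset ℕ} (g : ℕ → ℝ) {p : ℕ}
    (hp : p ∉ A) :
    weightedSum (cardWeight (m + 1)) (insert p A) g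
      = weightedSum (cardWeight (m + 1)) A g + g p * weightedSum (cardWeight m) A g := by
  have key : weightedSum (fun d => cardWeight (m + 1) (insert p d)) A g
      = weightedSum (cardWeight m) A g := by
    refine weightedSum_congr fun d hd => ?_
    have : (insert p d).card = d.card + 1 := card_insert_of_notMem fun h => hp (hd h)
    simp [cardWeight, this]
  rw [weightedSum_insert _ _ _ hp, key]

lemma weightedSum_cardWeight_nonneg (m : ℕ) {A : Finset ℕ} {g : ℕ → ℝ}
    (hg : ∀ p ∈ A, 0 ≤ g p) : 0 ≤ weightedSum (cardWeight m) A g :=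
  sum_nonneg fun d hd => mul_nonneg (by unfold cardWeight; split_ifs <;> norm_num)
    (prod_nonneg fun p hp => hg p (mem_powerset.1 hd hp))

/-- Bonferroni's inequalities: the partial sums of the expansion of `∏ (1 - g p)` are alternately
too large and too small. -/
lemma bonferroni (k : ℕ) {A : Finset ℕ} {g : ℕ → ℝ} (h0 : ∀ p ∈ A, 0 ≤ g p)
    (h1 : ∀ p ∈ A, g p ≤ 1) :
    0 ≤ (-1) ^ k * (weightedSum (truncMoebius k) A g - ∏ p ∈ A, (1 - g p)) := by
  induction A using Finset.induction_on generalizing k with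
  | empty => simp [weightedSum, truncMoebius]
  | insert p A hp ih =>
    simp only [mem_insert, forall_eq_or_imp] at h0 h1
    cases k with
    | zero =>
      rw [weightedSum_truncMoebius_zero]
      have : ∏ q ∈ insert p A, (1 - g q) ≤ 1 := prod_le_one
        (fun q hq => by
          rcases mem_insert.1 hq with rfl | hq
          · linarith [h1.1]
          · linarith [h1.2 q hq])
        (fun q hq => by
          rcases mem_insert.1 hq with rfl | hq
          · linarith [h0.1]
          · linarith [h0.2 q hq])
      simpa using this
    | succ k =>
      have e1 := ih (k + 1) h0.2 h1.2
      have e2 := mul_nonneg h0.1 (ih k h0.2 h1.2)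
      rw [weightedSum_truncMoebius_succ_insert _ _ hp, prod_insert hp]
      rw [pow_succ] at e1 ⊢
      linarith

lemma prod_le_weightedSum_truncMoebius (b : ℕ) {A : Finset ℕ} {g : ℕ → ℝ}
    (h0 : ∀ p ∈ A, 0 ≤ g p) (h1 : ∀ p ∈ A, g p ≤ 1) :
    ∏ p ∈ A, (1 - g p) ≤ weightedSum (truncMoebius (2 * b)) A g := by
  have := bonferroni (2 * b) h0 h1
  simp only [pow_mul, even_two, Even.neg_pow, one_pow, one_mul] at this
  linarith

lemma weightedSum_truncMoebius_le (b : ℕ) {A : Finset ℕ} {g : ℕ → ℝ}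
    (h0 : ∀ p ∈ A, 0 ≤ g p) (h1 : ∀ p ∈ A, g p ≤ 1) :
    weightedSum (truncMoebius (2 * b)) A g
      ≤ ∏ p ∈ A, (1 - g p) + weightedSum (cardWeight (2 * b + 1)) A g := by
  have := bonferroni (2 * b + 1) h0 h1
  have e : weightedSum (truncMoebius (2 * b + 1)) A g
      = weightedSum (truncMoebius (2 * b)) A g - weightedSum (cardWeight (2 * b + 1)) A g := by
    unfold weightedSum
    rw [← sum_sub_distrib]
    refine sum_congr rfl fun d _ => ?_
    unfold truncMoebius cardWeight
    rcases lt_trichotomy d.card (2 * b + 1) with h | h | h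
    · simp [h.le, Nat.lt_succ_iff.1 h, h.ne]
    · simp [h, pow_succ]
    · simp [not_le.2 h, h.ne', show ¬ d.card ≤ 2 * b by omega]
  rw [e, pow_succ, pow_mul] at this
  norm_num at this
  linarith

/-- The elementary symmetric sum of degree `m` is at most `S ^ m / m!`, where `S` is the sum. -/
lemma weightedSum_cardWeight_le (m : ℕ) {A : Finset ℕ} {g : ℕ → ℝ} (h0 : ∀ p ∈ A, 0 ≤ g p) :
    weightedSum (cardWeight m) A g ≤ (∑ p ∈ A, g p) ^ m / m.factorial := by
  induction A using Finset.induction_on generalizing m with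
  | empty =>
    cases m <;> simp [weightedSum, cardWeight]
  | insert p A hp ih =>
    simp only [mem_insert, forall_eq_or_imp] at h0
    cases m with
    | zero => rw [weightedSum_cardWeight_zero]; simp
    | succ m =>
      rw [weightedSum_cardWeight_succ_insert _ _ hp, sum_insert hp]
      set S := ∑ p ∈ A, g p with hS
      have hS0 : 0 ≤ S := sum_nonneg h0.2
      have e1 := ih (m + 1) h0.2
      have e2 := mul_le_mul_of_nonneg_left (ih m h0.2) h0.1
      have key : S ^ (m + 1) + (m + 1) * (g p * S ^ m) ≤ (g p + S) ^ (m + 1) := by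
        have := h0.1
        rw [add_comm (g p)]
        clear_value S
        clear e1 e2 hS
        induction m with
        | zero => simp
        | succ m ih' =>
          have := mul_le_mul_of_nonneg_right ih' (add_nonneg hS0 h0.1)
          rw [pow_succ (S + g p) (m + 1)]
          refine le_trans ?_ this
          have h3 : 0 ≤ (m + 1) * (g p * g p * S ^ m) := by positivity
          push_cast
          ring_nf at h3 ⊢
          nlinarith [h3]
      calc _ ≤ S ^ (m + 1) / ((m + 1).factorial : ℝ) + g p * (S ^ m / (m.factorial : ℝ)) :=
            add_le_add e1 e2
        _ = (S ^ (m + 1) + (m + 1) * (g p * S ^ m)) / ((m + 1).factorial : ℝ) := by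
            rw [Nat.factorial_succ]; push_cast
            have : (m.factorial : ℝ) ≠ 0 := by positivity
            field_simp
        _ ≤ _ := by gcongr

lemma sum_powerset_union_disjoint {A B : Finset ℕ} (h : Disjoint A B) (F : Finset ℕ → ℝ) :
    ∑ d ∈ (A ∪ B).powerset, F d = ∑ a ∈ A.powerset, ∑ b ∈ B.powerset, F (a ∪ b) := by
  induction A using Finset.induction_on generalizing F with
  | empty => simp
  | insert p A hp ih =>
    rw [disjoint_insert_left] at h
    rw [insert_union, sum_powerset_insert (by simp [hp, h.1]), sum_powerset_insert hp,
      ih h.2, ih h.2 (fun d => F (insert p d))]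
    simp only [insert_union]

/-- The union of the first `r` blocks. -/
abbrev blockUnion (I : ℕ → Finset ℕ) (r : ℕ) : Finset ℕ := (range r).biUnion I

/-- A weight that is a product over disjoint blocks has a main term that is a product. -/
lemma weightedSum_prod_blocks {I : ℕ → Finset ℕ} (hI : ∀ i j, i ≠ j → Disjoint (I i) (I j))
    (w : ℕ → Finset ℕ → ℝ) (g : ℕ → ℝ) (r : ℕ) :
    weightedSum (fun d => ∏ j ∈ range r, w j (d ∩ I j)) (blockUnion I r) g
      = ∏ j ∈ range r, weightedSum (w j) (I j) g := by
  induction r with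
  | zero => simp [weightedSum, blockUnion]
  | succ r ih =>
    have hd : Disjoint (blockUnion I r) (I r) := by
      rw [disjoint_biUnion_left]
      exact fun i hi => hI i r (mem_range.1 hi).ne
    have hU : blockUnion I (r + 1) = blockUnion I r ∪ I r := by
      rw [blockUnion, range_add_one, biUnion_insert, union_comm]
    rw [prod_range_succ, ← ih]
    unfold weightedSum
    rw [hU, sum_powerset_union_disjoint hd, sum_mul_sum]
    refine sum_congr rfl fun a ha => sum_congr rfl fun b hb => ?_
    rw [mem_powerset] at ha hb
    rw [prod_union (disjoint_of_subset_left ha (disjoint_of_subset_right hb hd))]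
    beta_reduce
    rw [prod_range_succ]
    have e1 : (a ∪ b) ∩ I r = b := by
      rw [union_inter_distrib_right, inter_eq_left.2 hb,
        disjoint_iff_inter_eq_empty.1 (disjoint_of_subset_left ha hd), empty_union]
    have e2 : ∀ j ∈ range r, w j ((a ∪ b) ∩ I j) = w j (a ∩ I j) := by
      intro j hj
      rw [union_inter_distrib_right, disjoint_iff_inter_eq_empty.1
        (disjoint_of_subset_left hb (hI r j (mem_range.1 hj).ne')), union_empty]
    rw [e1, prod_congr rfl e2]
    ring

/-! ### The Brun–Hooley weights -/

/-- The upper bound weight: the Möbius function on the sets having at most `2 b j` elements in the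
block `j`, for each `j < r`. -/
noncomputable def upperWeight (I : ℕ → Finset ℕ) (b : ℕ → ℕ) (r : ℕ) (d : Finset ℕ) : ℝ :=
  ∏ j ∈ range r, truncMoebius (2 * b j) (d ∩ I j)

/-- The lower bound weight: the Möbius function on the sets having at most `2 b j` elements in the
block `j`, except that one block `l` may contain exactly `2 b l + 1` elements. -/
noncomputable def lowerWeight (I : ℕ → Finset ℕ) (b : ℕ → ℕ) (r : ℕ) (d : Finset ℕ) : ℝ :=
  upperWeight I b r d - ∑ l ∈ range r, ∏ j ∈ range r,
    (if j = l then cardWeight (2 * b j + 1) else truncMoebius (2 * b j)) (d ∩ I j)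

lemma abs_truncMoebius_le (k : ℕ) (d : Finset ℕ) : |truncMoebius k d| ≤ 1 := by
  unfold truncMoebius; split_ifs <;> simp

lemma abs_upperWeight_le (I : ℕ → Finset ℕ) (b : ℕ → ℕ) (r : ℕ) (d : Finset ℕ) :
    |upperWeight I b r d| ≤ 1 := by
  unfold upperWeight
  rw [abs_prod]
  exact prod_le_one (fun _ _ => abs_nonneg _) fun _ _ => abs_truncMoebius_le _ _

lemma abs_lowerWeight_le (I : ℕ → Finset ℕ) (b : ℕ → ℕ) (r : ℕ) (d : Finset ℕ) :
    |lowerWeight I b r d| ≤ 1 := by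
  by_cases h : ∃ l ∈ range r, (d ∩ I l).card = 2 * b l + 1
  · obtain ⟨l, hl, hc⟩ := h
    have ht : truncMoebius (2 * b l) (d ∩ I l) = 0 := by simp [truncMoebius, hc]
    have e1 : upperWeight I b r d = 0 := prod_eq_zero hl ht
    unfold lowerWeight
    rw [e1, zero_sub, abs_neg, sum_eq_single_of_mem l hl, abs_prod]
    · refine prod_le_one (fun _ _ => abs_nonneg _) fun j _ => ?_
      split_ifs
      · unfold cardWeight; split_ifs <;> simp
      · exact abs_truncMoebius_le _ _
    · intro l' _ hne
      refine prod_eq_zero hl ?_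
      rw [if_neg hne.symm, ht]
  · push Not at h
    unfold lowerWeight
    rw [sum_eq_zero, sub_zero]
    · exact abs_upperWeight_le I b r d
    · intro l hl
      refine prod_eq_zero hl ?_
      simp [cardWeight, h l hl]

/-- The number of elements that the support of the weights allows in the blocks. -/
lemma card_inter_le_of_lowerWeight_ne_zero {I : ℕ → Finset ℕ} {b : ℕ → ℕ} {r : ℕ}
    {d : Finset ℕ} (h : lowerWeight I b r d ≠ 0) :
    ∃ l, ∀ j < r, (d ∩ I j).card ≤ 2 * b j + if j = l then 1 else 0 := by
  by_cases hu : upperWeight I b r d = 0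
  · have : ∃ l ∈ range r, ∏ j ∈ range r, (if j = l then cardWeight (2 * b j + 1)
        else truncMoebius (2 * b j)) (d ∩ I j) ≠ 0 := by
      by_contra! hc
      exact h (by rw [lowerWeight, hu, sum_eq_zero hc, sub_zero])
    obtain ⟨l, -, hl⟩ := this
    refine ⟨l, fun j hj => ?_⟩
    have := prod_ne_zero_iff.1 hl j (mem_range.2 hj)
    by_cases hjl : j = l
    · simp only [hjl, if_true, cardWeight, ne_eq, ite_eq_right_iff, one_ne_zero, imp_false,
        not_not] at this ⊢
      exact this.le
    · simp only [hjl, if_false, truncMoebius, ne_eq, ite_eq_right_iff, not_forall] at this ⊢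
      exact this.1
  · refine ⟨r, fun j hj => ?_⟩
    have := prod_ne_zero_iff.1 hu j (mem_range.2 hj)
    simp only [truncMoebius, ne_eq, ite_eq_right_iff, not_forall] at this
    exact this.1.trans (Nat.le_add_right _ _)

lemma card_inter_le_of_upperWeight_ne_zero {I : ℕ → Finset ℕ} {b : ℕ → ℕ} {r : ℕ}
    {d : Finset ℕ} (h : upperWeight I b r d ≠ 0) :
    ∀ j < r, (d ∩ I j).card ≤ 2 * b j := by
  intro j hj
  have := prod_ne_zero_iff.1 h j (mem_range.2 hj)
  simp only [truncMoebius, ne_eq, ite_eq_right_iff, not_forall] at this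
  exact this.1

lemma weightedSum_upperWeight {I : ℕ → Finset ℕ} (hI : ∀ i j, i ≠ j → Disjoint (I i) (I j))
    (b : ℕ → ℕ) (r : ℕ) (g : ℕ → ℝ) :
    weightedSum (upperWeight I b r) (blockUnion I r) g
      = ∏ j ∈ range r, weightedSum (truncMoebius (2 * b j)) (I j) g :=
  weightedSum_prod_blocks hI (fun j => truncMoebius (2 * b j)) g r

lemma weightedSum_lowerWeight {I : ℕ → Finset ℕ} (hI : ∀ i j, i ≠ j → Disjoint (I i) (I j))
    (b : ℕ → ℕ) (r : ℕ) (g : ℕ → ℝ) :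
    weightedSum (lowerWeight I b r) (blockUnion I r) g
      = ∏ j ∈ range r, weightedSum (truncMoebius (2 * b j)) (I j) g
        - ∑ l ∈ range r, weightedSum (cardWeight (2 * b l + 1)) (I l) g *
          ∏ j ∈ (range r).erase l, weightedSum (truncMoebius (2 * b j)) (I j) g := by
  rw [← weightedSum_upperWeight hI]
  have key : ∀ l ∈ range r, weightedSum (cardWeight (2 * b l + 1)) (I l) g *
      ∏ j ∈ (range r).erase l, weightedSum (truncMoebius (2 * b j)) (I j) g
      = weightedSum (fun d => ∏ j ∈ range r, (if j = l then cardWeight (2 * b j + 1)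
        else truncMoebius (2 * b j)) (d ∩ I j)) (blockUnion I r) g := by
    intro l hl
    rw [weightedSum_prod_blocks hI (fun j => if j = l then cardWeight (2 * b j + 1)
        else truncMoebius (2 * b j)), ← mul_prod_erase _ _ hl]
    congr 1
    · simp
    · refine prod_congr rfl fun j hj => ?_
      rw [if_neg (ne_of_mem_erase hj)]
  rw [sum_congr rfl key]
  unfold weightedSum lowerWeight
  rw [sum_comm, ← sum_sub_distrib]
  refine sum_congr rfl fun d _ => ?_
  rw [sub_mul, sum_mul]

lemma prod_blockUnion {I : ℕ → Finset ℕ} (hI : ∀ i j, i ≠ j → Disjoint (I i) (I j)) (r : ℕ)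
    (f : ℕ → ℝ) : ∏ p ∈ blockUnion I r, f p = ∏ j ∈ range r, ∏ p ∈ I j, f p :=
  prod_biUnion fun i _ j _ hij => hI i j hij

/-- The upper bound weight majorises, in the main term, the full product; for `g` an indicator
function this is the upper bound sieve inequality. -/
lemma prod_le_weightedSum_upperWeight {I : ℕ → Finset ℕ}
    (hI : ∀ i j, i ≠ j → Disjoint (I i) (I j)) (b : ℕ → ℕ) (r : ℕ) {g : ℕ → ℝ}
    (h0 : ∀ p ∈ blockUnion I r, 0 ≤ g p) (h1 : ∀ p ∈ blockUnion I r, g p ≤ 1) :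
    ∏ p ∈ blockUnion I r, (1 - g p) ≤ weightedSum (upperWeight I b r) (blockUnion I r) g := by
  have hs : ∀ j ∈ range r, ∀ p ∈ I j, p ∈ blockUnion I r := fun j hj p hp =>
    mem_biUnion.2 ⟨j, hj, hp⟩
  rw [weightedSum_upperWeight hI, prod_blockUnion hI]
  refine prod_le_prod (fun j hj => prod_nonneg fun p hp => ?_) fun j hj => ?_
  · linarith [h1 p (hs j hj p hp)]
  · exact prod_le_weightedSum_truncMoebius _ (fun p hp => h0 p (hs j hj p hp))
      fun p hp => h1 p (hs j hj p hp)

/-- For the indicator function `g` of a nonempty set the main term of the lower bound weight is not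
positive: the block that the set meets already compensates its product. -/
lemma weightedSum_lowerWeight_nonpos {I : ℕ → Finset ℕ}
    (hI : ∀ i j, i ≠ j → Disjoint (I i) (I j)) (b : ℕ → ℕ) (r : ℕ) {g : ℕ → ℝ}
    (h0 : ∀ p ∈ blockUnion I r, 0 ≤ g p) (h1 : ∀ p ∈ blockUnion I r, g p ≤ 1)
    (hp : ∃ p ∈ blockUnion I r, g p = 1) :
    weightedSum (lowerWeight I b r) (blockUnion I r) g ≤ 0 := by
  have hs : ∀ j ∈ range r, ∀ p ∈ I j, p ∈ blockUnion I r := fun j hj p hp =>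
    mem_biUnion.2 ⟨j, hj, hp⟩
  obtain ⟨p, hpU, hgp⟩ := hp
  obtain ⟨l, hl, hpl⟩ := mem_biUnion.1 hpU
  have hE : ∀ j ∈ range r, 0 ≤ weightedSum (truncMoebius (2 * b j)) (I j) g := fun j hj =>
    (prod_nonneg fun p hp => by linarith [h1 p (hs j hj p hp)]).trans
      (prod_le_weightedSum_truncMoebius _ (fun p hp => h0 p (hs j hj p hp))
      fun p hp => h1 p (hs j hj p hp))
  have hl0 : weightedSum (truncMoebius (2 * b l)) (I l) g
      ≤ weightedSum (cardWeight (2 * b l + 1)) (I l) g := by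
    have := weightedSum_truncMoebius_le (b l) (fun p hp => h0 p (hs l hl p hp))
      fun p hp => h1 p (hs l hl p hp)
    rwa [prod_eq_zero hpl (by rw [hgp, sub_self]), zero_add] at this
  have hT : ∀ j ∈ range r, 0 ≤ weightedSum (cardWeight (2 * b j + 1)) (I j) g *
      ∏ i ∈ (range r).erase j, weightedSum (truncMoebius (2 * b i)) (I i) g := fun j hj =>
    mul_nonneg (weightedSum_cardWeight_nonneg _ fun p hp => h0 p (hs j hj p hp))
      (prod_nonneg fun i hi => hE i (mem_of_mem_erase hi))
  have h2 := single_le_sum hT hl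
  rw [weightedSum_lowerWeight hI, ← mul_prod_erase _ _ hl]
  have h3 := mul_le_mul_of_nonneg_right hl0
    (prod_nonneg fun i hi => hE i (mem_of_mem_erase hi) :
      0 ≤ ∏ i ∈ (range r).erase l, weightedSum (truncMoebius (2 * b i)) (I i) g)
  linarith

lemma weightedSum_lowerWeight_eq_one {I : ℕ → Finset ℕ}
    (hI : ∀ i j, i ≠ j → Disjoint (I i) (I j)) (b : ℕ → ℕ) (r : ℕ) {g : ℕ → ℝ}
    (h0 : ∀ p ∈ blockUnion I r, g p = 0) :
    weightedSum (lowerWeight I b r) (blockUnion I r) g = 1 := by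
  have hs : ∀ j ∈ range r, ∀ p ∈ I j, g p = 0 := fun j hj p hp =>
    h0 p (mem_biUnion.2 ⟨j, hj, hp⟩)
  have hw : ∀ w : Finset ℕ → ℝ, ∀ j ∈ range r, weightedSum w (I j) g = w ∅ := by
    intro w j hj
    unfold weightedSum
    rw [sum_eq_single ∅]
    · simp
    · intro d hd hne
      obtain ⟨p, hp⟩ := nonempty_iff_ne_empty.2 hne
      rw [prod_eq_zero hp (hs j hj p (mem_powerset.1 hd hp)), mul_zero]
    · simp
  rw [weightedSum_lowerWeight hI, prod_congr rfl fun j hj => hw _ j hj, sum_eq_zero]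
  · simp [truncMoebius]
  · intro l hl
    rw [hw _ l hl]
    simp [cardWeight]

/-- The main term of the lower bound weight, when the relative losses in the blocks add up to less
than one. -/
lemma le_weightedSum_lowerWeight {I : ℕ → Finset ℕ}
    (hI : ∀ i j, i ≠ j → Disjoint (I i) (I j)) (b : ℕ → ℕ) (r : ℕ) {g : ℕ → ℝ} {t : ℕ → ℝ}
    {c : ℝ} (hc : 0 ≤ c) (h0 : ∀ p ∈ blockUnion I r, 0 ≤ g p)
    (h1 : ∀ p ∈ blockUnion I r, g p ≤ 1)
    (ht : ∀ j < r, weightedSum (cardWeight (2 * b j + 1)) (I j) g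
      ≤ t j * ∏ p ∈ I j, (1 - g p)) (ht0 : ∀ j < r, 0 ≤ t j)
    (hsum : ∑ j ∈ range r, t j ≤ 1 - c) :
    c * ∏ p ∈ blockUnion I r, (1 - g p)
      ≤ weightedSum (lowerWeight I b r) (blockUnion I r) g := by
  have hs : ∀ j ∈ range r, ∀ p ∈ I j, p ∈ blockUnion I r := fun j hj p hp =>
    mem_biUnion.2 ⟨j, hj, hp⟩
  have hV : ∀ j ∈ range r, 0 ≤ ∏ p ∈ I j, (1 - g p) := fun j hj =>
    prod_nonneg fun p hp => by linarith [h1 p (hs j hj p hp)]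
  have hVE : ∀ j ∈ range r, ∏ p ∈ I j, (1 - g p)
      ≤ weightedSum (truncMoebius (2 * b j)) (I j) g := fun j hj =>
    prod_le_weightedSum_truncMoebius _ (fun p hp => h0 p (hs j hj p hp))
      fun p hp => h1 p (hs j hj p hp)
  set E : ℕ → ℝ := fun j => weightedSum (truncMoebius (2 * b j)) (I j) g with hEdef
  have hE : ∀ j ∈ range r, 0 ≤ E j := fun j hj => (hV j hj).trans (hVE j hj)
  have h2 : ∑ l ∈ range r, weightedSum (cardWeight (2 * b l + 1)) (I l) g *
      ∏ j ∈ (range r).erase l, E j ≤ ∑ l ∈ range r, t l * ∏ j ∈ range r, E j := by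
    refine sum_le_sum fun l hl => ?_
    rw [← mul_prod_erase _ _ hl, ← mul_assoc]
    refine mul_le_mul_of_nonneg_right ?_ (prod_nonneg fun i hi => hE i (mem_of_mem_erase hi))
    exact (ht l (mem_range.1 hl)).trans
      (mul_le_mul_of_nonneg_left (hVE l hl) (ht0 l (mem_range.1 hl)))
  rw [← sum_mul] at h2
  have hP : 0 ≤ ∏ j ∈ range r, E j := prod_nonneg hE
  have h3 := mul_le_mul_of_nonneg_right hsum hP
  have h4 : ∏ p ∈ blockUnion I r, (1 - g p) ≤ ∏ j ∈ range r, E j := by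
    rw [prod_blockUnion hI]
    exact prod_le_prod hV hVE
  rw [weightedSum_lowerWeight hI]
  nlinarith [mul_le_mul_of_nonneg_left h4 hc]

/-- The main term of the upper bound weight, in terms of the relative losses in the blocks. -/
lemma weightedSum_upperWeight_le {I : ℕ → Finset ℕ}
    (hI : ∀ i j, i ≠ j → Disjoint (I i) (I j)) (b : ℕ → ℕ) (r : ℕ) {g : ℕ → ℝ} {t : ℕ → ℝ}
    {c : ℝ} (h0 : ∀ p ∈ blockUnion I r, 0 ≤ g p)
    (h1 : ∀ p ∈ blockUnion I r, g p ≤ 1)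
    (ht : ∀ j < r, weightedSum (cardWeight (2 * b j + 1)) (I j) g
      ≤ t j * ∏ p ∈ I j, (1 - g p)) (hsum : ∑ j ∈ range r, t j ≤ c) :
    weightedSum (upperWeight I b r) (blockUnion I r) g
      ≤ Real.exp c * ∏ p ∈ blockUnion I r, (1 - g p) := by
  have hs : ∀ j ∈ range r, ∀ p ∈ I j, p ∈ blockUnion I r := fun j hj p hp =>
    mem_biUnion.2 ⟨j, hj, hp⟩
  have hV : ∀ j ∈ range r, 0 ≤ ∏ p ∈ I j, (1 - g p) := fun j hj =>
    prod_nonneg fun p hp => by linarith [h1 p (hs j hj p hp)]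
  have hV' : 0 ≤ ∏ p ∈ blockUnion I r, (1 - g p) := by
    rw [prod_blockUnion hI]; exact prod_nonneg hV
  calc _ = ∏ j ∈ range r, weightedSum (truncMoebius (2 * b j)) (I j) g :=
        weightedSum_upperWeight hI b r g
    _ ≤ ∏ j ∈ range r, Real.exp (t j) * ∏ p ∈ I j, (1 - g p) := by
        refine prod_le_prod (fun j hj => (hV j hj).trans (prod_le_weightedSum_truncMoebius _
          (fun p hp => h0 p (hs j hj p hp)) fun p hp => h1 p (hs j hj p hp))) fun j hj => ?_
        have e1 := weightedSum_truncMoebius_le (b j) (fun p hp => h0 p (hs j hj p hp))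
          fun p hp => h1 p (hs j hj p hp)
        have e2 := ht j (mem_range.1 hj)
        have e3 := mul_le_mul_of_nonneg_right (Real.add_one_le_exp (t j)) (hV j hj)
        linarith
    _ = Real.exp (∑ j ∈ range r, t j) * ∏ p ∈ blockUnion I r, (1 - g p) := by
        rw [prod_mul_distrib, ← Real.exp_sum, prod_blockUnion hI]
    _ ≤ _ := mul_le_mul_of_nonneg_right (Real.exp_le_exp.2 hsum) hV'

/-- The relative loss in a block whose product of the `(1 - g p)⁻¹` is at most `a`. -/
lemma weightedSum_cardWeight_le_of_prod_inv_le {A : Finset ℕ} {g : ℕ → ℝ} {a : ℝ} (m : ℕ)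
    (h0 : ∀ p ∈ A, 0 ≤ g p) (h1 : ∀ p ∈ A, g p < 1) (ha : ∏ p ∈ A, (1 - g p)⁻¹ ≤ a) :
    weightedSum (cardWeight m) A g
      ≤ a * Real.log a ^ m / m.factorial * ∏ p ∈ A, (1 - g p) := by
  have hV : 0 < ∏ p ∈ A, (1 - g p) := prod_pos fun p hp => by linarith [h1 p hp]
  rw [prod_inv_distrib] at ha
  have ha0 : 0 < a := (inv_pos.2 hV).trans_le ha
  have hS : ∑ p ∈ A, g p ≤ Real.log a := by
    refine le_trans ?_ (Real.log_le_log (inv_pos.2 hV) ha)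
    rw [Real.log_inv, Real.log_prod (fun p hp => by linarith [h1 p hp]), ← sum_neg_distrib]
    refine sum_le_sum fun p hp => ?_
    have := Real.log_le_sub_one_of_pos (show 0 < 1 - g p by linarith [h1 p hp])
    linarith
  have hS0 : 0 ≤ ∑ p ∈ A, g p := sum_nonneg h0
  have haV : 1 ≤ a * ∏ p ∈ A, (1 - g p) := by
    have := mul_le_mul_of_nonneg_right ha hV.le
    rwa [inv_mul_cancel₀ hV.ne'] at this
  have hX : 0 ≤ Real.log a ^ m / m.factorial := by
    have := hS0.trans hS
    positivity
  calc _ ≤ (∑ p ∈ A, g p) ^ m / m.factorial := weightedSum_cardWeight_le m h0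
    _ ≤ Real.log a ^ m / m.factorial := by gcongr
    _ ≤ Real.log a ^ m / m.factorial * (a * ∏ p ∈ A, (1 - g p)) :=
        le_mul_of_one_le_right hX haV
    _ = _ := by ring

/-! ### Squarefree integers and sets of primes -/

lemma mem_primesBelow {z : ℝ} {p : ℕ} : p ∈ primesBelow z ↔ p.Prime ∧ (p : ℝ) < z := by
  simp [primesBelow, Nat.lt_ceil, and_comm]

lemma prod_primes_pos {A : Finset ℕ} (hA : ∀ p ∈ A, p.Prime) : 0 < ∏ p ∈ A, p :=
  prod_pos fun p hp => (hA p hp).pos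

lemma primeFactors_prod_primes {A : Finset ℕ} (hA : ∀ p ∈ A, p.Prime) :
    (∏ p ∈ A, p).primeFactors = A :=
  Nat.primeFactors_prod hA

lemma squarefree_prod_primes {A : Finset ℕ} (hA : ∀ p ∈ A, p.Prime) :
    Squarefree (∏ p ∈ A, p) :=
  squarefree_prod_of_pairwise_isCoprime
    (fun p hp q hq hpq => Nat.coprime_iff_isRelPrime.1
      ((Nat.coprime_primes (hA p hp) (hA q hq)).2 hpq))
    fun p hp => (hA p hp).squarefree

/-- The divisors of a product of distinct primes are the products over subsets. -/
lemma sum_divisors_prod_primes {A : Finset ℕ} (hA : ∀ p ∈ A, p.Prime) (F : ℕ → ℝ) :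
    ∑ d ∈ (∏ p ∈ A, p).divisors, F d = ∑ d ∈ A.powerset, F (∏ p ∈ d, p) := by
  have hsq := squarefree_prod_primes hA
  refine sum_nbij' (fun d => d.primeFactors) (fun d => ∏ p ∈ d, p) ?_ ?_ ?_ ?_ ?_
  · intro d hd
    rw [Nat.mem_divisors] at hd
    have := Nat.primeFactors_mono hd.1 hd.2
    rw [primeFactors_prod_primes hA] at this
    exact mem_powerset.2 this
  · intro d hd
    exact Nat.mem_divisors.2 ⟨prod_dvd_prod_of_subset _ _ _ (mem_powerset.1 hd),
      (prod_primes_pos hA).ne'⟩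
  · intro d hd
    exact Nat.prod_primeFactors_of_squarefree (hsq.squarefree_of_dvd (Nat.dvd_of_mem_divisors hd))
  · intro d hd
    exact primeFactors_prod_primes fun p hp => hA p (mem_powerset.1 hd hp)
  · intro d hd
    rw [Nat.prod_primeFactors_of_squarefree (hsq.squarefree_of_dvd (Nat.dvd_of_mem_divisors hd))]

lemma exists_eq_prod_of_dvd_prod_primes {A : Finset ℕ} (hA : ∀ p ∈ A, p.Prime) {n : ℕ}
    (hn : n ∣ ∏ p ∈ A, p) : ∃ N ⊆ A, n = ∏ p ∈ N, p := by
  have hsq := squarefree_prod_primes hA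
  refine ⟨n.primeFactors, ?_, (Nat.prod_primeFactors_of_squarefree
    (hsq.squarefree_of_dvd hn)).symm⟩
  have := Nat.primeFactors_mono hn (prod_primes_pos hA).ne'
  rwa [primeFactors_prod_primes hA] at this

/-- For the indicator function of `N` the main term is the divisor sum of the weights at `N`. -/
lemma weightedSum_indicator (w : Finset ℕ → ℝ) {A N : Finset ℕ} (hN : N ⊆ A) :
    weightedSum w A (fun p => if p ∈ N then 1 else 0) = ∑ d ∈ N.powerset, w d := by
  unfold weightedSum
  rw [← sum_subset (powerset_mono.2 hN)]
  · refine sum_congr rfl fun d hd => ?_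
    rw [prod_eq_one, mul_one]
    intro p hp
    simp [mem_powerset.1 hd hp]
  · intro d _ hd
    rw [mem_powerset, not_subset] at hd
    obtain ⟨p, hp, hpN⟩ := hd
    rw [prod_eq_zero hp (by simp [hpN]), mul_zero]

/-! ### The decomposition of the primes into blocks -/

/-- The primes in `[z ^ ((3/5) ^ (j + 1)), z ^ ((3/5) ^ j))`. -/
noncomputable def sieveBlock (z : ℝ) (j : ℕ) : Finset ℕ :=
  (primesBelow (z ^ ((3 / 5 : ℝ) ^ j))).filter fun p : ℕ => z ^ ((3 / 5 : ℝ) ^ (j + 1)) ≤ (p : ℝ)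

/-- Half the number of primes that the weights allow in the block `j`: the sequence
`1, 2, 2, 2, 2, 3, 3, 3, 3, …`. -/
def blockSize (j : ℕ) : ℕ := 1 + (j + 3) / 4

lemma mem_sieveBlock {z : ℝ} {j p : ℕ} : p ∈ sieveBlock z j ↔
    p.Prime ∧ (p : ℝ) < z ^ ((3 / 5 : ℝ) ^ j) ∧ z ^ ((3 / 5 : ℝ) ^ (j + 1)) ≤ (p : ℝ) := by
  simp [sieveBlock, mem_primesBelow, and_assoc]

lemma rpow_ratio_pow_antitone {z : ℝ} (hz : 1 ≤ z) :
    Antitone fun j : ℕ => z ^ ((3 / 5 : ℝ) ^ j) := fun _ _ hij =>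
  Real.rpow_le_rpow_of_exponent_le hz (pow_le_pow_of_le_one (by norm_num) (by norm_num) hij)

lemma disjoint_sieveBlock {z : ℝ} (hz : 1 ≤ z) (i j : ℕ) (hij : i ≠ j) :
    Disjoint (sieveBlock z i) (sieveBlock z j) := by
  wlog h : i < j generalizing i j
  · exact (this j i hij.symm (by omega)).symm
  rw [disjoint_left]
  intro p hp hq
  rw [mem_sieveBlock] at hp hq
  have := rpow_ratio_pow_antitone hz (show i + 1 ≤ j from h)
  linarith [hp.2.2, hq.2.1]

lemma mem_blockUnion_sieveBlock {z : ℝ} (hz : 1 ≤ z) {r p : ℕ} :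
    p ∈ blockUnion (sieveBlock z) r
      ↔ p.Prime ∧ (p : ℝ) < z ∧ z ^ ((3 / 5 : ℝ) ^ r) ≤ (p : ℝ) := by
  induction r with
  | zero =>
    simp only [blockUnion, range_zero, biUnion_empty, notMem_empty, pow_zero, Real.rpow_one,
      false_iff]
    rintro ⟨-, h1, h2⟩
    linarith
  | succ r ih =>
    rw [blockUnion, range_add_one, biUnion_insert, mem_union, ih, mem_sieveBlock]
    have h1 := rpow_ratio_pow_antitone hz (Nat.le_succ r)
    have h2 := rpow_ratio_pow_antitone hz (Nat.zero_le r)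
    simp only [pow_zero, Real.rpow_one, Nat.succ_eq_add_one] at h1 h2
    constructor
    · rintro (⟨a, b, c⟩ | ⟨a, b, c⟩)
      · exact ⟨a, by linarith, c⟩
      · exact ⟨a, b, by linarith⟩
    · rintro ⟨a, b, c⟩
      rcases lt_or_ge (p : ℝ) (z ^ ((3 / 5 : ℝ) ^ r)) with h | h
      · exact Or.inl ⟨a, h, c⟩
      · exact Or.inr ⟨a, b, h⟩

/-- Finitely many blocks exhaust the primes below `z`. -/
lemma exists_blockUnion_eq {z : ℝ} (hz : 1 ≤ z) :
    ∃ r, blockUnion (sieveBlock z) r = primesBelow z := by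
  have h : Filter.Tendsto (fun r : ℕ => z ^ ((3 / 5 : ℝ) ^ r)) Filter.atTop (nhds (z ^ (0 : ℝ))) :=
    (Real.continuousAt_const_rpow (by positivity)).tendsto.comp
      (tendsto_pow_atTop_nhds_zero_of_lt_one (by norm_num) (by norm_num))
  rw [Real.rpow_zero] at h
  obtain ⟨r, hr⟩ := (h.eventually (gt_mem_nhds one_lt_two)).exists
  refine ⟨r, ext fun p => ?_⟩
  rw [mem_blockUnion_sieveBlock hz, mem_primesBelow]
  refine ⟨fun h => ⟨h.1, h.2.1⟩, fun h => ⟨h.1, h.2, ?_⟩⟩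
  have : (2 : ℝ) ≤ p := by exact_mod_cast h.1.two_le
  linarith

/-! ### The level of the weights -/

/-- The exponents of the blocks, counted with the number of primes allowed in them, add up to a
constant; `(5/4 j + 85/8) (3/5)^j` majorises the tail of the series. -/
lemma sum_blockSize_le (r : ℕ) :
    ∑ j ∈ range r, 2 * (blockSize j : ℝ) * (3 / 5 : ℝ) ^ j ≤ 43 / 5 - 1 / 20 := by
  have key : ∀ n : ℕ, ∑ j ∈ range (n + 5), 2 * (blockSize j : ℝ) * (3 / 5 : ℝ) ^ j
      + (5 / 4 * (n + 5 : ℝ) + 85 / 8) * (3 / 5 : ℝ) ^ (n + 5) ≤ 43 / 5 - 1 / 20 := by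
    intro n
    induction n with
    | zero => norm_num [sum_range_succ, blockSize]
    | succ n ih =>
      rw [show n + 1 + 5 = n + 5 + 1 by ring, sum_range_succ]
      have hb : (blockSize (n + 5) : ℝ) ≤ 1 + (n + 5 + 3) / 4 := by
        have := @Nat.cast_div_le ℝ _ _ _ (n + 5 + 3) 4
        unfold blockSize
        push_cast at this ⊢
        linarith
      have hq : 0 ≤ (3 / 5 : ℝ) ^ (n + 5) := by positivity
      have := mul_le_mul_of_nonneg_right hb hq
      rw [pow_succ _ (n + 5)]
      push_cast
      linarith
  refine le_trans (sum_le_sum_of_subset_of_nonneg (range_mono (Nat.le_add_right r 5))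
    fun _ _ _ => by positivity) (le_trans ?_ (key r))
  have : 0 ≤ (5 / 4 * (r + 5 : ℝ) + 85 / 8) * (3 / 5 : ℝ) ^ (r + 5) := by positivity
  linarith

lemma prod_lt_level {z : ℝ} (hz : 1 < z) {r : ℕ} {d : Finset ℕ}
    (hd : d ⊆ blockUnion (sieveBlock z) r)
    (h : ∃ l, ∀ j < r, (d ∩ sieveBlock z j).card ≤ 2 * blockSize j + if j = l then 1 else 0) :
    ((∏ p ∈ d, p : ℕ) : ℝ) < z ^ (48 / 5 : ℝ) := by
  obtain ⟨l, hl⟩ := h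
  have hz0 : 0 < z := by linarith
  have hdU : d = (range r).biUnion fun j => d ∩ sieveBlock z j := by
    rw [← inter_biUnion]
    exact (inter_eq_left.2 hd).symm
  have hprod : ((∏ p ∈ d, p : ℕ) : ℝ) = ∏ j ∈ range r, ∏ p ∈ d ∩ sieveBlock z j, (p : ℝ) := by
    rw [← prod_biUnion, ← hdU]
    · push_cast; rfl
    · intro i _ j _ hij
      exact disjoint_of_subset_left inter_subset_right
        (disjoint_of_subset_right inter_subset_right (disjoint_sieveBlock hz.le i j hij))
  rw [hprod]
  calc ∏ j ∈ range r, ∏ p ∈ d ∩ sieveBlock z j, (p : ℝ)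
      ≤ ∏ j ∈ range r, z ^ ((3 / 5 : ℝ) ^ j * (2 * (blockSize j : ℝ) + if j = l then 1 else 0)) := by
        refine prod_le_prod (fun _ _ => by positivity) fun j hj => ?_
        calc ∏ p ∈ d ∩ sieveBlock z j, (p : ℝ) ≤ (z ^ ((3 / 5 : ℝ) ^ j)) ^ (d ∩ sieveBlock z j).card :=
              (prod_le_prod (fun _ _ => by positivity) fun p hp =>
                (mem_sieveBlock.1 (mem_of_mem_inter_right hp)).2.1.le).trans_eq (prod_const _)
          _ = z ^ ((3 / 5 : ℝ) ^ j * ((d ∩ sieveBlock z j).card : ℝ)) := by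
              rw [Real.rpow_mul_natCast hz0.le]
          _ ≤ _ := by
              refine Real.rpow_le_rpow_of_exponent_le hz.le ?_
              gcongr
              have := hl j (mem_range.1 hj)
              have h2 : (((d ∩ sieveBlock z j).card : ℕ) : ℝ)
                ≤ ((2 * blockSize j + if j = l then 1 else 0 : ℕ) : ℝ) := by exact_mod_cast this
              refine h2.trans (le_of_eq ?_)
              push_cast
              rfl
    _ = z ^ (∑ j ∈ range r, (3 / 5 : ℝ) ^ j * (2 * (blockSize j : ℝ) + if j = l then 1 else 0)) :=
        (Real.rpow_sum_of_pos hz0 _ _).symm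
    _ < z ^ (48 / 5 : ℝ) := by
        refine Real.rpow_lt_rpow_of_exponent_lt hz ?_
        have e1 : ∑ j ∈ range r, (3 / 5 : ℝ) ^ j * (if j = l then (1 : ℝ) else 0) ≤ 1 := by
          simp only [mul_ite, mul_one, mul_zero, sum_ite_eq']
          split_ifs
          · exact pow_le_one₀ (by norm_num) (by norm_num)
          · norm_num
        have e2 := sum_blockSize_le r
        have e3 : ∑ j ∈ range r, (3 / 5 : ℝ) ^ j * (2 * (blockSize j : ℝ) + if j = l then 1 else 0)
            = ∑ j ∈ range r, 2 * (blockSize j : ℝ) * (3 / 5 : ℝ) ^ j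
              + ∑ j ∈ range r, (3 / 5 : ℝ) ^ j * (if j = l then (1 : ℝ) else 0) := by
          rw [← sum_add_distrib]
          exact sum_congr rfl fun j _ => by ring
        rw [e3]
        linarith

/-! ### The losses in the blocks -/

/-- A bound for the products of the `(1 - g p)⁻¹` over the block `j`, for a density of dimension `κ`
with constant `L`. -/
noncomputable def blockRatio (κ L z : ℝ) (j : ℕ) : ℝ :=
  (5 / 3 : ℝ) ^ κ * (1 + max L 0 / Real.log (max 2 (z ^ ((3 / 5 : ℝ) ^ (j + 1)))))

/-- The bound for the relative loss in a block with ratio `a` and index `j`. -/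
noncomputable def blockLoss (a : ℝ) (j : ℕ) : ℝ :=
  a * Real.log a ^ (2 * blockSize j + 1) / (2 * blockSize j + 1).factorial

lemma log_max_two_ge (x : ℝ) : Real.log 2 ≤ Real.log (max 2 x) :=
  Real.log_le_log two_pos (le_max_left _ _)

lemma one_le_blockRatio {κ : ℝ} (hκ : 0 ≤ κ) (L z : ℝ) (j : ℕ) : 1 ≤ blockRatio κ L z j := by
  have h1 : 0 < Real.log (max 2 (z ^ ((3 / 5 : ℝ) ^ (j + 1)))) :=
    (Real.log_pos one_lt_two).trans_le (log_max_two_ge _)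
  have h2 : (1 : ℝ) ≤ (5 / 3 : ℝ) ^ κ := Real.one_le_rpow (by norm_num) hκ
  have h3 : 0 ≤ max L 0 / Real.log (max 2 (z ^ ((3 / 5 : ℝ) ^ (j + 1)))) := by positivity
  exact one_le_mul_of_one_le_of_one_le h2 (by linarith)

lemma blockRatio_le (κ L z : ℝ) (j : ℕ) :
    blockRatio κ L z j ≤ (5 / 3 : ℝ) ^ κ * (1 + max L 0 / Real.log 2) := by
  unfold blockRatio
  have h1 := log_max_two_ge (z ^ ((3 / 5 : ℝ) ^ (j + 1)))
  have := Real.log_pos one_lt_two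
  gcongr

lemma prod_sieveBlock_le {κ L : ℝ} (hκ : 0 ≤ κ) {g : ℕ → ℝ} (hg : IsSieveDensity κ L g) {z : ℝ}
    (hz : 1 < z) (j : ℕ) : ∏ p ∈ sieveBlock z j, (1 - g p)⁻¹ ≤ blockRatio κ L z j := by
  set u := z ^ ((3 / 5 : ℝ) ^ j) with hu
  set w := max 2 (z ^ ((3 / 5 : ℝ) ^ (j + 1))) with hw
  have hlw : 0 < Real.log w := (Real.log_pos one_lt_two).trans_le (log_max_two_ge _)
  have hsub : sieveBlock z j = (primesBelow u).filter fun p : ℕ => w ≤ (p : ℝ) := by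
    ext p
    rw [mem_sieveBlock, mem_filter, mem_primesBelow, hw, max_le_iff]
    constructor
    · rintro ⟨a, b, c⟩
      exact ⟨⟨a, b⟩, by exact_mod_cast a.two_le, c⟩
    · rintro ⟨⟨a, b⟩, -, c⟩
      exact ⟨a, b, c⟩
  rcases lt_or_ge w u with h | h
  · rw [hsub]
    refine (hg.dimension w u (le_max_left _ _) h).trans ?_
    unfold blockRatio
    rw [← hw]
    have hz0 : 0 < Real.log z := Real.log_pos hz
    have hlu : Real.log u = (3 / 5 : ℝ) ^ j * Real.log z := Real.log_rpow (by linarith) _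
    have hlw' : (3 / 5 : ℝ) ^ (j + 1) * Real.log z ≤ Real.log w := by
      rw [← Real.log_rpow (by linarith)]
      exact Real.log_le_log (Real.rpow_pos_of_pos (by linarith) _) (le_max_right _ _)
    have h0 : 0 ≤ Real.log u := by rw [hlu]; positivity
    refine mul_le_mul (Real.rpow_le_rpow (by positivity) ?_ hκ) ?_ ?_ (by positivity)
    · rw [div_le_iff₀ hlw, hlu]
      rw [pow_succ] at hlw'
      linarith
    · gcongr
      exact le_max_left _ _
    · by_contra! hneg
      have e1 := hg.dimension w u (le_max_left _ _) h
      have e2 : 0 < ∏ p ∈ (primesBelow u).filter (fun p : ℕ => w ≤ (p : ℝ)), (1 - g p)⁻¹ :=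
        prod_pos fun p hp => inv_pos.2 (by
          have := hg.lt_one p (mem_primesBelow.1 (mem_filter.1 hp).1).1
          linarith)
      have e3 : 0 ≤ (Real.log u / Real.log w) ^ κ := by positivity
      nlinarith
  · have : sieveBlock z j = ∅ := by
      rw [hsub, filter_eq_empty_iff]
      intro p hp
      have := (mem_primesBelow.1 hp).2
      linarith
    rw [this, prod_empty]
    exact one_le_blockRatio hκ L z j

lemma blockLoss_nonneg {a : ℝ} (ha : 1 ≤ a) (j : ℕ) : 0 ≤ blockLoss a j := by
  have := Real.log_nonneg ha
  unfold blockLoss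
  positivity

lemma blockLoss_mono {a b : ℝ} (ha : 1 ≤ a) (hab : a ≤ b) (j : ℕ) :
    blockLoss a j ≤ blockLoss b j := by
  have := Real.log_nonneg ha
  have := Real.log_le_log (by linarith) hab
  have : 0 ≤ b := by linarith
  unfold blockLoss
  gcongr

lemma blockLoss_le {a : ℝ} (ha : 1 ≤ a) (j : ℕ) :
    blockLoss a j ≤ a * Real.exp (4 * Real.log a) * (1 / 2 : ℝ) ^ j := by
  set x := Real.log a with hx
  have hx0 : 0 ≤ x := Real.log_nonneg ha
  set n := 2 * blockSize j + 1 with hn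
  have h1 : (4 * x) ^ n / n.factorial ≤ Real.exp (4 * x) :=
    Real.pow_div_factorial_le_exp _ (by positivity) n
  have h2 : (2 : ℝ) ^ j ≤ 4 ^ n := by
    rw [show (4 : ℝ) = 2 ^ 2 by norm_num, ← pow_mul]
    exact pow_le_pow_right₀ (by norm_num) (by unfold blockSize at hn; omega)
  have h3 : x ^ n / n.factorial ≤ Real.exp (4 * x) * (1 / 2 : ℝ) ^ j := by
    have h4 : x ^ n / n.factorial = (4 * x) ^ n / n.factorial / 4 ^ n := by
      rw [mul_pow]; field_simp
    rw [h4, one_div, inv_pow, ← div_eq_mul_inv]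
    gcongr
  unfold blockLoss
  rw [mul_div_assoc, mul_assoc]
  exact mul_le_mul_of_nonneg_left h3 (by linarith)

lemma summable_blockLoss {a : ℝ} (ha : 1 ≤ a) : Summable (blockLoss a) :=
  Summable.of_nonneg_of_le (blockLoss_nonneg ha) (blockLoss_le ha)
    (summable_geometric_two.mul_left _)

/-- In dimension two the total loss is less than one. -/
lemma tsum_blockLoss_lt : ∑' j, blockLoss ((5 / 3 : ℝ) ^ (2 : ℝ)) j < 19 / 20 := by
  have ha : (5 / 3 : ℝ) ^ (2 : ℝ) = 25 / 9 := by norm_num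
  rw [ha]
  set x := Real.log (25 / 9 : ℝ) with hx
  have hx0 : 0 ≤ x := Real.log_nonneg (by norm_num)
  have hx1 : x ≤ 103 / 100 := by
    rw [hx, Real.log_le_iff_le_exp (by norm_num)]
    have h1 := Real.exp_one_gt_d9
    have h2 := Real.add_one_le_exp (3 / 100 : ℝ)
    rw [show (103 / 100 : ℝ) = 1 + 3 / 100 by norm_num, Real.exp_add]
    nlinarith
  have hpow : ∀ m : ℕ, x ^ (2 * m + 5) / (2 * m + 5).factorial ≤ x ^ 5 / 120 / 16 ^ m := by
    intro m
    induction m with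
    | zero => norm_num [Nat.factorial]
    | succ m ih =>
      have e : x ^ (2 * (m + 1) + 5) / ((2 * (m + 1) + 5).factorial : ℝ)
          = x ^ (2 * m + 5) / (2 * m + 5).factorial * (x ^ 2 / ((2 * m + 7) * (2 * m + 6))) := by
        rw [show 2 * (m + 1) + 5 = 2 * m + 5 + 1 + 1 by ring, Nat.factorial_succ,
          Nat.factorial_succ, pow_succ, pow_succ]
        push_cast
        have : ((2 * m + 5).factorial : ℝ) ≠ 0 := by positivity
        field_simp
        ring
      have e2 : x ^ 2 / ((2 * m + 7) * (2 * m + 6) : ℝ) ≤ 1 / 16 := by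
        rw [div_le_div_iff₀ (by positivity) (by norm_num)]
        have : (0 : ℝ) ≤ m := m.cast_nonneg
        nlinarith
      rw [e, pow_succ (16 : ℝ), ← div_div (x ^ 5 / 120), div_eq_mul_one_div _ (16 : ℝ)]
      exact mul_le_mul ih e2 (by positivity) (by positivity)
  have htail : ∀ i : ℕ, blockLoss (25 / 9 : ℝ) (i + 1) ≤ 25 / 9 * x ^ 5 / 15 * (1 / 2 : ℝ) ^ i := by
    intro i
    have e : 2 * blockSize (i + 1) + 1 = 2 * (i / 4) + 5 := by unfold blockSize; omega
    have e3 : (2 : ℝ) ^ i ≤ 8 * 16 ^ (i / 4) := by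
      rw [show (8 : ℝ) = 2 ^ 3 by norm_num, show (16 : ℝ) = 2 ^ 4 by norm_num, ← pow_mul, ← pow_add]
      exact pow_le_pow_right₀ (by norm_num) (by omega)
    unfold blockLoss
    rw [e, ← hx, mul_div_assoc]
    calc 25 / 9 * (x ^ (2 * (i / 4) + 5) / ((2 * (i / 4) + 5).factorial : ℝ))
        ≤ 25 / 9 * (x ^ 5 / 120 / 16 ^ (i / 4)) :=
          mul_le_mul_of_nonneg_left (hpow _) (by norm_num)
      _ = 25 / 9 * x ^ 5 / 15 / (8 * 16 ^ (i / 4)) := by field_simp; ring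
      _ ≤ 25 / 9 * x ^ 5 / 15 / 2 ^ i := by gcongr
      _ = _ := by rw [one_div, inv_pow, div_eq_mul_inv]
  have hs := summable_blockLoss (show (1 : ℝ) ≤ 25 / 9 by norm_num)
  rw [hs.tsum_eq_zero_add]
  have h1 : ∑' i, blockLoss (25 / 9 : ℝ) (i + 1) ≤ 25 / 9 * x ^ 5 / 15 * 2 := by
    rw [← tsum_geometric_two, ← tsum_mul_left]
    exact ((summable_nat_add_iff 1).2 hs).tsum_le_tsum htail (summable_geometric_two.mul_left _)
  have h0 : blockLoss (25 / 9 : ℝ) 0 = 25 / 9 * x ^ 3 / 6 := by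
    simp [blockLoss, blockSize, Nat.factorial, ← hx]
  have h3 : x ^ 3 ≤ (103 / 100) ^ 3 := by gcongr
  have h5 : x ^ 5 ≤ (103 / 100) ^ 5 := by gcongr
  rw [h0]
  norm_num at h3 h5 ⊢
  linarith

lemma tendsto_blockRatio (κ L : ℝ) (j : ℕ) :
    Filter.Tendsto (fun z => blockRatio κ L z j) Filter.atTop (nhds ((5 / 3 : ℝ) ^ κ)) := by
  have h1 : Filter.Tendsto (fun z : ℝ => max 2 (z ^ ((3 / 5 : ℝ) ^ (j + 1)))) Filter.atTop
      Filter.atTop :=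
    Filter.tendsto_atTop_mono (fun z => le_max_right _ _) (tendsto_rpow_atTop (by positivity))
  have h2 := ((Real.tendsto_log_atTop.comp h1).const_div_atTop (max L 0)).const_add 1
  have h3 := h2.const_mul ((5 / 3 : ℝ) ^ κ)
  simpa [blockRatio] using h3

lemma eventually_sum_blockLoss_le (L : ℝ) :
    ∃ z₀ : ℝ, ∀ z ≥ z₀, ∀ r, ∑ j ∈ range r, blockLoss (blockRatio 2 L z j) j ≤ 19 / 20 := by
  set A := (5 / 3 : ℝ) ^ (2 : ℝ) * (1 + max L 0 / Real.log 2) with hA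
  have h1 : ∀ z j, 1 ≤ blockRatio 2 L z j := one_le_blockRatio (by norm_num) L
  have hA1 : 1 ≤ A := (h1 0 0).trans (blockRatio_le 2 L 0 0)
  have hle : ∀ z j, blockLoss (blockRatio 2 L z j) j ≤ blockLoss A j := fun z j =>
    blockLoss_mono (h1 z j) (blockRatio_le 2 L z j) j
  have key : Filter.Tendsto (fun z : ℝ => ∑' j, blockLoss (blockRatio 2 L z j) j) Filter.atTop
      (nhds (∑' j, blockLoss ((5 / 3 : ℝ) ^ (2 : ℝ)) j)) := by
    refine tendsto_tsum_of_dominated_convergence (summable_blockLoss hA1) (fun j => ?_)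
      (Filter.Eventually.of_forall fun z j => ?_)
    · have hc : ContinuousAt (fun a => blockLoss a j) ((5 / 3 : ℝ) ^ (2 : ℝ)) := by
        unfold blockLoss
        have : ((5 / 3 : ℝ) ^ (2 : ℝ)) ≠ 0 := by positivity
        fun_prop (disch := assumption)
      exact hc.tendsto.comp (tendsto_blockRatio 2 L j)
    · rw [Real.norm_of_nonneg (blockLoss_nonneg (h1 z j) j)]
      exact hle z j
  obtain ⟨z₀, h⟩ := Filter.eventually_atTop.1 (key.eventually (gt_mem_nhds tsum_blockLoss_lt))
  refine ⟨z₀, fun z hz r => le_trans ?_ (h z hz).le⟩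
  exact Summable.sum_le_tsum _ (fun j _ => blockLoss_nonneg (h1 z j) j)
    (Summable.of_nonneg_of_le (fun j => blockLoss_nonneg (h1 z j) j) (hle z)
      (summable_blockLoss hA1))

lemma sum_blockLoss_le {κ : ℝ} (hκ : 0 ≤ κ) (L z : ℝ) (r : ℕ) :
    ∑ j ∈ range r, blockLoss (blockRatio κ L z j) j
      ≤ ∑' j, blockLoss ((5 / 3 : ℝ) ^ κ * (1 + max L 0 / Real.log 2)) j := by
  have h1 : ∀ z j, 1 ≤ blockRatio κ L z j := one_le_blockRatio hκ L
  have hA1 := (h1 0 0).trans (blockRatio_le κ L 0 0)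
  refine (sum_le_sum fun j _ => blockLoss_mono (h1 z j) (blockRatio_le κ L z j) j).trans ?_
  exact Summable.sum_le_tsum _ (fun j _ => blockLoss_nonneg hA1 j) (summable_blockLoss hA1)

/-! ### The lower and the upper bound sieve -/

lemma cardWeight_sieveBlock_le {κ L : ℝ} (hκ : 0 ≤ κ) {g : ℕ → ℝ} (hg : IsSieveDensity κ L g)
    {z : ℝ} (hz : 1 < z) (j : ℕ) :
    weightedSum (cardWeight (2 * blockSize j + 1)) (sieveBlock z j) g
      ≤ blockLoss (blockRatio κ L z j) j * ∏ p ∈ sieveBlock z j, (1 - g p) :=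
  weightedSum_cardWeight_le_of_prod_inv_le _ (fun p hp => hg.nonneg p (mem_sieveBlock.1 hp).1)
    (fun p hp => hg.lt_one p (mem_sieveBlock.1 hp).1) (prod_sieveBlock_le hκ hg hz j)

/-- The Brun–Hooley sieve of dimension two has a positive main term at level `z ^ 9.6`. -/
theorem sievePositiveAt_two : SievePositiveAt 2 (48 / 5) := by
  intro L
  obtain ⟨z₀, hz₀⟩ := eventually_sum_blockLoss_le L
  refine ⟨1 / 20, by norm_num, 0, max z₀ 2, fun z hz g hg => ?_⟩
  have hz1 : 1 < z := lt_of_lt_of_le (by norm_num) ((le_max_right _ _).trans hz)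
  have hI := disjoint_sieveBlock hz1.le
  obtain ⟨r, hr⟩ := exists_blockUnion_eq hz1.le
  have hA : ∀ p ∈ primesBelow z, p.Prime := fun p hp => (mem_primesBelow.1 hp).1
  set W := lowerWeight (sieveBlock z) blockSize r with hW
  refine ⟨fun d => W d.primeFactors, ⟨?_, ?_, ?_⟩, ?_⟩
  · intro d hd hD
    obtain ⟨N, hN, rfl⟩ := exists_eq_prod_of_dvd_prod_primes hA hd
    rw [primeFactors_prod_primes fun p hp => hA p (hN hp)]
    by_contra hne
    have := prod_lt_level hz1 (hr ▸ hN) (card_inter_le_of_lowerWeight_ne_zero hne)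
    linarith
  · intro d _
    simpa using abs_lowerWeight_le (sieveBlock z) blockSize r d.primeFactors
  · intro n hn
    obtain ⟨N, hN, rfl⟩ := exists_eq_prod_of_dvd_prod_primes hA hn
    have hNp : ∀ p ∈ N, p.Prime := fun p hp => hA p (hN hp)
    rw [sum_divisors_prod_primes hNp (fun d => W d.primeFactors)]
    have e : ∑ d ∈ N.powerset, W (∏ p ∈ d, p).primeFactors = ∑ d ∈ N.powerset, W d :=
      sum_congr rfl fun d hd => by
        rw [primeFactors_prod_primes fun p hp => hNp p (mem_powerset.1 hd hp)]
    rw [e, ← weightedSum_indicator W hN, ← hr]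
    rcases N.eq_empty_or_nonempty with rfl | ⟨p, hp⟩
    · rw [prod_empty, if_pos rfl, weightedSum_lowerWeight_eq_one hI]
      simp
    · have hne : ∏ p ∈ N, p ≠ 1 := by
        intro h1
        have := Finset.dvd_prod_of_mem (fun p => p) hp
        rw [h1, Nat.dvd_one] at this
        exact (hNp p hp).one_lt.ne' this
      rw [if_neg hne]
      refine weightedSum_lowerWeight_nonpos hI _ _ (fun p _ => ?_) (fun p _ => ?_)
        ⟨p, hr ▸ hN hp, by simp [hp]⟩ <;> split_ifs <;> norm_num
  · rw [sievePrimorial, sum_divisors_prod_primes hA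
      (fun d => W d.primeFactors * ∏ p ∈ d.primeFactors, g p)]
    have e : ∑ d ∈ (primesBelow z).powerset, W (∏ p ∈ d, p).primeFactors
        * ∏ p ∈ (∏ p ∈ d, p).primeFactors, g p = weightedSum W (primesBelow z) g :=
      sum_congr rfl fun d hd => by
        rw [primeFactors_prod_primes fun p hp => hA p (mem_powerset.1 hd hp)]
    rw [e, ← hr]
    have hp : ∀ p ∈ blockUnion (sieveBlock z) r, p.Prime := fun p hp => hA p (hr ▸ hp)
    refine le_weightedSum_lowerWeight hI blockSize r (by norm_num)
      (fun p h => hg.nonneg p (hp p h)) (fun p h => (hg.lt_one p (hp p h)).le)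
      (t := fun j => blockLoss (blockRatio 2 L z j) j)
      (fun j _ => cardWeight_sieveBlock_le (by norm_num) hg hz1 j)
      (fun j _ => blockLoss_nonneg (one_le_blockRatio (by norm_num) L z j) j) ?_
    have := hz₀ z ((le_max_left _ _).trans hz) r
    linarith

/-- The upper bound sieve of level `z ^ 9.6`: in every dimension its main term is at most a constant
times the product of the `1 - g p`. -/
theorem exists_upper_bound_sieve {κ : ℝ} (hκ : 0 ≤ κ) (L : ℝ) :
    ∃ C : ℝ, 0 < C ∧ ∀ z : ℝ, 1 < z → ∃ w : Finset ℕ → ℝ, (∀ d, |w d| ≤ 1) ∧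
      (∀ d ⊆ primesBelow z, w d ≠ 0 → ((∏ p ∈ d, p : ℕ) : ℝ) < z ^ (48 / 5 : ℝ)) ∧
      (∀ N ⊆ primesBelow z, (if N = ∅ then (1 : ℝ) else 0) ≤ ∑ d ∈ N.powerset, w d) ∧
      ∀ g : ℕ → ℝ, IsSieveDensity κ L g →
        weightedSum w (primesBelow z) g ≤ C * ∏ p ∈ primesBelow z, (1 - g p) := by
  refine ⟨Real.exp (∑' j, blockLoss ((5 / 3 : ℝ) ^ κ * (1 + max L 0 / Real.log 2)) j),
    Real.exp_pos _, fun z hz1 => ?_⟩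
  have hI := disjoint_sieveBlock hz1.le
  obtain ⟨r, hr⟩ := exists_blockUnion_eq hz1.le
  have hA : ∀ p ∈ primesBelow z, p.Prime := fun p hp => (mem_primesBelow.1 hp).1
  refine ⟨upperWeight (sieveBlock z) blockSize r, abs_upperWeight_le _ _ _, ?_, ?_, ?_⟩
  · intro d hd hne
    exact prod_lt_level hz1 (hr ▸ hd) ⟨0, fun j hj =>
      (card_inter_le_of_upperWeight_ne_zero hne j hj).trans (Nat.le_add_right _ _)⟩
  · intro N hN
    rw [← weightedSum_indicator _ hN, ← hr]
    refine le_trans ?_ (prod_le_weightedSum_upperWeight hI blockSize r ?_ ?_)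
    · split_ifs with h
      · simp [h]
      · exact prod_nonneg fun p _ => by split_ifs <;> norm_num
    · intro p _; split_ifs <;> norm_num
    · intro p _; split_ifs <;> norm_num
  · intro g hg
    rw [← hr]
    have hp : ∀ p ∈ blockUnion (sieveBlock z) r, p.Prime := fun p hp => hA p (hr ▸ hp)
    exact weightedSum_upperWeight_le hI blockSize r (fun p h => hg.nonneg p (hp p h))
      (fun p h => (hg.lt_one p (hp p h)).le) (t := fun j => blockLoss (blockRatio κ L z j) j)
      (fun j _ => cardWeight_sieveBlock_le hκ hg hz1 j) (sum_blockLoss_le hκ L z r)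

/-! ### Mertens' theorems -/

/-- The sum of `log p / p` over the primes `p ≤ n`. -/
noncomputable def primeLogSum (n : ℕ) : ℝ :=
  ∑ k ∈ range (n + 1), if k.Prime then Real.log k / k else 0

lemma log_factorial_eq_sum (n : ℕ) : Real.log (n.factorial : ℝ)
    = ∑ p ∈ (range (n + 1)).filter Nat.Prime, (n.factorial.factorization p : ℝ) * Real.log p := by
  rw [Real.log_nat_eq_sum_factorization, Finsupp.sum]
  refine sum_subset (fun p hp => ?_) fun p _ hp => ?_
  · rw [Nat.support_factorization, Nat.mem_primeFactors] at hp
    rw [mem_filter, mem_range, Nat.lt_succ_iff]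
    exact ⟨(hp.1.dvd_factorial).1 hp.2.1, hp.1⟩
  · rw [Finsupp.notMem_support_iff] at hp
    simp [hp]

lemma primeLogSum_eq (n : ℕ) :
    primeLogSum n = ∑ p ∈ (range (n + 1)).filter Nat.Prime, Real.log p / p :=
  (sum_filter _ _).symm

lemma summable_log_div_sq : ∃ K : ℝ, ∀ S : Finset ℕ, (∀ p ∈ S, p.Prime) →
    ∑ p ∈ S, Real.log p / (p * (p - 1)) ≤ K := by
  have hs : Summable fun n : ℕ => 4 * (1 / (n : ℝ) ^ (3 / 2 : ℝ)) :=
    (Real.summable_one_div_nat_rpow.2 (by norm_num)).mul_left 4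
  refine ⟨_, fun S hS => le_trans (sum_le_sum fun p hp => ?_)
    (hs.sum_le_tsum S fun n _ => by positivity)⟩
  have h2 : (2 : ℝ) ≤ p := by exact_mod_cast (hS p hp).two_le
  have hp0 : (0 : ℝ) < p := by linarith
  have h1 : Real.log p ≤ (p : ℝ) ^ (1 / 2 : ℝ) / (1 / 2) :=
    Real.log_le_rpow_div hp0.le (by norm_num)
  have h3 : (p : ℝ) ^ (1 / 2 : ℝ) * (p : ℝ) ^ (3 / 2 : ℝ) = p * p := by
    rw [← Real.rpow_add hp0]; norm_num [sq]
  have h4 : 0 < (p : ℝ) ^ (3 / 2 : ℝ) := Real.rpow_pos_of_pos hp0 _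
  rw [mul_one_div, div_le_div_iff₀ (by nlinarith) h4]
  nlinarith

/-- Mertens' first theorem. -/
lemma exists_abs_primeLogSum_sub_log_le :
    ∃ C : ℝ, ∀ n : ℕ, 1 ≤ n → |primeLogSum n - Real.log n| ≤ C := by
  obtain ⟨K, hK⟩ := summable_log_div_sq
  refine ⟨max (1 + K) (Real.log 4), fun n hn => ?_⟩
  have hn0 : (0 : ℝ) < n := by exact_mod_cast hn
  set S := (range (n + 1)).filter Nat.Prime with hS
  have hSp : ∀ p ∈ S, p.Prime := fun p hp => (mem_filter.1 hp).2
  have hlogp : ∀ p ∈ S, 0 ≤ Real.log p := fun p _ => Real.log_natCast_nonneg p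
  rw [abs_le]
  constructor
  · have h1 : (n : ℝ) * Real.log n - n ≤ Real.log n.factorial := by
      have := Stirling.le_log_factorial_stirling (show n ≠ 0 by omega)
      have h2 : 0 ≤ Real.log n := Real.log_natCast_nonneg n
      have h3 : 0 ≤ Real.log (2 * Real.pi) :=
        Real.log_nonneg (by linarith [Real.pi_gt_three])
      linarith
    have h2 : Real.log n.factorial ≤ n * (primeLogSum n + K) := by
      rw [log_factorial_eq_sum, primeLogSum_eq]
      calc _ ≤ ∑ p ∈ S, (n : ℝ) * (Real.log p / p + Real.log p / (p * (p - 1))) := by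
            refine sum_le_sum fun p hp => ?_
            have hp2 : (2 : ℝ) ≤ p := by exact_mod_cast (hSp p hp).two_le
            have e1 : (n.factorial.factorization p : ℝ) ≤ n / (p - 1) := by
              have := Nat.factorization_factorial_le_div_pred (hSp p hp) n
              have h4 : ((n / (p - 1) : ℕ) : ℝ) ≤ (n : ℝ) / ((p - 1 : ℕ) : ℝ) := Nat.cast_div_le
              rw [Nat.cast_sub (hSp p hp).one_le, Nat.cast_one] at h4
              exact le_trans (by exact_mod_cast this) h4
            have e2 : Real.log p / p + Real.log p / (p * (p - 1)) = Real.log p / (p - 1) := by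
              have : (p : ℝ) - 1 ≠ 0 := by linarith
              field_simp
              ring
            rw [e2]
            calc _ ≤ (n : ℝ) / (p - 1) * Real.log p :=
                  mul_le_mul_of_nonneg_right e1 (hlogp p hp)
              _ = _ := by ring
        _ = n * (∑ p ∈ S, Real.log p / p + ∑ p ∈ S, Real.log p / (p * (p - 1))) := by
            rw [← mul_sum, sum_add_distrib]
        _ ≤ _ := by
            have := hK S hSp
            gcongr
    have h3 : (n : ℝ) * Real.log n - n ≤ n * (primeLogSum n + K) := h1.trans h2
    have h4 : Real.log n - 1 ≤ primeLogSum n + K := by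
      refine le_of_mul_le_mul_left ?_ hn0
      linarith
    have := le_max_left (1 + K) (Real.log 4)
    linarith
  · have h1 : Real.log n.factorial ≤ n * Real.log n := by
      rw [← Real.log_pow]
      exact Real.log_le_log (by exact_mod_cast n.factorial_pos)
        (by exact_mod_cast Nat.factorial_le_pow n)
    have h2 : n * primeLogSum n - Real.log 4 * n ≤ Real.log n.factorial := by
      have hth : ∑ p ∈ S, Real.log p ≤ Real.log 4 * n := by
        have := Chebyshev.theta_le_log4_mul_x hn0.le
        rw [Chebyshev.theta_eq_sum_Icc, Nat.floor_natCast] at this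
        have e : Icc 0 n = range (n + 1) := by
          ext; simp
        rwa [e] at this
      rw [log_factorial_eq_sum, primeLogSum_eq]
      calc _ ≤ n * ∑ p ∈ S, Real.log p / p - ∑ p ∈ S, Real.log p := by linarith
        _ = ∑ p ∈ S, ((n : ℝ) / p - 1) * Real.log p := by
            rw [mul_sum, ← sum_sub_distrib]
            exact sum_congr rfl fun p _ => by ring
        _ ≤ _ := by
            refine sum_le_sum fun p hp => mul_le_mul_of_nonneg_right ?_ (hlogp p hp)
            have e1 : n / p ≤ n.factorial.factorization p := by
              rw [Nat.factorization_factorial (hSp p hp)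
                (show Nat.log p n < Nat.log p n + 2 by omega)]
              have := single_le_sum (f := fun i => n / p ^ i) (fun _ _ => Nat.zero_le _)
                (show 1 ∈ Ico 1 (Nat.log p n + 2) by simp)
              simpa using this
            have e2 : (n : ℝ) / p < ((n / p : ℕ) : ℝ) + 1 := by
              rw [← Nat.floor_div_eq_div (K := ℝ)]
              exact Nat.lt_floor_add_one _
            have e3 : ((n / p : ℕ) : ℝ) ≤ n.factorial.factorization p := by exact_mod_cast e1
            linarith
    have h4 : primeLogSum n - Real.log 4 ≤ Real.log n := by
      refine le_of_mul_le_mul_left ?_ hn0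
      linarith
    have := le_max_right (1 + K) (Real.log 4)
    linarith

/-- Mertens' second theorem, as an upper bound on intervals: summation by parts against
`1 / log n`. -/
lemma exists_sum_inv_prime_le : ∃ C : ℝ, 0 ≤ C ∧ ∀ w z : ℝ, 2 ≤ w → w < z →
    ∑ p ∈ (primesBelow z).filter (fun p : ℕ => w ≤ (p : ℝ)), 1 / (p : ℝ)
      ≤ Real.log (Real.log z / Real.log w) + C / Real.log w := by
  obtain ⟨C, hC⟩ := exists_abs_primeLogSum_sub_log_le
  have hC0 : 0 ≤ C := (abs_nonneg _).trans (hC 1 le_rfl)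
  refine ⟨4 * C + 1, by positivity, fun w z hw hwz => ?_⟩
  set R : ℕ → ℝ := fun n => primeLogSum n - Real.log n + C with hR
  have hR0 : ∀ n, 1 ≤ n → 0 ≤ R n ∧ R n ≤ 2 * C := fun n hn => by
    have := abs_le.1 (hC n hn)
    constructor <;> simp only [hR] <;> linarith [this.1, this.2]
  set c : ℕ → ℝ := fun n => if n.Prime then 1 / (n : ℝ) else 0 with hc
  have hparts : ∀ a : ℕ, 2 ≤ a → ∀ b, a ≤ b →
      ∑ n ∈ Ioc a b, c n ≤ Real.log (Real.log b / Real.log a) + R b / Real.log b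
        - R a / Real.log a + 2 * C * (1 / Real.log a - 1 / Real.log b) := by
    intro a ha b hab
    have hla : 0 < Real.log a := Real.log_pos (by exact_mod_cast ha)
    induction b, hab using Nat.le_induction with
    | base => simp [div_self hla.ne']
    | succ b hab ih =>
      rw [sum_Ioc_succ_top (by omega)]
      have hb2 : (2 : ℝ) ≤ b := by exact_mod_cast ha.trans hab
      set l := Real.log b with hl
      set l' := Real.log ((b + 1 : ℕ) : ℝ) with hl'
      have hl0 : 0 < l := Real.log_pos (by linarith)
      have hll : l ≤ l' := Real.log_le_log (by linarith) (by push_cast; linarith)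
      have hl0' : 0 < l' := hl0.trans_le hll
      have e1 : c (b + 1) = (R (b + 1) - R b + (l' - l)) / l' := by
        have e : primeLogSum (b + 1) = primeLogSum b
            + if (b + 1).Prime then Real.log ((b + 1 : ℕ) : ℝ) / ((b + 1 : ℕ) : ℝ) else 0 :=
          sum_range_succ _ _
        simp only [hR, hc, e]
        rw [← hl, ← hl']
        split_ifs
        · field_simp
          ring
        · simp
      have e2 : (l' - l) / l' ≤ Real.log (l' / Real.log a) - Real.log (l / Real.log a) := by
        rw [Real.log_div hl0'.ne' hla.ne', Real.log_div hl0.ne' hla.ne']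
        have := Real.log_le_sub_one_of_pos (show 0 < l / l' by positivity)
        rw [Real.log_div hl0.ne' hl0'.ne'] at this
        have e3 : (l' - l) / l' = 1 - l / l' := by field_simp
        rw [e3]
        linarith
      have e3 : R b * (1 / l - 1 / l') ≤ 2 * C * (1 / l - 1 / l') := by
        refine mul_le_mul_of_nonneg_right (hR0 b (by omega)).2 ?_
        rw [sub_nonneg]
        exact one_div_le_one_div_of_le hl0 hll
      have e4 : c (b + 1) = R (b + 1) / l' - R b / l' + (l' - l) / l' := by
        rw [e1]; ring
      have e5 : R b * (1 / l - 1 / l') = R b / l - R b / l' := by ring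
      rw [e4]
      linarith
  have hlw : 0 < Real.log w := Real.log_pos (by linarith)
  have hlz : Real.log w ≤ Real.log z := Real.log_le_log (by linarith) hwz.le
  set a := ⌈w⌉₊ with haw
  set b := ⌈z⌉₊ - 1 with hbz
  have hwa : w ≤ a := Nat.le_ceil w
  have ha2 : 2 ≤ a := by
    have : (2 : ℝ) ≤ a := hw.trans hwa
    exact_mod_cast this
  have hz1 : 1 ≤ ⌈z⌉₊ := Nat.one_le_ceil_iff.2 (by linarith)
  have hsum : ∑ p ∈ (primesBelow z).filter (fun p : ℕ => w ≤ (p : ℝ)), 1 / (p : ℝ)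
      = ∑ n ∈ Icc a b, c n := by
    rw [hc, ← sum_filter]
    refine sum_congr ?_ fun _ _ => rfl
    ext p
    simp only [mem_filter, mem_primesBelow, mem_Icc]
    rw [← Nat.ceil_le, ← Nat.lt_ceil]
    constructor
    · rintro ⟨⟨h1, h2⟩, h3⟩
      exact ⟨⟨h3, by omega⟩, h1⟩
    · rintro ⟨⟨h3, h2⟩, h1⟩
      exact ⟨⟨h1, by omega⟩, h3⟩
  have hlog0 : 0 ≤ Real.log (Real.log z / Real.log w) :=
    Real.log_nonneg ((one_le_div hlw).2 hlz)
  rw [hsum]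
  rcases lt_or_ge b a with hab | hab
  · rw [Icc_eq_empty (by omega), sum_empty]
    positivity
  · have hbz' : (b : ℝ) < z := by
      rw [← Nat.lt_ceil]; omega
    have hla : Real.log w ≤ Real.log a := Real.log_le_log (by linarith) hwa
    have hlb : Real.log a ≤ Real.log b :=
      Real.log_le_log (by linarith) (by exact_mod_cast hab)
    have hbz2 : Real.log b ≤ Real.log z := Real.log_le_log (by
      have : (a : ℝ) ≤ b := by exact_mod_cast hab
      linarith) hbz'.le
    have hla0 : 0 < Real.log a := hlw.trans_le hla
    have hlb0 : 0 < Real.log b := hla0.trans_le hlb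
    have hlz0 : 0 < Real.log z := hlb0.trans_le hbz2
    rw [← add_sum_Ioc_eq_sum_Icc hab]
    have h1 := hparts a ha2 b hab
    have h2 : c a ≤ 1 / Real.log w := by
      have h3 : Real.log a ≤ a := (Real.log_le_sub_one_of_pos (by linarith)).trans (by linarith)
      simp only [hc]
      split_ifs
      · exact one_div_le_one_div_of_le hlw (hla.trans h3)
      · positivity
    have h3 : Real.log (Real.log b / Real.log a) ≤ Real.log (Real.log z / Real.log w) := by
      refine Real.log_le_log (by positivity) ?_
      gcongr
    have h4 : R b / Real.log b ≤ 2 * C / Real.log w := by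
      exact div_le_div₀ (by positivity) (hR0 b (by omega)).2 hlw (hla.trans hlb)
    have h5 : 0 ≤ R a / Real.log a := div_nonneg (hR0 a (by omega)).1 (by linarith)
    have h6 : 2 * C * (1 / Real.log a - 1 / Real.log b) ≤ 2 * C * (1 / Real.log w) := by
      have e1 : 1 / Real.log a ≤ 1 / Real.log w := one_div_le_one_div_of_le hlw hla
      have e2 : 0 ≤ 1 / Real.log b := by positivity
      have e3 : 1 / Real.log a - 1 / Real.log b ≤ 1 / Real.log w := by linarith
      gcongr
    have h7 : (4 * C + 1) / Real.log w
        = 2 * C / Real.log w + 2 * C * (1 / Real.log w) + 1 / Real.log w := by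
      field_simp; ring
    rw [h7]
    linarith

/-- A function of size at most `K / p`, bounded away from one, is a density of dimension `K`. -/
lemma exists_isSieveDensity (K : ℕ) {θ : ℝ} (hθ : θ < 1) : ∃ L : ℝ, 0 ≤ L ∧ ∀ g : ℕ → ℝ,
    (∀ p : ℕ, p.Prime → 0 ≤ g p) → (∀ p : ℕ, p.Prime → g p ≤ θ) →
    (∀ p : ℕ, p.Prime → g p ≤ K / p) → IsSieveDensity K L g := by
  obtain ⟨C, hC0, hC⟩ := exists_sum_inv_prime_le
  set M := K * C + K ^ 2 / (1 - θ) * 2 with hM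
  have hθ' : 0 < 1 - θ := by linarith
  have hM0 : 0 ≤ M := by positivity
  refine ⟨M * Real.exp (M / Real.log 2), by positivity, fun g h0 h1 h2 =>
    ⟨h0, fun p hp => (h1 p hp).trans_lt hθ, fun w z hw hwz => ?_⟩⟩
  have hl2 := Real.log_pos one_lt_two
  have hlw2 : Real.log 2 ≤ Real.log w := Real.log_le_log two_pos hw
  have hlw : 0 < Real.log w := by linarith
  have hlz : Real.log w ≤ Real.log z := Real.log_le_log (by linarith) hwz.le
  have hlz0 : 0 < Real.log z := hlw.trans_le hlz
  set S := (primesBelow z).filter (fun p : ℕ => w ≤ (p : ℝ)) with hS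
  have hSp : ∀ p ∈ S, p.Prime := fun p hp => (mem_primesBelow.1 (mem_filter.1 hp).1).1
  have hterm : ∀ p ∈ S, (1 - g p)⁻¹
      ≤ Real.exp (K * (1 / (p : ℝ)) + K ^ 2 / (1 - θ) * ((p : ℝ) ^ 2)⁻¹) := by
    intro p hp
    have hpp := hSp p hp
    have hp0 : (0 : ℝ) < p := by exact_mod_cast hpp.pos
    have a1 := h0 p hpp
    have a2 := h1 p hpp
    have a3 := h2 p hpp
    have e1 : (1 - g p)⁻¹ = g p + g p ^ 2 / (1 - g p) + 1 := by
      have : 1 - g p ≠ 0 := by linarith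
      field_simp
      ring
    rw [e1]
    refine le_trans ?_ (Real.add_one_le_exp _)
    have e2 : g p ^ 2 / (1 - g p) ≤ (K / p) ^ 2 / (1 - θ) := by gcongr
    have e3 : (K / (p : ℝ)) ^ 2 / (1 - θ) = K ^ 2 / (1 - θ) * ((p : ℝ) ^ 2)⁻¹ := by
      field_simp
    have e4 : (K : ℝ) / p = K * (1 / (p : ℝ)) := by ring
    linarith
  have hsq : ∑ p ∈ S, ((p : ℝ) ^ 2)⁻¹ ≤ 2 / Real.log w := by
    have hw1 : 1 ≤ ⌈w⌉₊ := Nat.one_le_ceil_iff.2 (by linarith)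
    have h3 : S ⊆ Ioo (⌈w⌉₊ - 1) ⌈z⌉₊ := by
      intro p hp
      rw [hS, mem_filter, mem_primesBelow, ← Nat.ceil_le, ← Nat.lt_ceil] at hp
      rw [mem_Ioo]
      exact ⟨by omega, hp.1.2⟩
    refine (sum_le_sum_of_subset_of_nonneg h3 fun _ _ _ => by positivity).trans ?_
    refine (sum_Ioo_inv_sq_le _ _).trans ?_
    have h4 : ((⌈w⌉₊ - 1 : ℕ) : ℝ) + 1 = ⌈w⌉₊ := by
      rw [Nat.cast_sub hw1]; simp
    rw [h4]
    have h5 : Real.log w ≤ w := (Real.log_le_sub_one_of_pos (by linarith)).trans (by linarith)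
    exact div_le_div_of_nonneg_left (by norm_num) hlw (h5.trans (Nat.le_ceil w))
  calc ∏ p ∈ S, (1 - g p)⁻¹
      ≤ ∏ p ∈ S, Real.exp (K * (1 / (p : ℝ)) + K ^ 2 / (1 - θ) * ((p : ℝ) ^ 2)⁻¹) :=
        prod_le_prod (fun p hp => inv_nonneg.2 (by linarith [h1 p (hSp p hp)])) hterm
    _ = Real.exp (K * ∑ p ∈ S, 1 / (p : ℝ) + K ^ 2 / (1 - θ) * ∑ p ∈ S, ((p : ℝ) ^ 2)⁻¹) := by
        rw [← Real.exp_sum, sum_add_distrib, mul_sum, mul_sum]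
    _ ≤ Real.exp (K * (Real.log (Real.log z / Real.log w) + C / Real.log w)
          + K ^ 2 / (1 - θ) * (2 / Real.log w)) := by
        have := hC w z hw hwz
        gcongr
    _ = (Real.log z / Real.log w) ^ (K : ℝ) * Real.exp (M / Real.log w) := by
        rw [Real.rpow_def_of_pos (by positivity), ← Real.exp_add]
        congr 1
        rw [hM]
        field_simp
        ring
    _ ≤ (Real.log z / Real.log w) ^ (K : ℝ)
          * (1 + M * Real.exp (M / Real.log 2) / Real.log w) := by
        gcongr
        have e1 : M / Real.log w ≤ M / Real.log 2 := by gcongr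
        have e2 : Real.exp (M / Real.log w) ≤ Real.exp (M / Real.log 2) := Real.exp_le_exp.2 e1
        have e3 := Real.add_one_le_exp (-(M / Real.log w))
        rw [Real.exp_neg] at e3
        have e4 := Real.exp_pos (M / Real.log w)
        have e5 : Real.exp (M / Real.log w) - 1
            ≤ M / Real.log w * Real.exp (M / Real.log w) := by
          have := mul_le_mul_of_nonneg_right e3 e4.le
          rw [inv_mul_cancel₀ e4.ne'] at this
          linarith
        have e6 : M / Real.log w * Real.exp (M / Real.log w)
            ≤ M / Real.log w * Real.exp (M / Real.log 2) := by gcongr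
        have e7 : M * Real.exp (M / Real.log 2) / Real.log w
          = M / Real.log w * Real.exp (M / Real.log 2) := by ring
        rw [e7]
        linarith

lemma exists_prod_one_add_div_le (K : ℕ) : ∃ C : ℝ, 0 < C ∧ ∀ z : ℝ, 2 < z →
    ∏ p ∈ primesBelow z, (1 + (K : ℝ) / p) ≤ C * Real.log z ^ K := by
  obtain ⟨C, hC0, hC⟩ := exists_sum_inv_prime_le
  have hl2 := Real.log_pos one_lt_two
  refine ⟨Real.exp (K * (C / Real.log 2)) / Real.log 2 ^ K, by positivity, fun z hz => ?_⟩
  have h1 := hC 2 z le_rfl hz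
  have h2 : (primesBelow z).filter (fun p : ℕ => (2 : ℝ) ≤ (p : ℝ)) = primesBelow z := by
    refine filter_true_of_mem fun p hp => ?_
    exact_mod_cast (mem_primesBelow.1 hp).1.two_le
  rw [h2] at h1
  have hlz : 0 < Real.log z := Real.log_pos (by linarith)
  calc ∏ p ∈ primesBelow z, (1 + (K : ℝ) / p)
      ≤ ∏ p ∈ primesBelow z, Real.exp (K * (1 / (p : ℝ))) := by
        refine prod_le_prod (fun _ _ => by positivity) fun p _ => ?_
        have := Real.add_one_le_exp (K * (1 / (p : ℝ)))
        rw [mul_one_div] at this ⊢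
        linarith
    _ = Real.exp (K * ∑ p ∈ primesBelow z, 1 / (p : ℝ)) := by rw [← Real.exp_sum, mul_sum]
    _ ≤ Real.exp (K * (Real.log (Real.log z / Real.log 2) + C / Real.log 2)) := by gcongr
    _ = _ := by
        rw [mul_add, Real.exp_add, ← Real.log_pow, Real.exp_log (by positivity), div_pow]
        ring

/-- The lower bound `∏_{p < z} (1 - 1 / p)⁻¹ ≥ log z`: the product is the sum of the reciprocals
of the integers all of whose prime factors are less than `z`. -/
lemma log_le_prod_inv (z : ℝ) (hz : 1 < z) :
    Real.log z ≤ ∏ p ∈ primesBelow z, (1 - 1 / (p : ℝ))⁻¹ := by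
  set N := ⌈z⌉₊ with hN
  have hN1 : 1 < N := by
    have : (1 : ℝ) < N := hz.trans_le (Nat.le_ceil z)
    exact_mod_cast this
  let f : ℕ →* ℝ :=
    { toFun := fun n => (n : ℝ)⁻¹
      map_one' := by simp
      map_mul' := fun a b => by rw [Nat.cast_mul, mul_inv] }
  have h1 := (EulerProduct.summable_and_hasSum_smoothNumbers_prod_primesBelow_geometric
    (f := f) (fun {p} hp => by
      have : (1 : ℝ) < p := by exact_mod_cast hp.one_lt
      simp only [f, MonoidHom.coe_mk, OneHom.coe_mk, norm_inv, RCLike.norm_natCast]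
      exact inv_lt_one_of_one_lt₀ this) N).2
  have e : ∏ p ∈ primesBelow z, (1 - 1 / (p : ℝ))⁻¹ = ∏ p ∈ N.primesBelow, (1 - f p)⁻¹ := by
    refine prod_congr rfl fun p _ => ?_
    simp [f]
  rw [e]
  have hmem : ∀ m ∈ Icc 1 (N - 1), m ∈ N.smoothNumbers := fun m hm => by
    rw [mem_Icc] at hm
    exact Nat.mem_smoothNumbers_of_lt (by omega) (by omega)
  have h2 : ∑ m ∈ Icc 1 (N - 1), (m : ℝ)⁻¹ ≤ ∏ p ∈ N.primesBelow, (1 - f p)⁻¹ := by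
    have h3 := sum_le_hasSum ((Icc 1 (N - 1)).attach.map
      ⟨fun m : {m // m ∈ Icc 1 (N - 1)} => (⟨m.1, hmem m.1 m.2⟩ : N.smoothNumbers), fun a b h =>
        Subtype.ext (congrArg (fun x : N.smoothNumbers => (x : ℕ)) h)⟩) (fun i _ => by simp [f]) h1
    refine le_trans (le_of_eq ?_) h3
    rw [sum_map]
    exact (sum_attach (Icc 1 (N - 1)) fun m => (m : ℝ)⁻¹).symm
  have h4 := log_add_one_le_harmonic (N - 1)
  rw [show N - 1 + 1 = N by omega, harmonic_eq_sum_Icc] at h4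
  push_cast at h4
  exact (Real.log_le_log (by linarith) (Nat.le_ceil z)).trans (h4.trans h2)

/-! ### Counting in residue classes -/

lemma abs_card_modEq_sub_le {a b r : ℕ} (hab : a ≤ b) (hr : 0 < r) (v : ℕ) :
    |(((Ioc a b).filter fun m => m ≡ v [MOD r]).card : ℝ) - ((b : ℝ) - a) / r| ≤ 1 := by
  have h := Nat.Ioc_filter_modEq_card a b hr v
  have hr' : (0 : ℚ) < r := by exact_mod_cast hr
  have hab' : (a : ℚ) ≤ b := by exact_mod_cast hab
  set x : ℚ := ((b : ℚ) - v) / r with hx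
  set y : ℚ := ((a : ℚ) - v) / r with hy
  have hyx : y ≤ x := by rw [hx, hy]; gcongr
  rw [max_eq_left (sub_nonneg.2 (Int.floor_le_floor hyx))] at h
  have hq : (((Ioc a b).filter fun m => m ≡ v [MOD r]).card : ℚ) = (⌊x⌋ : ℚ) - ⌊y⌋ := by
    exact_mod_cast h
  have key : |(((Ioc a b).filter fun m => m ≡ v [MOD r]).card : ℚ) - ((b : ℚ) - a) / r| ≤ 1 := by
    have e : ((b : ℚ) - a) / r = x - y := by rw [hx, hy]; ring
    rw [hq, e, abs_le]
    have h1 := Int.floor_le x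
    have h2 := Int.lt_floor_add_one x
    have h3 := Int.floor_le y
    have h4 := Int.lt_floor_add_one y
    constructor <;> linarith
  simpa using (Rat.cast_le (K := ℝ)).2 key

/-- The number of integers in an interval that lie, for each prime of `T`, in one of the prescribed
residue classes. -/
lemma abs_card_residues_sub_le {a b : ℕ} (hab : a ≤ b) (Ω : ℕ → Finset ℕ) (T : Finset ℕ)
    (hT : ∀ p ∈ T, p.Prime) (hΩ : ∀ p ∈ T, ∀ c ∈ Ω p, c < p) (q v : ℕ) (hq : 0 < q)
    (hqT : ∀ p ∈ T, Nat.Coprime q p) :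
    |(((Ioc a b).filter fun m => m ≡ v [MOD q] ∧ ∀ p ∈ T, m % p ∈ Ω p).card : ℝ)
      - ((b : ℝ) - a) / q * ∏ p ∈ T, ((Ω p).card / p : ℝ)| ≤ ∏ p ∈ T, ((Ω p).card : ℝ) := by
  induction T using Finset.induction_on generalizing q v with
  | empty => simpa using abs_card_modEq_sub_le hab hq v
  | insert p T hp ih =>
    simp only [mem_insert, forall_eq_or_imp] at hT hΩ hqT
    have hcount : ((Ioc a b).filter fun m => m ≡ v [MOD q] ∧ ∀ p' ∈ insert p T, m % p' ∈ Ω p').card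
        = ∑ c ∈ Ω p, ((Ioc a b).filter fun m =>
          m ≡ Nat.chineseRemainder hqT.1 v c [MOD q * p] ∧ ∀ p' ∈ T, m % p' ∈ Ω p').card := by
      rw [card_eq_sum_card_fiberwise (f := fun m => m % p) (t := Ω p)]
      · refine sum_congr rfl fun c hc => ?_
        congr 1
        ext m
        have hcr := (Nat.chineseRemainder hqT.1 v c).2
        rw [mem_filter, mem_filter, mem_filter, ← Nat.modEq_and_modEq_iff_modEq_mul hqT.1]
        have e1 : m ≡ Nat.chineseRemainder hqT.1 v c [MOD q] ↔ m ≡ v [MOD q] :=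
          ⟨fun h => h.trans hcr.1, fun h => h.trans hcr.1.symm⟩
        have e2 : m ≡ Nat.chineseRemainder hqT.1 v c [MOD p] ↔ m % p = c := by
          rw [← Nat.mod_eq_of_lt (hΩ.1 c hc)]
          have e3 : m % p = c % p % p ↔ m ≡ c [MOD p] := by rw [Nat.mod_mod]; rfl
          rw [Nat.mod_eq_of_lt (hΩ.1 c hc)] at e3 ⊢
          rw [Nat.mod_eq_of_lt (hΩ.1 c hc)] at e3
          rw [e3]
          exact ⟨fun h => h.trans hcr.2, fun h => h.trans hcr.2.symm⟩
        rw [e1, e2]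
        simp only [mem_insert, forall_eq_or_imp]
        constructor
        · rintro ⟨⟨h1, h2, -, h4⟩, h5⟩
          exact ⟨h1, ⟨h2, h5⟩, h4⟩
        · rintro ⟨h1, ⟨h2, h5⟩, h4⟩
          exact ⟨⟨h1, h2, by rw [h5]; exact hc, h4⟩, h5⟩
      · intro m hm
        exact (mem_filter.1 (mem_coe.1 hm)).2.2 p (mem_insert_self _ _)
    have hp0 : (p : ℝ) ≠ 0 := by exact_mod_cast hT.1.ne_zero
    have hq0 : (q : ℝ) ≠ 0 := by exact_mod_cast hq.ne'
    have hmain : ((b : ℝ) - a) / q * ∏ p' ∈ insert p T, ((Ω p').card / p' : ℝ)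
        = ∑ c ∈ Ω p, ((b : ℝ) - a) / ((q * p : ℕ) : ℝ) * ∏ p' ∈ T, ((Ω p').card / p' : ℝ) := by
      rw [prod_insert hp, sum_const, nsmul_eq_mul]
      push_cast
      field_simp
    rw [hcount, hmain, prod_insert hp, Nat.cast_sum, ← sum_sub_distrib]
    refine (abs_sum_le_sum_abs _ _).trans ?_
    rw [← nsmul_eq_mul]
    refine sum_le_card_nsmul _ _ _ fun c _ => ih hT.2 hΩ.2 _ _ (Nat.mul_pos hq hT.1.pos) ?_
    intro p' hp'
    refine Nat.Coprime.mul_left (hqT.2 p' hp') ((Nat.coprime_primes hT.1 (hT.2 p' hp')).2 ?_)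
    rintro rfl
    exact hp hp'

/-- Summing the divisor sums of sieve weights over an interval: the main term is
`weightedSum w A g` times the length, with `g p` the proportion of the sifted classes modulo `p`. -/
lemma abs_sum_sieve_sub_le {a b : ℕ} (hab : a ≤ b) (Ω : ℕ → Finset ℕ) (A : Finset ℕ)
    (hA : ∀ p ∈ A, p.Prime) (hΩ : ∀ p ∈ A, ∀ c ∈ Ω p, c < p) (w : Finset ℕ → ℝ) :
    |∑ m ∈ Ioc a b, ∑ d ∈ (A.filter fun p => m % p ∈ Ω p).powerset, w d
      - ((b : ℝ) - a) * weightedSum w A (fun p => ((Ω p).card / p : ℝ))|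
      ≤ ∑ d ∈ A.powerset, |w d| * ∏ p ∈ d, ((Ω p).card : ℝ) := by
  have h1 : ∑ m ∈ Ioc a b, ∑ d ∈ (A.filter fun p => m % p ∈ Ω p).powerset, w d
      = ∑ d ∈ A.powerset, w d * (((Ioc a b).filter fun m => ∀ p ∈ d, m % p ∈ Ω p).card : ℝ) := by
    have : ∀ m ∈ Ioc a b, ∑ d ∈ (A.filter fun p => m % p ∈ Ω p).powerset, w d
        = ∑ d ∈ A.powerset, if ∀ p ∈ d, m % p ∈ Ω p then w d else 0 := by
      intro m _
      rw [← sum_filter]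
      refine sum_congr ?_ fun _ _ => rfl
      ext d
      simp only [mem_powerset, mem_filter, subset_iff]
      exact ⟨fun h => ⟨fun p hp => (h hp).1, fun p hp => (h hp).2⟩, fun h p hp => ⟨h.1 hp, h.2 p hp⟩⟩
    rw [sum_congr rfl this, sum_comm]
    refine sum_congr rfl fun d _ => ?_
    rw [← sum_filter, sum_const, nsmul_eq_mul, mul_comm]
  rw [h1, weightedSum, mul_sum, ← sum_sub_distrib]
  refine (abs_sum_le_sum_abs _ _).trans (sum_le_sum fun d hd => ?_)
  have hdA := mem_powerset.1 hd
  have := abs_card_residues_sub_le hab Ω d (fun p hp => hA p (hdA hp))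
    (fun p hp => hΩ p (hdA hp)) 1 0 one_pos (fun p _ => Nat.coprime_one_left p)
  simp only [Nat.modEq_one, true_and, Nat.cast_one, div_one] at this
  have e : w d * (((Ioc a b).filter fun m => ∀ p ∈ d, m % p ∈ Ω p).card : ℝ)
      - ((b : ℝ) - a) * (w d * ∏ p ∈ d, ((Ω p).card / p : ℝ))
      = w d * ((((Ioc a b).filter fun m => ∀ p ∈ d, m % p ∈ Ω p).card : ℝ)
        - ((b : ℝ) - a) * ∏ p ∈ d, ((Ω p).card / p : ℝ)) := by ring
  rw [e, abs_mul]
  exact mul_le_mul_of_nonneg_left this (abs_nonneg _)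

/-- Rankin's bound for the remainder of a sieve of level `D`. -/
lemma sum_remainder_le {A : Finset ℕ} (hA : ∀ p ∈ A, p.Prime) {w : Finset ℕ → ℝ} {D : ℝ}
    (hD : 0 ≤ D) {Ω : ℕ → Finset ℕ} (K E : ℕ) (hw : ∀ d ⊆ A, |w d| ≤ (E : ℝ) ^ d.card)
    (hsupp : ∀ d ⊆ A, w d ≠ 0 → ((∏ p ∈ d, p : ℕ) : ℝ) < D) (hΩ : ∀ p ∈ A, (Ω p).card ≤ K) :
    ∑ d ∈ A.powerset, |w d| * ∏ p ∈ d, ((Ω p).card : ℝ)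
      ≤ D * ∏ p ∈ A, (1 + ((E * K : ℕ) : ℝ) / p) := by
  rw [prod_one_add, mul_sum]
  refine sum_le_sum fun d hd => ?_
  have hdA := mem_powerset.1 hd
  have hpos : (0 : ℝ) < ∏ p ∈ d, (p : ℝ) :=
    prod_pos fun p hp => by exact_mod_cast (hA p (hdA hp)).pos
  by_cases h0 : w d = 0
  · rw [h0, abs_zero, zero_mul]
    positivity
  · have h1 := hsupp d hdA h0
    push_cast at h1
    have h2 : ∏ p ∈ d, ((Ω p).card : ℝ) ≤ (K : ℝ) ^ d.card := by
      rw [← prod_const]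
      exact prod_le_prod (fun _ _ => by positivity) fun p hp => by exact_mod_cast hΩ p (hdA hp)
    have h3 : ∏ p ∈ d, (((E * K : ℕ) : ℝ) / p) = ((E : ℝ) * K) ^ d.card / ∏ p ∈ d, (p : ℝ) := by
      rw [prod_div_distrib, prod_const]; push_cast; rfl
    rw [h3]
    calc |w d| * ∏ p ∈ d, ((Ω p).card : ℝ) ≤ (E : ℝ) ^ d.card * (K : ℝ) ^ d.card :=
          mul_le_mul (hw d hdA) h2 (by positivity) (by positivity)
      _ = ((E : ℝ) * K) ^ d.card := (mul_pow _ _ _).symm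
      _ ≤ D / (∏ p ∈ d, (p : ℝ)) * ((E : ℝ) * K) ^ d.card :=
          le_mul_of_one_le_left (by positivity) ((one_le_div hpos).2 h1.le)
      _ = _ := by ring

/-! ### The residue classes of a tuple -/

/-- The residues `r` modulo `p` such that `p` divides `r + h` for some `h ∈ H`. -/
def tupleResidues (H : Finset ℕ) (p : ℕ) : Finset ℕ :=
  H.image fun h => (p - h % p) % p

lemma lt_of_mem_tupleResidues {H : Finset ℕ} {p c : ℕ} (hp : 0 < p)
    (hc : c ∈ tupleResidues H p) : c < p := by
  obtain ⟨h, -, rfl⟩ := mem_image.1 hc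
  exact Nat.mod_lt _ hp

lemma card_tupleResidues_le (H : Finset ℕ) (p : ℕ) : (tupleResidues H p).card ≤ H.card :=
  card_image_le

lemma mod_eq_neg_mod_iff {p : ℕ} (hp : 0 < p) (m h : ℕ) :
    m % p = (p - h % p) % p ↔ p ∣ m + h := by
  have hlt : h % p ≤ p := (Nat.mod_lt h hp).le
  change m ≡ p - h % p [MOD p] ↔ _
  rw [← ZMod.natCast_eq_natCast_iff, Nat.cast_sub hlt, ZMod.natCast_self, ZMod.natCast_mod,
    zero_sub, eq_neg_iff_add_eq_zero, ← Nat.cast_add, ZMod.natCast_eq_zero_iff]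

lemma mod_mem_tupleResidues_iff {H : Finset ℕ} {p : ℕ} (hp : 0 < p) (m : ℕ) :
    m % p ∈ tupleResidues H p ↔ ∃ h ∈ H, p ∣ m + h := by
  simp only [tupleResidues, mem_image]
  refine exists_congr fun h => and_congr_right fun _ => ?_
  rw [← mod_eq_neg_mod_iff hp, eq_comm]

lemma card_tupleResidues_eq {H : Finset ℕ} {p : ℕ} (hp : 0 < p)
    (hH : Set.InjOn (fun h => h % p) (H : Set ℕ)) : (tupleResidues H p).card = H.card := by
  refine card_image_of_injOn fun h hh h' hh' heq => hH hh hh' ?_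
  have h1 : p ∣ (p - h % p) % p + h := by rw [← mod_eq_neg_mod_iff hp, Nat.mod_mod]
  have h2 : p ∣ (p - h % p) % p + h' := by
    rw [← mod_eq_neg_mod_iff hp, Nat.mod_mod]; exact heq
  have h3 : (p - h % p) % p + h ≡ (p - h % p) % p + h' [MOD p] :=
    ((Nat.modEq_zero_iff_dvd).2 h1).trans ((Nat.modEq_zero_iff_dvd).2 h2).symm
  exact Nat.ModEq.add_left_cancel' _ h3

/-- The product of the `(1 - 1 / p)⁻¹` over the primes `p` dividing `n`, which is `n / φ(n)`. -/
noncomputable def eulerFactor (n : ℕ) : ℝ := ∏ p ∈ n.primeFactors, (1 - 1 / (p : ℝ))⁻¹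

lemma one_le_inv_one_sub {p : ℕ} (hp : p.Prime) : 1 ≤ (1 - 1 / (p : ℝ))⁻¹ := by
  have h2 : (2 : ℝ) ≤ p := by exact_mod_cast hp.two_le
  have h3 : 1 / (p : ℝ) ≤ 1 / 2 := one_div_le_one_div_of_le two_pos h2
  have h4 : 0 < 1 / (p : ℝ) := by positivity
  exact one_le_inv_iff₀.2 ⟨by linarith, by linarith⟩

lemma one_le_prod_of_one_le {A : Finset ℕ} {f : ℕ → ℝ} (h : ∀ p ∈ A, 1 ≤ f p) :
    1 ≤ ∏ p ∈ A, f p := by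
  rw [← prod_const_one (s := A)]
  exact prod_le_prod (fun _ _ => zero_le_one) h

lemma one_le_eulerFactor (n : ℕ) : 1 ≤ eulerFactor n :=
  one_le_prod_of_one_le fun _ hp => one_le_inv_one_sub (Nat.prime_of_mem_primeFactors hp)

lemma prod_inv_le_eulerFactor {A : Finset ℕ} {n : ℕ} (hA : A ⊆ n.primeFactors) :
    ∏ p ∈ A, (1 - 1 / (p : ℝ))⁻¹ ≤ eulerFactor n := by
  unfold eulerFactor
  rw [← prod_sdiff hA]
  refine le_mul_of_one_le_left ?_ ?_
  · exact prod_nonneg fun p hp => zero_le_one.trans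
      (one_le_inv_one_sub (Nat.prime_of_mem_primeFactors (hA hp)))
  · exact one_le_prod_of_one_le fun p hp => one_le_inv_one_sub
      (Nat.prime_of_mem_primeFactors (mem_sdiff.1 hp).1)

lemma eulerFactor_mul_le {a b : ℕ} (ha : a ≠ 0) (hb : b ≠ 0) :
    eulerFactor (a * b) ≤ eulerFactor a * eulerFactor b := by
  have h : (a * b).primeFactors = a.primeFactors ∪ (b.primeFactors \ a.primeFactors) := by
    rw [Nat.primeFactors_mul ha hb, union_sdiff_self_eq_union]
  unfold eulerFactor
  rw [h, prod_union disjoint_sdiff]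
  refine mul_le_mul_of_nonneg_left (prod_inv_le_eulerFactor sdiff_subset) ?_
  exact zero_le_one.trans (one_le_eulerFactor a)

/-- The integers `m` in `(a, b]` such that no `m + h` with `h ∈ H` has a prime factor `p < z`. -/
noncomputable def siftedTuples (H : Finset ℕ) (z : ℝ) (a b : ℕ) : Finset ℕ :=
  (Ioc a b).filter fun m => ∀ h ∈ H, ∀ p ∈ primesBelow z, ¬ p ∣ m + h

/-- An exponential beats a power. -/
lemma eventually_pow_mul_rpow_le (C : ℝ) (E : ℕ) {α c : ℝ} (hα : α < 1) (hc : 0 < c) :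
    ∀ᶠ n : ℕ in Filter.atTop, C * (n : ℝ) ^ E * (2 : ℝ) ^ (α * n) ≤ c * 2 ^ n := by
  have hr : |(2 : ℝ) ^ (α - 1)| < 1 := by
    rw [abs_of_pos (by positivity)]
    exact Real.rpow_lt_one_of_one_lt_of_neg one_lt_two (by linarith)
  have h := (tendsto_pow_const_mul_const_pow_of_abs_lt_one E hr).const_mul C
  rw [mul_zero] at h
  filter_upwards [h.eventually (gt_mem_nhds hc)] with n hn
  have e : ((2 : ℝ) ^ (α - 1)) ^ n = (2 : ℝ) ^ (α * n) / 2 ^ n := by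
    rw [← Real.rpow_mul_natCast two_pos.le, sub_mul, one_mul, Real.rpow_sub two_pos,
      Real.rpow_natCast]
  rw [e] at hn
  have h2 : (0 : ℝ) < 2 ^ n := by positivity
  have e2 : C * ((n : ℝ) ^ E * ((2 : ℝ) ^ (α * n) / 2 ^ n))
      = (C * (n : ℝ) ^ E * (2 : ℝ) ^ (α * n)) / 2 ^ n := by ring
  rw [e2, div_lt_iff₀ h2] at hn
  exact hn.le

lemma log_two_rpow_mul (j : ℕ) (η : ℝ) :
    Real.log ((2 : ℝ) ^ (η * j)) = η * j * Real.log 2 := Real.log_rpow two_pos _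

/-! ### An upper bound for the number of tuples -/

/-- The product of the `1 - g p` for the density that belongs to a `K`-tuple. -/
lemma prod_one_sub_tuple_le {H : Finset ℕ} {Δ : ℕ} (hΔ0 : Δ ≠ 0)
    (hΔ : ∀ p : ℕ, p.Prime → ¬ p ∣ Δ → Set.InjOn (fun h => h % p) (H : Set ℕ)) {z : ℝ}
    (hz : 1 < z) :
    ∏ p ∈ primesBelow z, (1 - (if p ≤ H.card then 0 else ((tupleResidues H p).card : ℝ) / p))
      ≤ (eulerFactor (Δ * H.card.factorial) / Real.log z) ^ H.card := by
  set K := H.card with hK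
  set Δ' := Δ * K.factorial with hΔ'
  have hA : ∀ p ∈ primesBelow z, p.Prime := fun p hp => (mem_primesBelow.1 hp).1
  have hΔ'0 : Δ' ≠ 0 := mul_ne_zero hΔ0 K.factorial_ne_zero
  have hterm : ∀ p ∈ primesBelow z,
      (1 - (if p ≤ K then 0 else ((tupleResidues H p).card : ℝ) / p))
        ≤ ((1 - 1 / (p : ℝ)) * if p ∣ Δ' then (1 - 1 / (p : ℝ))⁻¹ else 1) ^ K := by
    intro p hp
    have hpp := hA p hp
    have h2 : (2 : ℝ) ≤ p := by exact_mod_cast hpp.two_le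
    have h3 : 1 / (p : ℝ) ≤ 1 / 2 := one_div_le_one_div_of_le two_pos h2
    by_cases hd : p ∣ Δ'
    · rw [if_pos hd, mul_inv_cancel₀ (by linarith), one_pow]
      have : 0 ≤ if p ≤ K then 0 else ((tupleResidues H p).card : ℝ) / p := by
        split_ifs <;> positivity
      linarith
    · rw [if_neg hd, mul_one]
      have hpK : ¬ p ≤ K := fun h => hd (dvd_mul_of_dvd_right ((hpp.dvd_factorial).2 h) _)
      rw [if_neg hpK, card_tupleResidues_eq hpp.pos
        (hΔ p hpp fun h => hd (dvd_mul_of_dvd_left h _)), ← hK]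
      have := one_add_mul_le_pow (show (-2 : ℝ) ≤ -(1 / p) by linarith) K
      have e1 : 1 + (K : ℝ) * (-(1 / p)) = 1 - K / p := by ring
      have e2 : 1 + -(1 / (p : ℝ)) = 1 - 1 / p := by ring
      rwa [e1, e2] at this
  refine (prod_le_prod (fun p hp => ?_) hterm).trans ?_
  · have hpp := hA p hp
    have hp0 : (0 : ℝ) < p := by exact_mod_cast hpp.pos
    split_ifs with h
    · norm_num
    · have h1 : ((tupleResidues H p).card : ℝ) ≤ p := by
        exact_mod_cast (card_tupleResidues_le H p).trans (by omega)
      linarith [(div_le_one hp0).2 h1]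
  · rw [prod_pow, prod_mul_distrib, prod_ite, prod_const_one, mul_one]
    have hlz : 0 < Real.log z := Real.log_pos hz
    have h1 := log_le_prod_inv z hz
    rw [prod_inv_distrib] at h1
    have hV : 0 ≤ ∏ p ∈ primesBelow z, (1 - 1 / (p : ℝ)) := prod_nonneg fun p hp => by
      have h2 : (2 : ℝ) ≤ p := by exact_mod_cast (hA p hp).two_le
      have h3 : 1 / (p : ℝ) ≤ 1 / 2 := one_div_le_one_div_of_le two_pos h2
      linarith
    have h2 : ∏ p ∈ primesBelow z, (1 - 1 / (p : ℝ)) ≤ (Real.log z)⁻¹ := by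
      rw [← inv_inv (∏ p ∈ primesBelow z, (1 - 1 / (p : ℝ)))]
      exact inv_anti₀ hlz h1
    have h3 : ∏ p ∈ (primesBelow z).filter (fun p => p ∣ Δ'), (1 - 1 / (p : ℝ))⁻¹
        ≤ eulerFactor Δ' := prod_inv_le_eulerFactor fun p hp => by
      rw [mem_filter] at hp
      exact Nat.mem_primeFactors.2 ⟨hA p hp.1, hp.2, hΔ'0⟩
    have h4 : 0 ≤ ∏ p ∈ (primesBelow z).filter (fun p => p ∣ Δ'), (1 - 1 / (p : ℝ))⁻¹ :=
      prod_nonneg fun p hp => zero_le_one.trans (one_le_inv_one_sub (hA p (mem_filter.1 hp).1))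
    refine pow_le_pow_left₀ (mul_nonneg hV h4) ?_ K
    rw [div_eq_inv_mul]
    exact mul_le_mul h2 h3 h4 (by positivity)

/-- The upper bound for the number of sifted `K`-tuples in a dyadic interval. The number `Δ` takes
account of the primes modulo which elements of the tuple coincide. -/
theorem exists_card_siftedTuples_le (K : ℕ) {η : ℝ} (hη : 0 < η) (hη' : η ≤ 1 / 20) :
    ∃ C : ℝ, 0 < C ∧ ∀ᶠ j : ℕ in Filter.atTop, ∀ H : Finset ℕ, H.card = K → ∀ Δ : ℕ, Δ ≠ 0 →
      (∀ p : ℕ, p.Prime → ¬ p ∣ Δ → Set.InjOn (fun h => h % p) (H : Set ℕ)) →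
      ((siftedTuples H ((2 : ℝ) ^ (η * j)) (2 ^ j) (2 ^ (j + 1))).card : ℝ)
        ≤ C * 2 ^ j / (j : ℝ) ^ K * eulerFactor Δ ^ K := by
  obtain ⟨L, hL0, hL⟩ := exists_isSieveDensity K (θ := K / (K + 1))
    (by rw [div_lt_one (by positivity)]; linarith)
  obtain ⟨C₁, hC₁, hsieve⟩ := exists_upper_bound_sieve (show (0 : ℝ) ≤ (K : ℝ) by positivity) L
  obtain ⟨C₂, hC₂, hprod⟩ := exists_prod_one_add_div_le K
  have hl2 := Real.log_pos one_lt_two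
  refine ⟨C₁ * (eulerFactor K.factorial / (η * Real.log 2)) ^ K + 1, by
    have := one_le_eulerFactor K.factorial
    positivity, ?_⟩
  have hev := eventually_pow_mul_rpow_le (C₂ * (η * Real.log 2) ^ K) (2 * K)
    (show (1 / 2 : ℝ) < 1 by norm_num) one_pos
  filter_upwards [hev, Filter.eventually_gt_atTop ⌈1 / η⌉₊] with j hj hj1 H hH Δ hΔ0 hΔ
  have hjη : 1 < η * j := by
    have := Nat.lt_of_ceil_lt hj1
    rw [div_lt_iff₀ hη] at this
    linarith
  have hj0 : (0 : ℝ) < j := by nlinarith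
  set z := (2 : ℝ) ^ (η * j) with hz
  have hz2 : 2 < z := by
    have := Real.rpow_lt_rpow_of_exponent_lt one_lt_two hjη
    rwa [Real.rpow_one] at this
  have hlz : Real.log z = η * j * Real.log 2 := log_two_rpow_mul j η
  set A := primesBelow z with hAdef
  have hA : ∀ p ∈ A, p.Prime := fun p hp => (mem_primesBelow.1 hp).1
  set Ω : ℕ → Finset ℕ := fun p => if p ≤ K then ∅ else tupleResidues H p with hΩdef
  obtain ⟨w, hw1, hw2, hw3, hw4⟩ := hsieve z (by linarith)
  have hΩlt : ∀ p ∈ A, ∀ c ∈ Ω p, c < p := fun p hp c hc => by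
    simp only [hΩdef] at hc
    split_ifs at hc
    · simp at hc
    · exact lt_of_mem_tupleResidues (hA p hp).pos hc
  have hΩcard : ∀ p, (Ω p).card ≤ K := fun p => by
    simp only [hΩdef]
    split_ifs
    · simp
    · exact (card_tupleResidues_le H p).trans hH.le
  set g : ℕ → ℝ := fun p => ((Ω p).card / p : ℝ) with hg
  have hgd : IsSieveDensity K L g := by
    refine hL g (fun p _ => by positivity) (fun p hp => ?_) fun p hp => ?_
    · simp only [hg, hΩdef]
      split_ifs with h
      · simp; positivity
      · have h1 : ((tupleResidues H p).card : ℝ) ≤ K := by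
          exact_mod_cast (card_tupleResidues_le H p).trans hH.le
        have h2 : (K : ℝ) + 1 ≤ p := by exact_mod_cast Nat.lt_of_not_le h
        gcongr
    · have h1 : ((Ω p).card : ℝ) ≤ K := by exact_mod_cast hΩcard p
      simp only [hg]
      gcongr
  have hab : 2 ^ j ≤ 2 ^ (j + 1) := Nat.pow_le_pow_right (by norm_num) (by omega)
  have hlen : (((2 ^ (j + 1) : ℕ) : ℝ) - ((2 ^ j : ℕ) : ℝ)) = 2 ^ j := by
    push_cast; ring
  have hcount : ((siftedTuples H z (2 ^ j) (2 ^ (j + 1))).card : ℝ)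
      ≤ ∑ m ∈ Ioc (2 ^ j) (2 ^ (j + 1)),
        ∑ d ∈ (A.filter fun p => m % p ∈ Ω p).powerset, w d := by
    rw [siftedTuples, card_filter, Nat.cast_sum]
    refine sum_le_sum fun m _ => ?_
    refine le_trans ?_ (hw3 _ (filter_subset _ _))
    split_ifs with h1 h2 h2
    · simp
    · exfalso
      obtain ⟨p, hp⟩ := nonempty_iff_ne_empty.2 h2
      rw [mem_filter] at hp
      have h3 := hp.2
      simp only [hΩdef] at h3
      split_ifs at h3
      · simp at h3
      · obtain ⟨h, hh, hdvd⟩ := (mod_mem_tupleResidues_iff (hA p hp.1).pos m).1 h3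
        exact h1 h hh p hp.1 hdvd
    · simp
    · simp
  have hrem : ∑ d ∈ A.powerset, |w d| * ∏ p ∈ d, ((Ω p).card : ℝ) ≤ 2 ^ j / (j : ℝ) ^ K := by
    refine (sum_remainder_le hA (D := z ^ (48 / 5 : ℝ)) (by positivity) K 1
      (fun d _ => by simpa using hw1 d) hw2 fun p _ => hΩcard p).trans ?_
    rw [one_mul]
    have h1 := hprod z hz2
    have h2 : z ^ (48 / 5 : ℝ) ≤ (2 : ℝ) ^ (1 / 2 * j : ℝ) := by
      rw [hz, ← Real.rpow_mul two_pos.le]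
      refine Real.rpow_le_rpow_of_exponent_le one_le_two ?_
      nlinarith
    rw [le_div_iff₀ (by positivity)]
    calc (z ^ (48 / 5 : ℝ) * ∏ p ∈ A, (1 + (K : ℝ) / p)) * (j : ℝ) ^ K
        ≤ (2 : ℝ) ^ (1 / 2 * j : ℝ) * (C₂ * Real.log z ^ K) * (j : ℝ) ^ K := by gcongr
      _ = C₂ * (η * Real.log 2) ^ K * (j : ℝ) ^ (2 * K) * (2 : ℝ) ^ (1 / 2 * j : ℝ) := by
          rw [hlz]; ring
      _ ≤ _ := by linarith
  have hmain : weightedSum w A g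
      ≤ C₁ * (eulerFactor K.factorial / (η * Real.log 2)) ^ K / (j : ℝ) ^ K * eulerFactor Δ ^ K := by
    have h1 := prod_one_sub_tuple_le hΔ0 hΔ (show 1 < z by linarith)
    rw [hH] at h1
    have e : ∀ p ∈ A, 1 - g p
        = 1 - (if p ≤ K then 0 else ((tupleResidues H p).card : ℝ) / p) := fun p _ => by
      simp only [hg, hΩdef]
      split_ifs <;> simp
    rw [← prod_congr rfl e] at h1
    have h2 := eulerFactor_mul_le hΔ0 K.factorial_ne_zero
    have h0 := one_le_eulerFactor (Δ * K.factorial)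
    calc weightedSum w A g ≤ C₁ * ∏ p ∈ A, (1 - g p) := hw4 g hgd
      _ ≤ C₁ * (eulerFactor (Δ * K.factorial) / Real.log z) ^ K := by gcongr
      _ ≤ C₁ * (eulerFactor Δ * eulerFactor K.factorial / Real.log z) ^ K := by
          have : 0 < Real.log z := Real.log_pos (by linarith)
          gcongr
      _ = _ := by
          rw [hlz]
          simp only [div_pow, mul_pow]
          field_simp
  have hsum := abs_sum_sieve_sub_le hab Ω A hA hΩlt w
  rw [hlen] at hsum
  have h1 := (abs_le.1 (hsum.trans hrem)).2
  have h2 : (2 : ℝ) ^ j * weightedSum w A g ≤ 2 ^ j * (C₁ * (eulerFactor K.factorial /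
    (η * Real.log 2)) ^ K / (j : ℝ) ^ K * eulerFactor Δ ^ K) := by gcongr
  have h3 : (2 : ℝ) ^ j / (j : ℝ) ^ K ≤ 2 ^ j / (j : ℝ) ^ K * eulerFactor Δ ^ K :=
    le_mul_of_one_le_right (by positivity) (one_le_pow₀ (one_le_eulerFactor Δ))
  calc _ ≤ 2 ^ j * (C₁ * (eulerFactor K.factorial / (η * Real.log 2)) ^ K / (j : ℝ) ^ K
          * eulerFactor Δ ^ K) + 2 ^ j / (j : ℝ) ^ K * eulerFactor Δ ^ K := by linarith
    _ = _ := by ring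

/-! ### A lower bound for the number of pairs -/

lemma card_tupleResidues_pair_le {h : ℕ} (hh : Even h) {p : ℕ} (hp : p.Prime) :
    ((tupleResidues {0, h} p).card : ℝ) / p ≤ 2 / 3
      ∧ ((tupleResidues {0, h} p).card : ℝ) / p ≤ (2 : ℕ) / p := by
  have h2 : (tupleResidues {0, h} p).card ≤ 2 := (card_tupleResidues_le _ _).trans card_le_two
  have h2' : ((tupleResidues {0, h} p).card : ℝ) ≤ (2 : ℕ) := by exact_mod_cast h2
  refine ⟨?_, by gcongr⟩
  rcases hp.two_le.eq_or_lt with rfl | hlt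
  · have e : tupleResidues {0, h} 2 = {0} := by
      simp [tupleResidues, Nat.even_iff.1 hh]
    rw [e]
    norm_num
  · have h3 : (3 : ℝ) ≤ p := by exact_mod_cast hlt
    push_cast at h2'
    gcongr

/-- A sieve with a positive main term at `s` yields, for every even `h`, the expected number of
`m` such that neither `m` nor `m + h` has a small prime factor. -/
theorem exists_le_card_siftedTuples_pair {s δ : ℝ} (hs : SievePositiveAt 2 s) (hδ : 0 < δ)
    (hsδ : s * δ < 1) :
    ∃ c : ℝ, 0 < c ∧ ∀ᶠ j : ℕ in Filter.atTop, ∀ h : ℕ, Even h →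
      c * 2 ^ j / (j : ℝ) ^ 2
        ≤ ((siftedTuples {0, h} ((2 : ℝ) ^ (δ * ((j + 2 : ℕ) : ℝ))) (2 ^ j) (2 ^ (j + 1))).card : ℝ) := by
  obtain ⟨L, hL0, hL⟩ := exists_isSieveDensity 2 (θ := 2 / 3) (by norm_num)
  obtain ⟨c, hc, B, z₀, hsieve⟩ := hs L
  obtain ⟨C₂, hC₂, hprod⟩ := exists_prod_one_add_div_le (2 ^ B * 2)
  have hl2 := Real.log_pos one_lt_two
  set c₁ := 1 / (δ ^ 2 * (1 + L / Real.log 2)) with hc₁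
  have hc₁0 : 0 < c₁ := by positivity
  refine ⟨c * c₁ / 18, by positivity, ?_⟩
  have hz : Filter.Tendsto (fun n : ℕ => (2 : ℝ) ^ (δ * n)) Filter.atTop Filter.atTop :=
    (tendsto_rpow_atTop_of_base_gt_one 2 one_lt_two).comp
      (tendsto_natCast_atTop_atTop.const_mul_atTop hδ)
  have hev := (eventually_pow_mul_rpow_le (C₂ * (δ * Real.log 2) ^ (2 ^ B * 2)) (2 ^ B * 2 + 2) hsδ
    (show 0 < c * c₁ / 8 by positivity)).and
    ((hz.eventually_ge_atTop z₀).and (hz.eventually_gt_atTop 2))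
  filter_upwards [(Filter.tendsto_add_atTop_nat 2).eventually hev, Filter.eventually_ge_atTop 1]
    with j ⟨hj1, hj2, hj3⟩ hj h hh
  set n := j + 2 with hn
  have hn0 : (0 : ℝ) < n := by positivity
  set z := (2 : ℝ) ^ (δ * (n : ℝ)) with hzdef
  have hlz : Real.log z = δ * n * Real.log 2 := log_two_rpow_mul n δ
  set A := primesBelow z with hAdef
  have hA : ∀ p ∈ A, p.Prime := fun p hp => (mem_primesBelow.1 hp).1
  set Ω := tupleResidues {0, h} with hΩ
  set g : ℕ → ℝ := fun p => ((Ω p).card / p : ℝ) with hg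
  have hgd : IsSieveDensity 2 L g := by
    exact_mod_cast hL g (fun p _ => by positivity) (fun p hp => (card_tupleResidues_pair_le hh hp).1)
      fun p hp => (card_tupleResidues_pair_le hh hp).2
  obtain ⟨lam, hlam, hmain⟩ := hsieve z hj2 g hgd
  set w : Finset ℕ → ℝ := fun d => lam (∏ p ∈ d, p) with hw
  have hdvd : ∀ d ⊆ A, (∏ p ∈ d, p) ∣ sievePrimorial z := fun d hd =>
    prod_dvd_prod_of_subset _ _ _ hd
  have hmain' : c * ∏ p ∈ A, (1 - g p) ≤ weightedSum w A g := by
    refine hmain.trans_eq ?_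
    rw [sievePrimorial, sum_divisors_prod_primes hA (fun d => lam d * ∏ p ∈ d.primeFactors, g p)]
    refine sum_congr rfl fun d hd => ?_
    rw [primeFactors_prod_primes fun p hp => hA p (mem_powerset.1 hd hp)]
  have hab : 2 ^ j ≤ 2 ^ (j + 1) := Nat.pow_le_pow_right (by norm_num) (by omega)
  have hlen : (((2 ^ (j + 1) : ℕ) : ℝ) - ((2 ^ j : ℕ) : ℝ)) = 2 ^ j := by
    push_cast; ring
  have hcount : ∑ m ∈ Ioc (2 ^ j) (2 ^ (j + 1)),
      ∑ d ∈ (A.filter fun p => m % p ∈ Ω p).powerset, w d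
      ≤ ((siftedTuples {0, h} z (2 ^ j) (2 ^ (j + 1))).card : ℝ) := by
    rw [siftedTuples, card_filter, Nat.cast_sum]
    refine sum_le_sum fun m _ => ?_
    set N := A.filter fun p => m % p ∈ Ω p with hN
    have hNA : N ⊆ A := filter_subset _ _
    have h1 := hlam.sum_le _ (hdvd N hNA)
    rw [sum_divisors_prod_primes fun p hp => hA p (hNA hp)] at h1
    refine h1.trans ?_
    split_ifs with h2 h3 h3
    · simp
    · exfalso
      push Not at h3
      obtain ⟨h', hh', p, hp, hpd⟩ := h3
      have hpN : p ∈ N := mem_filter.2 ⟨hp, (mod_mem_tupleResidues_iff (hA p hp).pos m).2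
        ⟨h', hh', hpd⟩⟩
      have := Finset.dvd_prod_of_mem (fun p => p) hpN
      rw [h2, Nat.dvd_one] at this
      exact (hA p hp).one_lt.ne' this
    · simp
    · simp
  have hrem : ∑ d ∈ A.powerset, |w d| * ∏ p ∈ d, ((Ω p).card : ℝ)
      ≤ c * c₁ / 2 * 2 ^ j / (n : ℝ) ^ 2 := by
    refine (sum_remainder_le hA (D := z ^ s) (by positivity) 2 (2 ^ B) (fun d hd => ?_)
      (fun d hd hne => ?_) fun p _ => (card_tupleResidues_le _ _).trans card_le_two).trans ?_
    · have h1 := hlam.abs_le _ (hdvd d hd)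
      have h2 : ((∏ p ∈ d, p).divisors.card : ℝ) = 2 ^ d.card := by
        have := sum_divisors_prod_primes (fun p hp => hA p (hd hp)) (fun _ => 1)
        simpa using this
      rw [h2] at h1
      refine h1.trans_eq ?_
      push_cast
      rw [← pow_mul, ← pow_mul, mul_comm]
    · by_contra! hge
      exact hne (hlam.eq_zero_of_level_le _ (hdvd d hd) hge)
    · have h1 := hprod z hj3
      have h2 : z ^ s = (2 : ℝ) ^ (s * δ * n) := by
        rw [hzdef, ← Real.rpow_mul two_pos.le]
        congr 1
        ring
      rw [le_div_iff₀ (by positivity)]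
      calc z ^ s * (∏ p ∈ A, (1 + ((2 ^ B * 2 : ℕ) : ℝ) / p)) * (n : ℝ) ^ 2
          ≤ (2 : ℝ) ^ (s * δ * n) * (C₂ * Real.log z ^ (2 ^ B * 2)) * (n : ℝ) ^ 2 := by
            rw [h2]; gcongr
        _ = C₂ * (δ * Real.log 2) ^ (2 ^ B * 2) * (n : ℝ) ^ (2 ^ B * 2 + 2)
              * (2 : ℝ) ^ (s * δ * n) := by
            rw [hlz]; ring
        _ ≤ c * c₁ / 8 * 2 ^ n := hj1
        _ = _ := by rw [hn]; ring
  have hV : c₁ / (n : ℝ) ^ 2 ≤ ∏ p ∈ A, (1 - g p) := by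
    have h1 := hgd.dimension 2 z le_rfl hj3
    have h2 : (primesBelow z).filter (fun p : ℕ => (2 : ℝ) ≤ (p : ℝ)) = A :=
      filter_true_of_mem fun p hp => by exact_mod_cast (hA p hp).two_le
    rw [h2, prod_inv_distrib] at h1
    have hpos : 0 < ∏ p ∈ A, (1 - g p) :=
      prod_pos fun p hp => by linarith [hgd.lt_one p (hA p hp)]
    have h3 := inv_anti₀ (inv_pos.2 hpos) h1
    rw [inv_inv] at h3
    refine le_trans (le_of_eq ?_) h3
    rw [hlz, hc₁, mul_div_assoc, div_self hl2.ne', mul_one, Real.rpow_two]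
    field_simp
  have hsum := abs_sum_sieve_sub_le hab Ω A hA
    (fun p hp c hc => lt_of_mem_tupleResidues (hA p hp).pos hc) w
  rw [hlen] at hsum
  have h1 := (abs_le.1 (hsum.trans hrem)).1
  have h2 : (2 : ℝ) ^ j * (c * (c₁ / (n : ℝ) ^ 2)) ≤ 2 ^ j * weightedSum w A g := by
    have := (mul_le_mul_of_nonneg_left hV hc.le).trans hmain'
    gcongr
  have h3 : c * c₁ / 18 * 2 ^ j / (j : ℝ) ^ 2 ≤ c * c₁ / 2 * 2 ^ j / (n : ℝ) ^ 2 := by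
    have hj0 : (1 : ℝ) ≤ j := by exact_mod_cast hj
    have hn3 : (n : ℝ) ≤ 3 * j := by
      rw [hn]; push_cast; linarith
    have h4 : (n : ℝ) ^ 2 ≤ 9 * (j : ℝ) ^ 2 := by nlinarith
    have e : c * c₁ / 18 * 2 ^ j / (j : ℝ) ^ 2 = c * c₁ / 2 * 2 ^ j / (9 * (j : ℝ) ^ 2) := by
      field_simp
      norm_num
    rw [e]
    gcongr
  have e : (2 : ℝ) ^ j * (c * (c₁ / (n : ℝ) ^ 2))
      = c * c₁ / 2 * 2 ^ j / (n : ℝ) ^ 2 + c * c₁ / 2 * 2 ^ j / (n : ℝ) ^ 2 := by ring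
  linarith

/-! ### The mean value of the factors `n / φ(n)` -/

lemma one_add_two_mul_pow_le {t : ℝ} (h0 : 0 ≤ t) (h1 : t ≤ 1) (K : ℕ) :
    (1 + 2 * t) ^ K ≤ 1 + (3 ^ K - 1) * t := by
  induction K with
  | zero => simp
  | succ K ih =>
    have h3 : (1 : ℝ) ≤ 3 ^ K := one_le_pow₀ (by norm_num)
    have := mul_le_mul_of_nonneg_right ih (show 0 ≤ 1 + 2 * t by linarith)
    rw [pow_succ, pow_succ]
    nlinarith [mul_nonneg (sub_nonneg.2 h3) (mul_nonneg h0 (sub_nonneg.2 h1))]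

lemma inv_one_sub_pow_le {p : ℕ} (hp : p.Prime) (K : ℕ) :
    (1 - 1 / (p : ℝ))⁻¹ ^ K ≤ 1 + 3 ^ K / p := by
  have h2 : (2 : ℝ) ≤ p := by exact_mod_cast hp.two_le
  have h3 : 1 / (p : ℝ) ≤ 1 / 2 := one_div_le_one_div_of_le two_pos h2
  have h4 : 0 < 1 / (p : ℝ) := by positivity
  have h5 : (1 - 1 / (p : ℝ))⁻¹ ≤ 1 + 2 * (1 / (p : ℝ)) := by
    rw [inv_le_iff_one_le_mul₀ (by linarith)]
    nlinarith
  have h6 : 0 ≤ (1 - 1 / (p : ℝ))⁻¹ := inv_nonneg.2 (by linarith)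
  refine (pow_le_pow_left₀ h6 h5 K).trans ((one_add_two_mul_pow_le h4.le (by linarith) K).trans ?_)
  rw [sub_mul, one_mul, mul_one_div]
  linarith

lemma exists_sum_eulerFactor_pow_le (K : ℕ) : ∃ C : ℝ, 0 < C ∧ ∀ N : ℕ,
    ∑ h ∈ Ioc 0 N, eulerFactor h ^ K ≤ C * N := by
  have hs : Summable fun n : ℕ => (3 : ℝ) ^ K * (1 / (n : ℝ) ^ 2) :=
    (Real.summable_one_div_nat_pow.2 one_lt_two).mul_left _
  refine ⟨Real.exp (∑' n : ℕ, (3 : ℝ) ^ K * (1 / (n : ℝ) ^ 2)), Real.exp_pos _, fun N => ?_⟩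
  set P := (range (N + 1)).filter Nat.Prime with hP
  have hPp : ∀ p ∈ P, p.Prime := fun p hp => (mem_filter.1 hp).2
  have hsub : ∀ h ∈ Ioc 0 N, h.primeFactors ⊆ P := fun h hh p hp => by
    rw [mem_Ioc] at hh
    have := Nat.le_of_mem_primeFactors hp
    exact mem_filter.2 ⟨mem_range.2 (by omega), Nat.prime_of_mem_primeFactors hp⟩
  calc ∑ h ∈ Ioc 0 N, eulerFactor h ^ K
      ≤ ∑ h ∈ Ioc 0 N, ∑ T ∈ h.primeFactors.powerset, ∏ p ∈ T, ((3 : ℝ) ^ K / p) := by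
        refine sum_le_sum fun h _ => ?_
        rw [← prod_one_add, eulerFactor, ← prod_pow]
        refine prod_le_prod (fun p hp => ?_) fun p hp =>
          inv_one_sub_pow_le (Nat.prime_of_mem_primeFactors hp) K
        exact pow_nonneg (zero_le_one.trans
          (one_le_inv_one_sub (Nat.prime_of_mem_primeFactors hp))) K
    _ = ∑ h ∈ Ioc 0 N, ∑ T ∈ P.powerset,
          if T ⊆ h.primeFactors then ∏ p ∈ T, ((3 : ℝ) ^ K / p) else 0 := by
        refine sum_congr rfl fun h hh => ?_
        rw [← sum_filter]
        refine sum_congr ?_ fun _ _ => rfl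
        ext T
        simp only [mem_powerset, mem_filter]
        exact ⟨fun hT => ⟨hT.trans (hsub h hh), hT⟩, fun hT => hT.2⟩
    _ = ∑ T ∈ P.powerset, (((Ioc 0 N).filter fun h => T ⊆ h.primeFactors).card : ℝ)
          * ∏ p ∈ T, ((3 : ℝ) ^ K / p) := by
        rw [sum_comm]
        refine sum_congr rfl fun T _ => ?_
        rw [← sum_filter, sum_const, nsmul_eq_mul]
    _ ≤ ∑ T ∈ P.powerset, (N : ℝ) * ∏ p ∈ T, ((3 : ℝ) ^ K * (1 / (p : ℝ) ^ 2)) := by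
        refine sum_le_sum fun T hT => ?_
        have h1 : ((Ioc 0 N).filter fun h => T ⊆ h.primeFactors).card ≤ N / ∏ p ∈ T, p := by
          rw [← Nat.Ioc_filter_dvd_card_eq_div]
          refine card_le_card fun h hh => ?_
          rw [mem_filter] at hh ⊢
          exact ⟨hh.1, (prod_dvd_prod_of_subset _ _ _ hh.2).trans (Nat.prod_primeFactors_dvd h)⟩
        have h2 : (((Ioc 0 N).filter fun h => T ⊆ h.primeFactors).card : ℝ)
            ≤ N * ∏ p ∈ T, (1 / (p : ℝ)) := by
          refine (Nat.cast_le.2 h1).trans (Nat.cast_div_le.trans (le_of_eq ?_))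
          rw [prod_div_distrib, prod_const_one, mul_one_div]
          push_cast
          rfl
        calc _ ≤ (N * ∏ p ∈ T, (1 / (p : ℝ))) * ∏ p ∈ T, ((3 : ℝ) ^ K / p) := by gcongr
          _ = _ := by
              rw [mul_assoc, ← prod_mul_distrib]
              congr 1
              exact prod_congr rfl fun p _ => by ring
    _ = (∏ p ∈ P, (1 + (3 : ℝ) ^ K * (1 / (p : ℝ) ^ 2))) * N := by
        rw [← mul_sum, ← prod_one_add, mul_comm]
    _ ≤ _ := by
        gcongr
        refine (Real.prod_one_add_le_exp_sum P fun p => by positivity).trans ?_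
        exact Real.exp_le_exp.2 (hs.sum_le_tsum P fun _ _ => by positivity)

/-! ### Iterated logarithms along the powers of two -/

lemma iterLog_one (x : ℝ) : iterLog 1 x = Real.log x := rfl

lemma iterLog_succ (k : ℕ) (x : ℝ) : iterLog (k + 1) x = Real.log (iterLog k x) :=
  Function.iterate_succ_apply' _ _ _

lemma tendsto_iterLog (k : ℕ) : Filter.Tendsto (iterLog k) Filter.atTop Filter.atTop := by
  induction k with
  | zero => exact Filter.tendsto_id
  | succ k ih =>
    have : iterLog (k + 1) = Real.log ∘ iterLog k := funext fun x => iterLog_succ k x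
    rw [this]
    exact Real.tendsto_log_atTop.comp ih

lemma eventually_forall_iterLog_gt (k : ℕ) (c : ℝ) :
    ∀ᶠ x in Filter.atTop, ∀ j ∈ Icc 1 k, c < iterLog j x :=
  (Filter.eventually_all_finset _).2 fun j _ => (tendsto_iterLog j).eventually_gt_atTop c

lemma eventually_iterLogsPos (k : ℕ) : ∀ᶠ x in Filter.atTop, IterLogsPos k x :=
  eventually_forall_iterLog_gt k 0

lemma iterLog_mono {k : ℕ} {a b : ℝ} (h : IterLogsPos k a) (ha : 0 < a) (hab : a ≤ b) :
    ∀ i ≤ k + 1, iterLog i a ≤ iterLog i b := by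
  intro i
  induction i with
  | zero => exact fun _ => hab
  | succ i ih =>
    intro hi
    rw [iterLog_succ, iterLog_succ]
    refine Real.log_le_log ?_ (ih (by omega))
    rcases i.eq_zero_or_pos with rfl | hi0
    · exact ha
    · exact h i (mem_Icc.2 ⟨hi0, by omega⟩)

lemma iterLogsPos_mono {k : ℕ} {a b : ℝ} (h : IterLogsPos k a) (ha : 0 < a) (hab : a ≤ b) :
    IterLogsPos k b := fun j hj =>
  (h j hj).trans_le (iterLog_mono h ha hab j (by rw [mem_Icc] at hj; omega))

/-- The product `log_1 x ⋯ log_k x`. -/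
noncomputable def logProduct (k : ℕ) (x : ℝ) : ℝ := ∏ j ∈ Icc 1 k, iterLog j x

lemma logProduct_pos {k : ℕ} {x : ℝ} (h : IterLogsPos k x) : 0 < logProduct k x := prod_pos h

lemma logProduct_succ (k : ℕ) (x : ℝ) :
    logProduct (k + 1) x = logProduct k x * iterLog (k + 1) x := prod_Icc_succ_top (by omega) _

lemma logProduct_eq {k : ℕ} (hk : 1 ≤ k) (x : ℝ) :
    logProduct k x = Real.log x * logorial k x := by
  induction k, hk using Nat.le_induction with
  | base => simp [logProduct, logorial, iterLog_one]
  | succ k hk ih =>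
    rw [logProduct_succ, ih, logorial, logorial, prod_Icc_succ_top (by omega), mul_assoc]

lemma logorial_pos {k : ℕ} {x : ℝ} (h : IterLogsPos k x) : 0 < logorial k x :=
  prod_pos fun j hj => h j (by rw [mem_Icc] at hj ⊢; omega)

lemma logorial_mono {k : ℕ} {a b : ℝ} (h : IterLogsPos k a) (ha : 0 < a) (hab : a ≤ b) :
    logorial k a ≤ logorial k b :=
  prod_le_prod (fun j hj => (h j (by rw [mem_Icc] at hj ⊢; omega)).le) fun j hj =>
    iterLog_mono h ha hab j (by rw [mem_Icc] at hj; omega)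

lemma tendsto_logorial {k : ℕ} (hk : 2 ≤ k) :
    Filter.Tendsto (logorial k) Filter.atTop Filter.atTop := by
  refine Filter.tendsto_atTop_mono' _ ?_ (tendsto_iterLog 2)
  filter_upwards [eventually_forall_iterLog_gt k 1] with x hx
  have h2 : 2 ∈ Icc 2 k := mem_Icc.2 ⟨le_rfl, hk⟩
  have h1 : ∀ j ∈ Icc 2 k, 1 < iterLog j x := fun j hj => hx j (by rw [mem_Icc] at hj ⊢; omega)
  unfold logorial
  rw [← mul_prod_erase _ _ h2]
  exact le_mul_of_one_le_right (zero_le_one.trans (h1 2 h2).le)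
    (one_le_prod_of_one_le fun j hj => (h1 j (mem_of_mem_erase hj)).le)

lemma iterLog_le_iterLog_two {k : ℕ} {x : ℝ} (h : IterLogsPos k x) :
    ∀ j, 2 ≤ j → j ≤ k → iterLog j x ≤ iterLog 2 x := by
  intro j hj
  induction j, hj using Nat.le_induction with
  | base => exact fun _ => le_rfl
  | succ j hj ih =>
    intro hjk
    refine le_trans ?_ (ih (by omega))
    rw [iterLog_succ]
    have := Real.log_le_sub_one_of_pos (h j (mem_Icc.2 ⟨by omega, by omega⟩))
    linarith

lemma tendsto_logorial_div_log (k : ℕ) :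
    Filter.Tendsto (fun x => logorial k x / Real.log x) Filter.atTop (nhds 0) := by
  have h1 : Filter.Tendsto (fun u : ℝ => Real.log u ^ (k + 1 - 2) / u) Filter.atTop (nhds 0) :=
    (Real.isLittleO_pow_log_id_atTop (n := k + 1 - 2)).tendsto_div_nhds_zero
  refine squeeze_zero' ?_ ?_ (h1.comp Real.tendsto_log_atTop)
  · filter_upwards [eventually_iterLogsPos k, Filter.eventually_ge_atTop 1] with x hx hx1
    exact div_nonneg (logorial_pos hx).le (Real.log_nonneg hx1)
  · filter_upwards [eventually_iterLogsPos k, Filter.eventually_ge_atTop 1] with x hx hx1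
    have h0 : 0 ≤ Real.log x := Real.log_nonneg hx1
    simp only [Function.comp_apply]
    gcongr
    calc logorial k x ≤ ∏ _j ∈ Icc 2 k, iterLog 2 x :=
          prod_le_prod (fun j hj => (hx j (by rw [mem_Icc] at hj ⊢; omega)).le) fun j hj => by
            rw [mem_Icc] at hj
            exact iterLog_le_iterLog_two hx j hj.1 hj.2
      _ = Real.log (Real.log x) ^ (k + 1 - 2) := by
          rw [prod_const, Nat.card_Icc]; rfl

lemma iterLog_sub_le {k : ℕ} {a b : ℝ} (h : IterLogsPos k a) (ha : 0 < a) (hab : a ≤ b) :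
    iterLog (k + 1) b - iterLog (k + 1) a ≤ (Real.log b - Real.log a) / logProduct k a := by
  induction k with
  | zero => simp [logProduct, iterLog_one]
  | succ k ih =>
    have h' : IterLogsPos k a := fun j hj => h j (by rw [mem_Icc] at hj ⊢; omega)
    have hA : 0 < iterLog (k + 1) a := h _ (mem_Icc.2 ⟨by omega, le_rfl⟩)
    have hB : iterLog (k + 1) a ≤ iterLog (k + 1) b := iterLog_mono h ha hab _ (by omega)
    have h1 := Real.log_le_sub_one_of_pos (div_pos (hA.trans_le hB) hA)
    rw [Real.log_div (hA.trans_le hB).ne' hA.ne', ← iterLog_succ, ← iterLog_succ] at h1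
    rw [logProduct_succ, ← div_div]
    refine h1.trans ?_
    rw [div_sub_one hA.ne']
    exact div_le_div_of_nonneg_right (ih h') hA.le

lemma le_iterLog_sub {k : ℕ} {a b : ℝ} (h : IterLogsPos k a) (ha : 0 < a) (hab : a ≤ b) :
    (Real.log b - Real.log a) / logProduct k b ≤ iterLog (k + 1) b - iterLog (k + 1) a := by
  induction k with
  | zero => simp [logProduct, iterLog_one]
  | succ k ih =>
    have h' : IterLogsPos k a := fun j hj => h j (by rw [mem_Icc] at hj ⊢; omega)
    have hA : 0 < iterLog (k + 1) a := h _ (mem_Icc.2 ⟨by omega, le_rfl⟩)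
    have hB : iterLog (k + 1) a ≤ iterLog (k + 1) b := iterLog_mono h ha hab _ (by omega)
    have hB0 := hA.trans_le hB
    have h1 := Real.log_le_sub_one_of_pos (div_pos hA hB0)
    rw [Real.log_div hA.ne' hB0.ne', ← iterLog_succ, ← iterLog_succ] at h1
    rw [logProduct_succ, ← div_div]
    have h2 := div_le_div_of_nonneg_right (ih h') hB0.le
    rw [sub_div (iterLog (k + 1) b), div_self hB0.ne'] at h2
    linarith

lemma log_two_pow_succ_sub (j : ℕ) :
    Real.log ((2 : ℝ) ^ (j + 1)) - Real.log ((2 : ℝ) ^ j) = Real.log 2 := by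
  rw [Real.log_pow, Real.log_pow]; push_cast; ring

lemma two_pow_mono {i j : ℕ} (h : i ≤ j) : (2 : ℝ) ^ i ≤ 2 ^ j :=
  pow_le_pow_right₀ one_le_two h

/-- The series `∑ 1 / (log_1 ⋯ log_k)(2 ^ j)` diverges: its terms majorise the increments of
`log_{k+1} (2 ^ j)`. -/
lemma tendsto_sum_inv_logProduct {k j₀ : ℕ} (h : IterLogsPos k ((2 : ℝ) ^ j₀)) :
    Filter.Tendsto (fun J : ℕ => ∑ j ∈ Ico j₀ J, 1 / logProduct k ((2 : ℝ) ^ j))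
      Filter.atTop Filter.atTop := by
  have h2 : Filter.Tendsto (fun J : ℕ => (iterLog (k + 1) ((2 : ℝ) ^ J)
      - iterLog (k + 1) ((2 : ℝ) ^ j₀)) / Real.log 2) Filter.atTop Filter.atTop :=
    (Filter.tendsto_atTop_add_const_right _ _ ((tendsto_iterLog (k + 1)).comp
      (tendsto_pow_atTop_atTop_of_one_lt one_lt_two))).atTop_div_const (Real.log_pos one_lt_two)
  refine Filter.tendsto_atTop_mono' _ ?_ h2
  filter_upwards [Filter.eventually_ge_atTop j₀] with J hJ
  rw [div_le_iff₀ (Real.log_pos one_lt_two), sum_mul,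
    ← sum_Ico_sub (fun j => iterLog (k + 1) ((2 : ℝ) ^ j)) hJ]
  refine sum_le_sum fun j hj => ?_
  rw [mem_Ico] at hj
  have := iterLog_sub_le (iterLogsPos_mono h (by positivity) (two_pow_mono hj.1)) (by positivity)
    (two_pow_mono (Nat.le_succ j))
  rw [Nat.succ_eq_add_one, log_two_pow_succ_sub] at this
  rw [one_div_mul_eq_div]
  exact this

lemma rpow_neg_sub_ge {a b ε : ℝ} (ha : 0 < a) (hab : a ≤ b) (hε : 0 < ε) :
    ε * ((b - a) / b) / b ^ ε ≤ a ^ (-ε) - b ^ (-ε) := by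
  have hb := ha.trans_le hab
  have h1 : a ^ (-ε) = (a / b) ^ (-ε) * b ^ (-ε) := by
    rw [Real.div_rpow ha.le hb.le, div_mul_cancel₀ _ (Real.rpow_pos_of_pos hb _).ne']
  have h2 : 1 + ε * ((b - a) / b) ≤ (a / b) ^ (-ε) := by
    rw [Real.rpow_def_of_pos (div_pos ha hb)]
    have h3 := Real.log_le_sub_one_of_pos (div_pos ha hb)
    have h4 := Real.add_one_le_exp (Real.log (a / b) * -ε)
    have h5 : (b - a) / b = 1 - a / b := by field_simp
    rw [h5]
    nlinarith
  rw [h1, Real.rpow_neg hb.le, div_eq_mul_inv]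
  have h6 : 0 < (b ^ ε)⁻¹ := inv_pos.2 (Real.rpow_pos_of_pos hb _)
  nlinarith

/-- The series `∑ 1 / (log_1 ⋯ log_k · log_k ^ ε)(2 ^ j)` converges: its terms are dominated by the
increments of `-(log_k (2 ^ j)) ^ (-ε)`. -/
lemma sum_inv_logProduct_mul_rpow_le {k j₀ : ℕ} (hk : 1 ≤ k) (h : IterLogsPos k ((2 : ℝ) ^ j₀))
    {ε : ℝ} (hε : 0 < ε) (J : ℕ) :
    ∑ j ∈ Ico (j₀ + 1) J,
      1 / (logProduct k ((2 : ℝ) ^ j) * iterLog k ((2 : ℝ) ^ j) ^ ε)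
      ≤ iterLog k ((2 : ℝ) ^ j₀) ^ (-ε) / (ε * Real.log 2) := by
  obtain ⟨k, rfl⟩ := Nat.exists_eq_add_of_le' hk
  have hl2 := Real.log_pos one_lt_two
  have hpos : ∀ j, j₀ ≤ j → IterLogsPos (k + 1) ((2 : ℝ) ^ j) := fun j hj =>
    iterLogsPos_mono h (by positivity) (two_pow_mono hj)
  have hx : ∀ j, j₀ ≤ j → 0 < iterLog (k + 1) ((2 : ℝ) ^ j) := fun j hj =>
    hpos j hj _ (mem_Icc.2 ⟨by omega, le_rfl⟩)
  have hterm : ∀ j, j₀ ≤ j → 1 / (logProduct (k + 1) ((2 : ℝ) ^ (j + 1))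
      * iterLog (k + 1) ((2 : ℝ) ^ (j + 1)) ^ ε) * (ε * Real.log 2)
      ≤ iterLog (k + 1) ((2 : ℝ) ^ j) ^ (-ε) - iterLog (k + 1) ((2 : ℝ) ^ (j + 1)) ^ (-ε) := by
    intro j hj
    have hj' : IterLogsPos k ((2 : ℝ) ^ j) := fun i hi =>
      hpos j hj i (by rw [mem_Icc] at hi ⊢; omega)
    have hmono := iterLog_mono hj' (by positivity) (two_pow_mono (Nat.le_succ j)) (k + 1) le_rfl
    refine le_trans ?_ (rpow_neg_sub_ge (hx j hj) hmono hε)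
    have h1 := le_iterLog_sub hj' (by positivity) (two_pow_mono (Nat.le_succ j))
    rw [Nat.succ_eq_add_one, log_two_pow_succ_sub] at h1
    rw [Nat.succ_eq_add_one] at *
    have hx1 := hx (j + 1) (by omega)
    have hP : 0 < logProduct k ((2 : ℝ) ^ (j + 1)) := logProduct_pos fun i hi =>
      hpos (j + 1) (by omega) i (by rw [mem_Icc] at hi ⊢; omega)
    have hxε : 0 < iterLog (k + 1) ((2 : ℝ) ^ (j + 1)) ^ ε := Real.rpow_pos_of_pos hx1 _
    rw [logProduct_succ]
    calc _ = ε * (Real.log 2 / logProduct k ((2 : ℝ) ^ (j + 1))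
            / iterLog (k + 1) ((2 : ℝ) ^ (j + 1))) / iterLog (k + 1) ((2 : ℝ) ^ (j + 1)) ^ ε := by
          field_simp
      _ ≤ _ := by gcongr
  rcases Nat.lt_or_ge J (j₀ + 1) with hJ | hJ
  · rw [Ico_eq_empty (by omega), sum_empty]
    have := hx j₀ le_rfl
    positivity
  · obtain ⟨J, rfl⟩ := Nat.exists_eq_add_of_le' (show 1 ≤ J by omega)
    rw [le_div_iff₀ (by positivity), ← sum_Ico_add' (fun j => 1 / (logProduct (k + 1) ((2 : ℝ) ^ j)
      * iterLog (k + 1) ((2 : ℝ) ^ j) ^ ε)), sum_mul]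
    refine (sum_le_sum fun j hj => hterm j (mem_Ico.1 hj).1).trans ?_
    have h3 := sum_Ico_sub (fun j => -iterLog (k + 1) ((2 : ℝ) ^ j) ^ (-ε))
      (show j₀ ≤ J by omega)
    have h4 : ∑ j ∈ Ico j₀ J, (iterLog (k + 1) ((2 : ℝ) ^ j) ^ (-ε)
        - iterLog (k + 1) ((2 : ℝ) ^ (j + 1)) ^ (-ε))
        = ∑ j ∈ Ico j₀ J, (-iterLog (k + 1) ((2 : ℝ) ^ (j + 1)) ^ (-ε)
          - -iterLog (k + 1) ((2 : ℝ) ^ j) ^ (-ε)) := sum_congr rfl fun j _ => by ring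
    rw [h4, h3]
    have h5 : 0 < iterLog (k + 1) ((2 : ℝ) ^ J) ^ (-ε) :=
      Real.rpow_pos_of_pos (hx J (by omega)) _
    linarith

/-! ### Sums over dyadic blocks -/

open Classical in
/-- The contribution of `m` to the sum over short gaps. -/
noncomputable def shortGapTerm (k : ℕ) (S : Set ℕ) (lam : ℝ → ℝ) (m : ℕ) : ℝ :=
  if m ∈ S ∧ IterLogsPos k (m : ℝ) ∧
    (successorIn S m : ℝ) - (m : ℝ) ≤ lam (m : ℝ) * Real.log (m : ℝ) then 1 / (m : ℝ) else 0

lemma shortGapSum_eq (k : ℕ) (S : Set ℕ) (lam : ℝ → ℝ) (x : ℝ) :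
    shortGapSum k S lam x = ∑ m ∈ Icc 1 ⌊x⌋₊, shortGapTerm k S lam m := by
  unfold shortGapSum shortGapTerm
  rw [sum_filter]

lemma shortGapTerm_nonneg (k : ℕ) (S : Set ℕ) (lam : ℝ → ℝ) (m : ℕ) :
    0 ≤ shortGapTerm k S lam m := by
  unfold shortGapTerm
  split_ifs <;> positivity

lemma sum_Icc_two_pow_eq (f : ℕ → ℝ) {i J : ℕ} (hiJ : i ≤ J) :
    ∑ m ∈ Icc 1 (2 ^ J), f m
      = ∑ m ∈ Icc 1 (2 ^ i), f m + ∑ j ∈ Ico i J, ∑ m ∈ Ioc (2 ^ j) (2 ^ (j + 1)), f m := by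
  have e : ∀ n : ℕ, Icc 1 n = Ioc 0 n := fun n => rfl
  induction J, hiJ using Nat.le_induction with
  | base => simp
  | succ J hJ ih =>
    rw [sum_Ico_succ_top hJ, ← add_assoc, ← ih, e, e, sum_Ioc_consecutive _ (Nat.zero_le _)
      (Nat.pow_le_pow_right two_pos (Nat.le_succ J))]

/-! ### The short gaps have a convergent sum -/

lemma not_dvd_of_mem_survivors {δ η : ℝ} (hη : 0 ≤ η) (hηδ : η ≤ δ) {j m p : ℕ}
    (hm : m ∈ survivors δ) (hjm : 2 ^ j ≤ m) (hp : p ∈ primesBelow ((2 : ℝ) ^ (η * j))) :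
    ¬ p ∣ m := by
  intro hpm
  rw [mem_primesBelow] at hp
  have h1 := hm.2 p hp.1 hpm
  have hjm' : (2 : ℝ) ^ j ≤ m := by exact_mod_cast hjm
  have h2 : (2 : ℝ) ^ (η * j) ≤ (m : ℝ) ^ δ := by
    rw [mul_comm, Real.rpow_natCast_mul two_pos.le]
    have h3 : (1 : ℝ) ≤ 2 ^ j := one_le_pow₀ one_le_two
    exact (Real.rpow_le_rpow (by positivity) hjm' hη).trans
      (Real.rpow_le_rpow_of_exponent_le (h3.trans hjm') hηδ)
  linarith [hp.2]

/-- In a dyadic block the elements whose successor is at most `Y` away are covered by the sifted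
pairs with difference at most `Y`. -/
lemma exists_card_short_gaps_le {δ : ℝ} (hδ : 0 < δ) : ∃ C : ℝ, 0 < C ∧ ∀ᶠ j : ℕ in Filter.atTop,
    ∀ S ⊆ survivors δ, (∀ m, ∃ n ∈ S, m < n) → ∀ (Y : ℝ) (G : Finset ℕ),
      (∀ m ∈ G, m ∈ Ioc (2 ^ j) (2 ^ (j + 1)) ∧ m ∈ S ∧ (successorIn S m : ℝ) - m ≤ Y) →
      0 ≤ Y → (G.card : ℝ) ≤ C * 2 ^ j / (j : ℝ) ^ 2 * Y := by
  set η := min δ (1 / 20) with hη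
  have hη0 : 0 < η := by positivity
  obtain ⟨C₁, hC₁, h1⟩ := exists_card_siftedTuples_le 2 hη0 (min_le_right _ _)
  obtain ⟨C₂, hC₂, h2⟩ := exists_sum_eulerFactor_pow_le 2
  refine ⟨C₁ * C₂, by positivity, ?_⟩
  filter_upwards [h1] with j hj S hS hSinf Y G hG hY
  have hsub : G ⊆ (Ioc 0 ⌊Y⌋₊).biUnion fun h =>
      siftedTuples {0, h} ((2 : ℝ) ^ (η * j)) (2 ^ j) (2 ^ (j + 1)) := by
    intro m hm
    obtain ⟨hmI, hmS, hmY⟩ := hG m hm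
    have hsucc : successorIn S m ∈ {n : ℕ | n ∈ S ∧ m < n} := Nat.sInf_mem (hSinf m)
    set n := successorIn S m with hn
    have hmn : m < n := hsucc.2
    rw [mem_biUnion]
    refine ⟨n - m, mem_Ioc.2 ⟨by omega, ?_⟩, ?_⟩
    · refine Nat.le_floor ?_
      rw [Nat.cast_sub hmn.le]
      exact hmY
    · rw [siftedTuples, mem_filter]
      refine ⟨hmI, ?_⟩
      have hjm := (mem_Ioc.1 hmI).1.le
      simp only [mem_insert, mem_singleton, forall_eq_or_imp, forall_eq, add_zero,
        Nat.add_sub_cancel' hmn.le]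
      exact ⟨fun p hp => not_dvd_of_mem_survivors hη0.le (min_le_left _ _) (hS hmS) hjm hp,
        fun p hp => not_dvd_of_mem_survivors hη0.le (min_le_left _ _) (hS hsucc.1)
          (hjm.trans hmn.le) hp⟩
  calc (G.card : ℝ) ≤ ∑ h ∈ Ioc 0 ⌊Y⌋₊,
        ((siftedTuples {0, h} ((2 : ℝ) ^ (η * j)) (2 ^ j) (2 ^ (j + 1))).card : ℝ) := by
        exact_mod_cast (card_le_card hsub).trans card_biUnion_le
    _ ≤ ∑ h ∈ Ioc 0 ⌊Y⌋₊, C₁ * 2 ^ j / (j : ℝ) ^ 2 * eulerFactor h ^ 2 := by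
        refine sum_le_sum fun h hh => ?_
        have hh0 : h ≠ 0 := by rw [mem_Ioc] at hh; omega
        refine hj {0, h} (card_pair hh0.symm) h hh0 fun p hp hph => ?_
        have hne : h % p ≠ 0 := fun h0 => hph (Nat.dvd_of_mod_eq_zero h0)
        intro a ha b hb hab
        simp only [coe_insert, coe_singleton, Set.mem_insert_iff, Set.mem_singleton_iff] at ha hb
        rcases ha with rfl | rfl <;> rcases hb with rfl | rfl
        · rfl
        · simp only [Nat.zero_mod] at hab
          exact absurd hab.symm hne
        · simp only [Nat.zero_mod] at hab
          exact absurd hab hne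
        · rfl
    _ = C₁ * 2 ^ j / (j : ℝ) ^ 2 * ∑ h ∈ Ioc 0 ⌊Y⌋₊, eulerFactor h ^ 2 := by rw [mul_sum]
    _ ≤ C₁ * 2 ^ j / (j : ℝ) ^ 2 * (C₂ * Y) := by
        have h3 := h2 ⌊Y⌋₊
        have h4 := Nat.floor_le hY
        have h5 : C₂ * (⌊Y⌋₊ : ℝ) ≤ C₂ * Y := by gcongr
        exact mul_le_mul_of_nonneg_left (h3.trans h5) (by positivity)
    _ = _ := by ring

/-- The block `j` contributes at most a constant times
`1 / (log_1 ⋯ log_k · log_k ^ ε) (2 ^ j)`, which is summable. The set `S` may be sparser than the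
survivors, since only pairs of survivors are counted. -/
theorem exists_shortGapSum_le {δ : ℝ} (hδ : 0 < δ) {S : Set ℕ} (hS : S ⊆ survivors δ)
    (hSinf : ∀ m, ∃ n ∈ S, m < n) {k : ℕ} (hk : 2 ≤ k) {ε : ℝ} (hε : 0 < ε) :
    ∃ C : ℝ, ∀ x : ℝ,
      shortGapSum k S (fun t => 1 / (logorial k t * iterLog k t ^ ε)) x ≤ C := by
  obtain ⟨C₁, hC₁, hcard⟩ := exists_card_short_gaps_le hδ
  have hpow : Filter.Tendsto (fun j : ℕ => (2 : ℝ) ^ j) Filter.atTop Filter.atTop :=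
    tendsto_pow_atTop_atTop_of_one_lt one_lt_two
  obtain ⟨j₀, hj₀⟩ := Filter.eventually_atTop.1 (hcard.and
    ((hpow.eventually (eventually_iterLogsPos k)).and (Filter.eventually_ge_atTop 1)))
  have hl2 := Real.log_pos one_lt_two
  set lam : ℝ → ℝ := fun t => 1 / (logorial k t * iterLog k t ^ ε) with hlam
  set f := shortGapTerm k S lam with hf
  have hblock : ∀ j, j₀ ≤ j → ∑ m ∈ Ioc (2 ^ j) (2 ^ (j + 1)), f m
      ≤ 2 * C₁ * Real.log 2 ^ 2 * (1 / (logProduct k ((2 : ℝ) ^ j)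
        * iterLog k ((2 : ℝ) ^ j) ^ ε)) := by
    intro j hj
    obtain ⟨hcj, hpos, hj1⟩ := hj₀ j hj
    have hj1' : (1 : ℝ) ≤ j := by exact_mod_cast hj1
    have hlp := logorial_pos hpos
    have hx : 0 < iterLog k ((2 : ℝ) ^ j) := hpos k (mem_Icc.2 ⟨by omega, le_rfl⟩)
    have hxε : 0 < iterLog k ((2 : ℝ) ^ j) ^ ε := Real.rpow_pos_of_pos hx _
    set Q := logorial k ((2 : ℝ) ^ j) * iterLog k ((2 : ℝ) ^ j) ^ ε with hQ
    have hQ0 : 0 < Q := mul_pos hlp hxε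
    classical
    set G := (Ioc (2 ^ j) (2 ^ (j + 1))).filter fun m : ℕ => m ∈ S ∧ IterLogsPos k (m : ℝ) ∧
      (successorIn S m : ℝ) - (m : ℝ) ≤ lam (m : ℝ) * Real.log (m : ℝ) with hG
    have hsum : ∑ m ∈ Ioc (2 ^ j) (2 ^ (j + 1)), f m = ∑ m ∈ G, 1 / (m : ℝ) := by
      rw [hG, sum_filter]
      refine sum_congr rfl fun m _ => ?_
      rw [hf]
      unfold shortGapTerm
      congr
    have hGY := hcj S hS hSinf ((j + 1) * Real.log 2 / Q) G (fun m hm => by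
      rw [hG, mem_filter] at hm
      refine ⟨hm.1, hm.2.1, hm.2.2.2.trans ?_⟩
      have hmj := mem_Ioc.1 hm.1
      have h1 : (2 : ℝ) ^ j ≤ m := by exact_mod_cast hmj.1.le
      have h2 : (m : ℝ) ≤ 2 ^ (j + 1) := by exact_mod_cast hmj.2
      have h3 : Real.log m ≤ (j + 1) * Real.log 2 := by
        have := Real.log_le_log (lt_of_lt_of_le (by positivity) h1) h2
        rw [Real.log_pow] at this
        exact_mod_cast this
      have h4 : Q ≤ logorial k m * iterLog k m ^ ε := by
        have h5 := logorial_mono hpos (by positivity) h1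
        have h6 := iterLog_mono hpos (by positivity) h1 k (by omega)
        have h8 := hlp.le.trans h5
        rw [hQ]
        gcongr
      have h7 : lam m * Real.log m = Real.log m / (logorial k m * iterLog k m ^ ε) := by
        rw [hlam]; ring
      rw [h7]
      gcongr) (by positivity)
    calc _ = ∑ m ∈ G, 1 / (m : ℝ) := hsum
      _ ≤ ∑ _m ∈ G, 1 / (2 : ℝ) ^ j := by
          refine sum_le_sum fun m hm => ?_
          rw [hG, mem_filter] at hm
          refine one_div_le_one_div_of_le (by positivity) ?_
          exact_mod_cast (mem_Ioc.1 hm.1).1.le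
      _ = (G.card : ℝ) / 2 ^ j := by rw [sum_const, nsmul_eq_mul, mul_one_div]
      _ ≤ (C₁ * 2 ^ j / (j : ℝ) ^ 2 * ((j + 1) * Real.log 2 / Q)) / 2 ^ j := by gcongr
      _ = C₁ * Real.log 2 / Q / (j : ℝ) ^ 2 * (j + 1) := by field_simp
      _ ≤ C₁ * Real.log 2 / Q / (j : ℝ) ^ 2 * (2 * j) := by
          gcongr
          linarith
      _ = 2 * C₁ * Real.log 2 ^ 2 * (1 / (j * Real.log 2 * Q)) := by field_simp
      _ = _ := by
          rw [logProduct_eq (by omega), Real.log_pow, hQ, mul_assoc _ (logorial k _)]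
  set X := iterLog k ((2 : ℝ) ^ j₀) ^ (-ε) / (ε * Real.log 2) with hX
  refine ⟨∑ m ∈ Icc 1 (2 ^ (j₀ + 1)), f m + 2 * C₁ * Real.log 2 ^ 2 * X, fun x => ?_⟩
  set J := max (j₀ + 1) ⌊x⌋₊ with hJ
  have hJx : ⌊x⌋₊ ≤ 2 ^ J := (Nat.lt_two_pow_self (n := ⌊x⌋₊)).le.trans
    (Nat.pow_le_pow_right two_pos (le_max_right _ _))
  rw [shortGapSum_eq]
  calc ∑ m ∈ Icc 1 ⌊x⌋₊, f m ≤ ∑ m ∈ Icc 1 (2 ^ J), f m :=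
        sum_le_sum_of_subset_of_nonneg (Icc_subset_Icc_right hJx)
          fun m _ _ => shortGapTerm_nonneg k S lam m
    _ = ∑ m ∈ Icc 1 (2 ^ (j₀ + 1)), f m
          + ∑ j ∈ Ico (j₀ + 1) J, ∑ m ∈ Ioc (2 ^ j) (2 ^ (j + 1)), f m :=
        sum_Icc_two_pow_eq f (le_max_left _ _)
    _ ≤ ∑ m ∈ Icc 1 (2 ^ (j₀ + 1)), f m + ∑ j ∈ Ico (j₀ + 1) J, 2 * C₁ * Real.log 2 ^ 2
          * (1 / (logProduct k ((2 : ℝ) ^ j) * iterLog k ((2 : ℝ) ^ j) ^ ε)) := by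
        gcongr with j hj
        rw [mem_Ico] at hj
        exact hblock j (by omega)
    _ ≤ _ := by
        rw [← mul_sum]
        have := sum_inv_logProduct_mul_rpow_le (show 1 ≤ k by omega) (hj₀ j₀ le_rfl).2.1 hε J
        gcongr

/-! ### The short gaps have a divergent sum -/

/-- Counting an element of `I` and the pairs in `I` by their differences: the pairs that contain the
least element already account for all but one element. -/
lemma card_le_one_add_card_pairs {N : ℕ} {I : Finset ℕ} (hI : I ⊆ Ioc 0 N) :
    I.card ≤ (if I.Nonempty then 1 else 0)
      + ((Ioc 0 N ×ˢ Ioc 0 N).filter fun q => q.1 ∈ I ∧ q.1 + q.2 ∈ I).card := by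
  rcases I.eq_empty_or_nonempty with rfl | hne
  · simp
  · rw [if_pos hne, ← card_erase_add_one (min'_mem I hne), add_comm]
    refine Nat.add_le_add_left ?_ 1
    have hlt : ∀ i ∈ I.erase (I.min' hne), I.min' hne < i := fun i hi =>
      min'_lt_of_mem_erase_min' I hne hi
    refine card_le_card_of_injOn (fun i => (I.min' hne, i - I.min' hne)) (fun i hi => ?_) ?_
    · have h1 := hlt i hi
      have h2 := mem_Ioc.1 (hI (mem_of_mem_erase hi))
      simp only [coe_filter, mem_product, Set.mem_ofPred_eq, Nat.add_sub_cancel' h1.le]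
      exact ⟨⟨hI (min'_mem I hne), mem_Ioc.2 ⟨by omega, by omega⟩⟩, min'_mem I hne,
        mem_of_mem_erase hi⟩
    · intro i hi i' hi' heq
      have h1 := hlt i hi
      have h2 := hlt i' hi'
      simp only [Prod.mk.injEq, true_and] at heq
      omega

/-- The numbers `m` for which some pair `m, m + 2 i` with `0 < i ≤ N` survives the sieve: their
number is at least that of the pairs minus that of the triples. -/
lemma exists_le_card_short_gaps {s δ : ℝ} (hs : SievePositiveAt 2 s) (hδ : 0 < δ)
    (hsδ : s * δ < 1) :
    ∃ c C : ℝ, 0 < c ∧ 0 < C ∧ ∀ᶠ j : ℕ in Filter.atTop, ∀ N : ℕ, C * N ≤ j →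
      c * 2 ^ j / (j : ℝ) ^ 2 * N ≤ (((Ioc 0 N).biUnion fun i =>
        siftedTuples {0, 2 * i} ((2 : ℝ) ^ (δ * ((j + 2 : ℕ) : ℝ))) (2 ^ j) (2 ^ (j + 1))).card : ℝ) := by
  set η := min δ (1 / 20) with hη
  have hη0 : 0 < η := by positivity
  obtain ⟨c, hc, hlow⟩ := exists_le_card_siftedTuples_pair hs hδ hsδ
  obtain ⟨C₁, hC₁, hup⟩ := exists_card_siftedTuples_le 3 hη0 (min_le_right _ _)
  obtain ⟨C₂, hC₂, havg⟩ := exists_sum_eulerFactor_pow_le 9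
  set C₃ := C₁ * eulerFactor 2 ^ 3 * (4 * C₂) with hC₃
  have hF2 := one_le_eulerFactor 2
  refine ⟨c / 2, C₃ * (2 / c), by positivity, by positivity, ?_⟩
  filter_upwards [hlow, hup, Filter.eventually_ge_atTop 1] with j hj1 hj2 hj3 N hN
  have hj0 : (0 : ℝ) < j := by exact_mod_cast hj3
  set T : ℕ → Finset ℕ := fun i =>
    siftedTuples {0, 2 * i} ((2 : ℝ) ^ (δ * ((j + 2 : ℕ) : ℝ))) (2 ^ j) (2 ^ (j + 1)) with hT
  have hcomb : ∑ i ∈ Ioc 0 N, (T i).card ≤ ((Ioc 0 N).biUnion T).card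
      + ∑ q ∈ Ioc 0 N ×ˢ Ioc 0 N, (T q.1 ∩ T (q.1 + q.2)).card := by
    set B := Ioc (2 ^ j) (2 ^ (j + 1)) with hB
    have hTB : ∀ i, T i ⊆ B := fun i => filter_subset _ _
    have e1 : ∀ A ⊆ B, A.card = ∑ m ∈ B, if m ∈ A then 1 else 0 := fun A hA => by
      rw [← card_filter, filter_mem_eq_inter, inter_eq_right.2 hA]
    have e2 : ∑ i ∈ Ioc 0 N, (T i).card = ∑ m ∈ B, ∑ i ∈ Ioc 0 N, if m ∈ T i then 1 else 0 := by
      rw [sum_comm]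
      exact sum_congr rfl fun i _ => e1 _ (hTB i)
    have e3 : ∑ q ∈ Ioc 0 N ×ˢ Ioc 0 N, (T q.1 ∩ T (q.1 + q.2)).card
        = ∑ m ∈ B, ∑ q ∈ Ioc 0 N ×ˢ Ioc 0 N, if m ∈ T q.1 ∩ T (q.1 + q.2) then 1 else 0 := by
      rw [sum_comm]
      exact sum_congr rfl fun q _ => e1 _ (inter_subset_left.trans (hTB _))
    rw [e1 _ (biUnion_subset.2 fun i _ => hTB i), e2, e3, ← sum_add_distrib]
    refine sum_le_sum fun m _ => ?_
    have := card_le_one_add_card_pairs (N := N) (I := (Ioc 0 N).filter fun i => m ∈ T i)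
      (filter_subset _ _)
    rw [← card_filter, ← card_filter]
    refine this.trans (add_le_add (le_of_eq ?_) (card_le_card fun q hq => ?_))
    · refine if_congr ?_ rfl rfl
      simp [Finset.Nonempty, mem_biUnion]
    · rw [mem_filter] at hq ⊢
      simp only [mem_filter] at hq
      exact ⟨hq.1, mem_inter.2 ⟨hq.2.1.2, hq.2.2.2⟩⟩
  have hpairs : N * (c * 2 ^ j / (j : ℝ) ^ 2) ≤ ∑ i ∈ Ioc 0 N, ((T i).card : ℝ) := by
    have := card_nsmul_le_sum (Ioc 0 N) (fun i => ((T i).card : ℝ)) _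
      fun i _ => hj1 (2 * i) (even_two_mul i)
    simpa using this
  have htriple : ∀ i ∈ Ioc 0 N, ∀ d ∈ Ioc 0 N, ((T i ∩ T (i + d)).card : ℝ)
      ≤ C₁ * 2 ^ j / (j : ℝ) ^ 3 * eulerFactor 2 ^ 3
        * (eulerFactor i ^ 9 + eulerFactor (i + d) ^ 9 + eulerFactor d ^ 9) := by
    intro i hi d hd
    rw [mem_Ioc] at hi hd
    have hsub : T i ∩ T (i + d)
        ⊆ siftedTuples {0, 2 * i, 2 * (i + d)} ((2 : ℝ) ^ (η * j)) (2 ^ j) (2 ^ (j + 1)) := by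
      intro m hm
      rw [mem_inter, hT] at hm
      simp only [siftedTuples, mem_filter, mem_insert, mem_singleton, forall_eq_or_imp,
        forall_eq] at hm ⊢
      have hz : (2 : ℝ) ^ (η * j) ≤ (2 : ℝ) ^ (δ * ((j + 2 : ℕ) : ℝ)) := by
        refine Real.rpow_le_rpow_of_exponent_le one_le_two ?_
        have h1 : η ≤ δ := min_le_left _ _
        have h2 : (j : ℝ) ≤ ((j + 2 : ℕ) : ℝ) := by push_cast; linarith
        gcongr
      have hP : ∀ p ∈ primesBelow ((2 : ℝ) ^ (η * j)),
          p ∈ primesBelow ((2 : ℝ) ^ (δ * ((j + 2 : ℕ) : ℝ))) := fun p hp => by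
        rw [mem_primesBelow] at hp ⊢
        exact ⟨hp.1, hp.2.trans_le hz⟩
      exact ⟨hm.1.1, fun p hp => hm.1.2.1 p (hP p hp), fun p hp => hm.1.2.2 p (hP p hp),
        fun p hp => hm.2.2.2 p (hP p hp)⟩
    have hcard3 : ({0, 2 * i, 2 * (i + d)} : Finset ℕ).card = 3 :=
      card_eq_three.2 ⟨0, 2 * i, 2 * (i + d), by omega, by omega, by omega, rfl⟩
    have hi0 : i ≠ 0 := by omega
    have hd0 : d ≠ 0 := by omega
    have hid0 : i + d ≠ 0 := by omega
    have h1 := hj2 {0, 2 * i, 2 * (i + d)} hcard3 (2 * (i * ((i + d) * d)))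
      (mul_ne_zero two_ne_zero (mul_ne_zero hi0 (mul_ne_zero hid0 hd0))) fun p hp hpΔ => by
        have n2 : ¬ p ∣ 2 := fun h => hpΔ (dvd_mul_of_dvd_left h _)
        have ni : ¬ p ∣ i := fun h => hpΔ (dvd_mul_of_dvd_right (dvd_mul_of_dvd_left h _) _)
        have nid : ¬ p ∣ i + d := fun h => hpΔ
          (dvd_mul_of_dvd_right (dvd_mul_of_dvd_right (dvd_mul_of_dvd_left h _) _) _)
        have nd : ¬ p ∣ d := fun h => hpΔ
          (dvd_mul_of_dvd_right (dvd_mul_of_dvd_right (dvd_mul_of_dvd_right h _) _) _)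
        have m1 : ¬ 2 * i % p = 0 := fun h =>
          ((hp.dvd_mul).1 (Nat.dvd_of_mod_eq_zero h)).elim n2 ni
        have m2 : ¬ 2 * (i + d) % p = 0 := fun h =>
          ((hp.dvd_mul).1 (Nat.dvd_of_mod_eq_zero h)).elim n2 nid
        have m3 : ¬ 2 * i % p = 2 * (i + d) % p := fun h => by
          have := (Nat.modEq_iff_dvd' (show 2 * i ≤ 2 * (i + d) by omega)).1 h
          rw [show 2 * (i + d) - 2 * i = 2 * d by omega] at this
          exact ((hp.dvd_mul).1 this).elim n2 nd
        intro a ha b hb hab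
        simp only [coe_insert, coe_singleton, Set.mem_insert_iff, Set.mem_singleton_iff] at ha hb
        rcases ha with rfl | rfl | rfl <;> rcases hb with rfl | rfl | rfl <;>
          simp only [Nat.zero_mod] at hab
        · rfl
        · exact absurd hab.symm m1
        · exact absurd hab.symm m2
        · exact absurd hab m1
        · rfl
        · exact absurd hab m3
        · exact absurd hab m2
        · exact absurd hab.symm m3
        · rfl
    have h2 : eulerFactor (2 * (i * ((i + d) * d))) ^ 3 ≤ eulerFactor 2 ^ 3
        * (eulerFactor i ^ 9 + eulerFactor (i + d) ^ 9 + eulerFactor d ^ 9) := by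
      have a1 := one_le_eulerFactor i
      have a2 := one_le_eulerFactor (i + d)
      have a3 := one_le_eulerFactor d
      have b3 := eulerFactor_mul_le hid0 hd0
      have b2 := (eulerFactor_mul_le hi0 (mul_ne_zero hid0 hd0)).trans
        (mul_le_mul_of_nonneg_left b3 (by linarith))
      have b1 := (eulerFactor_mul_le two_ne_zero (mul_ne_zero hi0 (mul_ne_zero hid0 hd0))).trans
        (mul_le_mul_of_nonneg_left b2 (by linarith))
      have b0 := one_le_eulerFactor (2 * (i * ((i + d) * d)))
      refine (pow_le_pow_left₀ (by linarith) b1 3).trans ?_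
      rw [mul_pow]
      refine mul_le_mul_of_nonneg_left ?_ (by positivity)
      -- the product of three numbers is at most the sum of their cubes
      have key : ∀ u v w : ℝ, 0 ≤ u → 0 ≤ v → 0 ≤ w → u * (v * w) ≤ u ^ 3 + v ^ 3 + w ^ 3 := by
        intro u v w hu hv hw
        nlinarith [mul_nonneg (add_nonneg (add_nonneg hu hv) hw)
          (add_nonneg (add_nonneg (sq_nonneg (u - v)) (sq_nonneg (v - w))) (sq_nonneg (u - w))),
          mul_nonneg hu (mul_nonneg hv hw)]
      have := key (eulerFactor i ^ 3) (eulerFactor (i + d) ^ 3) (eulerFactor d ^ 3)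
        (by positivity) (by positivity) (by positivity)
      calc _ = eulerFactor i ^ 3 * (eulerFactor (i + d) ^ 3 * eulerFactor d ^ 3) := by ring
        _ ≤ _ := this
        _ = _ := by ring
    calc _ ≤ ((siftedTuples {0, 2 * i, 2 * (i + d)} ((2 : ℝ) ^ (η * j)) (2 ^ j)
            (2 ^ (j + 1))).card : ℝ) := by exact_mod_cast card_le_card hsub
      _ ≤ C₁ * 2 ^ j / (j : ℝ) ^ 3 * eulerFactor (2 * (i * ((i + d) * d))) ^ 3 := h1
      _ ≤ C₁ * 2 ^ j / (j : ℝ) ^ 3 * (eulerFactor 2 ^ 3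
          * (eulerFactor i ^ 9 + eulerFactor (i + d) ^ 9 + eulerFactor d ^ 9)) := by gcongr
      _ = _ := by ring
  have htriples : ∑ q ∈ Ioc 0 N ×ˢ Ioc 0 N, ((T q.1 ∩ T (q.1 + q.2)).card : ℝ)
      ≤ C₃ * 2 ^ j / (j : ℝ) ^ 3 * (N * N) := by
    have hN9 := havg N
    have hshift : ∀ i ∈ Ioc 0 N, ∑ d ∈ Ioc 0 N, eulerFactor (i + d) ^ 9 ≤ C₂ * (2 * N) := by
      intro i hi
      rw [mem_Ioc] at hi
      have h1 := havg (2 * N)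
      push_cast at h1
      refine le_trans ?_ h1
      rw [← sum_image (f := fun h => eulerFactor h ^ 9) (g := fun d => i + d)
        (fun a _ b _ h => Nat.add_left_cancel h)]
      refine sum_le_sum_of_subset_of_nonneg (fun h hh => ?_) fun h _ _ => ?_
      · obtain ⟨d, hd, rfl⟩ := mem_image.1 hh
        rw [mem_Ioc] at hd ⊢
        omega
      · have := one_le_eulerFactor h
        positivity
    rw [sum_product]
    calc _ ≤ ∑ i ∈ Ioc 0 N, ∑ d ∈ Ioc 0 N, C₁ * 2 ^ j / (j : ℝ) ^ 3 * eulerFactor 2 ^ 3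
          * (eulerFactor i ^ 9 + eulerFactor (i + d) ^ 9 + eulerFactor d ^ 9) :=
          sum_le_sum fun i hi => sum_le_sum fun d hd => htriple i hi d hd
      _ = C₁ * 2 ^ j / (j : ℝ) ^ 3 * eulerFactor 2 ^ 3 * ∑ i ∈ Ioc 0 N,
          (N * eulerFactor i ^ 9 + ∑ d ∈ Ioc 0 N, eulerFactor (i + d) ^ 9
            + ∑ d ∈ Ioc 0 N, eulerFactor d ^ 9) := by
          rw [mul_sum]
          refine sum_congr rfl fun i _ => ?_
          rw [← mul_sum, sum_add_distrib, sum_add_distrib, sum_const, Nat.card_Ioc, nsmul_eq_mul,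
            Nat.sub_zero]
      _ ≤ C₁ * 2 ^ j / (j : ℝ) ^ 3 * eulerFactor 2 ^ 3 * ∑ i ∈ Ioc 0 N,
          (N * eulerFactor i ^ 9 + C₂ * (2 * N) + C₂ * N) := by
          refine mul_le_mul_of_nonneg_left (sum_le_sum fun i hi => ?_) (by positivity)
          have := hshift i hi
          linarith
      _ = C₁ * 2 ^ j / (j : ℝ) ^ 3 * eulerFactor 2 ^ 3
          * (N * ∑ i ∈ Ioc 0 N, eulerFactor i ^ 9 + N * (C₂ * (2 * N)) + N * (C₂ * N)) := by
          rw [sum_add_distrib, sum_add_distrib, ← mul_sum, sum_const, sum_const, Nat.card_Ioc,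
            Nat.sub_zero, nsmul_eq_mul, nsmul_eq_mul]
      _ ≤ C₁ * 2 ^ j / (j : ℝ) ^ 3 * eulerFactor 2 ^ 3
          * (N * (C₂ * N) + N * (C₂ * (2 * N)) + N * (C₂ * N)) := by gcongr
      _ = _ := by rw [hC₃]; ring
  have hcomb' : ∑ i ∈ Ioc 0 N, ((T i).card : ℝ) ≤ (((Ioc 0 N).biUnion T).card : ℝ)
      + ∑ q ∈ Ioc 0 N ×ˢ Ioc 0 N, ((T q.1 ∩ T (q.1 + q.2)).card : ℝ) := by exact_mod_cast hcomb
  have hsmall : C₃ * 2 ^ j / (j : ℝ) ^ 3 * (N * N) ≤ c / 2 * 2 ^ j / (j : ℝ) ^ 2 * N := by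
    have h1 : C₃ * N ≤ c / 2 * j := by
      have := mul_le_mul_of_nonneg_left hN (show 0 ≤ c / 2 by positivity)
      have e : c / 2 * (C₃ * (2 / c) * N) = C₃ * N := by field_simp
      rwa [e] at this
    calc _ = (C₃ * N) * (2 ^ j / (j : ℝ) ^ 3 * N) := by ring
      _ ≤ (c / 2 * j) * (2 ^ j / (j : ℝ) ^ 3 * N) := by gcongr
      _ = _ := by field_simp
  have e : N * (c * 2 ^ j / (j : ℝ) ^ 2)
      = c / 2 * 2 ^ j / (j : ℝ) ^ 2 * N + c / 2 * 2 ^ j / (j : ℝ) ^ 2 * N := by ring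
  linarith

lemma mem_survivors_of_siftedTuples {δ : ℝ} (hδ : 0 < δ) {j n : ℕ} (hn0 : 1 ≤ n)
    (hn : n ≤ 2 ^ (j + 2))
    (h : ∀ p ∈ primesBelow ((2 : ℝ) ^ (δ * ((j + 2 : ℕ) : ℝ))), ¬ p ∣ n) : n ∈ survivors δ := by
  refine ⟨hn0, fun p hp hpn => ?_⟩
  have h1 : ¬ (p : ℝ) < (2 : ℝ) ^ (δ * ((j + 2 : ℕ) : ℝ)) := fun hlt =>
    h p (mem_primesBelow.2 ⟨hp, hlt⟩) hpn
  refine le_trans ?_ (not_lt.1 h1)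
  rw [mul_comm, Real.rpow_natCast_mul two_pos.le]
  exact Real.rpow_le_rpow (by positivity) (by exact_mod_cast hn) hδ.le

/-- The block `j` contributes at least a constant times `1 / (log_1 ⋯ log_k) (2 ^ (j + 1))`. -/
theorem tendsto_shortGapSum {s δ : ℝ} (hs : SievePositiveAt 2 s) (hδ : 0 < δ)
    (hsδ : s * δ < 1) {k : ℕ} (hk : 2 ≤ k) :
    Filter.Tendsto (fun x : ℝ => shortGapSum k (survivors δ) (fun t => 1 / logorial k t) x)
      Filter.atTop Filter.atTop := by
  obtain ⟨c, C, hc, hC, hcard⟩ := exists_le_card_short_gaps hs hδ hsδ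
  have hl2 := Real.log_pos one_lt_two
  have hl2' : Real.log 2 ≤ 1 := by
    have := Real.log_le_sub_one_of_pos two_pos
    linarith
  have hpow : Filter.Tendsto (fun j : ℕ => (2 : ℝ) ^ j) Filter.atTop Filter.atTop :=
    tendsto_pow_atTop_atTop_of_one_lt one_lt_two
  have hpow1 : Filter.Tendsto (fun j : ℕ => (2 : ℝ) ^ (j + 1)) Filter.atTop Filter.atTop :=
    hpow.comp (Filter.tendsto_add_atTop_nat 1)
  have hev1 := hpow1.eventually ((tendsto_logorial_div_log k).eventually
    (gt_mem_nhds (show (0 : ℝ) < 1 / 16 by norm_num)))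
  have hev2 := hpow1.eventually ((tendsto_logorial hk).eventually_ge_atTop (max 1 C))
  obtain ⟨j₀, hj₀⟩ := Filter.eventually_atTop.1 ((hcard.and (hev1.and hev2)).and
    ((hpow.eventually (eventually_iterLogsPos k)).and (Filter.eventually_ge_atTop 1)))
  set lam : ℝ → ℝ := fun t => 1 / logorial k t with hlam
  set S := survivors δ with hS
  set f := shortGapTerm k S lam with hf
  have hblock : ∀ j, j₀ ≤ j → c * Real.log 2 ^ 2 / 8 * (1 / logProduct k ((2 : ℝ) ^ (j + 1)))
      ≤ ∑ m ∈ Ioc (2 ^ j) (2 ^ (j + 1)), f m := by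
    intro j hj
    obtain ⟨⟨hcj, hj16, hjC⟩, hpos, hj1⟩ := hj₀ j hj
    have hj1' : (1 : ℝ) ≤ j := by exact_mod_cast hj1
    have hpos' := iterLogsPos_mono hpos (by positivity) (two_pow_mono (Nat.le_succ j))
    rw [Nat.succ_eq_add_one] at hpos'
    set Q := logorial k ((2 : ℝ) ^ (j + 1)) with hQ
    have hQ0 : 0 < Q := logorial_pos hpos'
    have hP : logProduct k ((2 : ℝ) ^ (j + 1)) = (j + 1) * Real.log 2 * Q := by
      rw [logProduct_eq (by omega), Real.log_pow]
      push_cast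
      rfl
    -- every gap of length at most `Y` counts
    set Y : ℝ := j ^ 2 * Real.log 2 ^ 2 / logProduct k ((2 : ℝ) ^ (j + 1)) with hY
    have hYeq : Y = (j : ℝ) ^ 2 * Real.log 2 / ((j + 1) * Q) := by
      rw [hY, hP]; field_simp
    have hYj : Y * Q ≤ j := by
      rw [hYeq, div_mul_eq_mul_div, div_le_iff₀ (by positivity)]
      have h1 : (j : ℝ) ^ 2 * Real.log 2 * Q ≤ (j : ℝ) ^ 2 * 1 * Q := by gcongr
      nlinarith [mul_pos hQ0 (show (0 : ℝ) < j by linarith)]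
    have hY4 : 4 ≤ Y := by
      rw [Real.log_pow, div_lt_iff₀ (by positivity)] at hj16
      push_cast at hj16
      rw [hYeq, le_div_iff₀ (by positivity)]
      have h1 : ((j : ℝ) + 1) ^ 2 ≤ 4 * (j : ℝ) ^ 2 := by nlinarith
      have h2 : 4 * (((j : ℝ) + 1) * Q) ≤ ((j : ℝ) + 1) ^ 2 * Real.log 2 / 4 := by
        have := mul_le_mul_of_nonneg_left hj16.le (show 0 ≤ 4 * ((j : ℝ) + 1) by positivity)
        linarith
      have h3 := mul_le_mul_of_nonneg_right h1 hl2.le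
      linarith
    set N := ⌊Y / 2⌋₊ with hN
    have hN2 : 2 * (N : ℝ) ≤ Y := by
      have := Nat.floor_le (show 0 ≤ Y / 2 by linarith)
      linarith
    have hN4 : Y / 4 ≤ N := by
      have := Nat.lt_floor_add_one (Y / 2)
      linarith
    have hYle : Y ≤ j := le_trans (le_mul_of_one_le_right (by linarith)
      ((le_max_left _ _).trans hjC)) hYj
    have hCN : C * N ≤ j := by
      have h1 : C * N ≤ Q * Y := mul_le_mul ((le_max_right _ _).trans hjC) (by linarith)
        (by positivity) hQ0.le
      linarith
    set G := (Ioc 0 N).biUnion fun i =>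
      siftedTuples {0, 2 * i} ((2 : ℝ) ^ (δ * ((j + 2 : ℕ) : ℝ))) (2 ^ j) (2 ^ (j + 1)) with hG
    have hGcard := hcj N hCN
    have hGB : G ⊆ Ioc (2 ^ j) (2 ^ (j + 1)) := biUnion_subset.2 fun i _ => filter_subset _ _
    have hNj : 2 * N ≤ 2 ^ (j + 1) := by
      have h1 : 2 * (N : ℝ) ≤ j := hN2.trans hYle
      have h2 : 2 * N ≤ j := by exact_mod_cast h1
      exact h2.trans ((Nat.lt_two_pow_self (n := j)).le.trans
        (Nat.pow_le_pow_right two_pos (Nat.le_succ j)))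
    have hterm : ∀ m ∈ G, f m = 1 / (m : ℝ) := by
      intro m hm
      have hmB := mem_Ioc.1 (hGB hm)
      obtain ⟨i, hi, hmi⟩ := mem_biUnion.1 hm
      rw [mem_Ioc] at hi
      simp only [siftedTuples, mem_filter, mem_insert, mem_singleton, forall_eq_or_imp, forall_eq,
        add_zero] at hmi
      have hm1 : (2 : ℝ) ^ j ≤ m := by exact_mod_cast hmB.1.le
      have hm2 : (m : ℝ) ≤ 2 ^ (j + 1) := by exact_mod_cast hmB.2
      have hm0 : 1 ≤ m := Nat.one_le_two_pow.trans hmB.1.le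
      have e2 : 2 ^ (j + 2) = 2 ^ (j + 1) + 2 ^ (j + 1) := by ring
      have hmS : m ∈ S := mem_survivors_of_siftedTuples hδ hm0 (by omega) hmi.2.1
      have hmS' : m + 2 * i ∈ S :=
        mem_survivors_of_siftedTuples hδ (by omega) (by omega) hmi.2.2
      have hmpos := iterLogsPos_mono hpos (by positivity) hm1
      have hsucc : successorIn S m ≤ m + 2 * i := Nat.sInf_le ⟨hmS', by omega⟩
      have hgap : (successorIn S m : ℝ) - m ≤ Y := by
        have h1 : (successorIn S m : ℝ) ≤ m + 2 * i := by exact_mod_cast hsucc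
        have h2 : (i : ℝ) ≤ N := by exact_mod_cast hi.2
        linarith
      have hYlam : Y ≤ lam m * Real.log m := by
        have h1 : lam m * Real.log m = Real.log m / logorial k m := by rw [hlam]; ring
        have h2 : j * Real.log 2 ≤ Real.log m := by
          have := Real.log_le_log (by positivity) hm1
          rwa [Real.log_pow] at this
        have h3 : logorial k m ≤ Q := logorial_mono hmpos
          (lt_of_lt_of_le (by positivity) hm1) hm2
        have h4 : 0 < logorial k m := logorial_pos hmpos
        rw [h1]
        calc Y ≤ j * Real.log 2 / Q := by
              rw [hYeq, div_le_div_iff₀ (by positivity) hQ0]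
              have : 0 ≤ (j : ℝ) * Real.log 2 * Q := by positivity
              nlinarith
          _ ≤ _ := by gcongr
      rw [hf]
      unfold shortGapTerm
      exact if_pos ⟨hmS, hmpos, hgap.trans hYlam⟩
    calc c * Real.log 2 ^ 2 / 8 * (1 / logProduct k ((2 : ℝ) ^ (j + 1)))
        = (c * 2 ^ j / (j : ℝ) ^ 2 * (Y / 4)) / 2 ^ (j + 1) := by
          have : 0 < logProduct k ((2 : ℝ) ^ (j + 1)) := logProduct_pos hpos'
          rw [hY]
          field_simp
          ring
      _ ≤ (c * 2 ^ j / (j : ℝ) ^ 2 * N) / 2 ^ (j + 1) := by gcongr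
      _ ≤ (G.card : ℝ) / 2 ^ (j + 1) := by gcongr
      _ = ∑ _m ∈ G, 1 / (2 : ℝ) ^ (j + 1) := by rw [sum_const, nsmul_eq_mul, mul_one_div]
      _ ≤ ∑ m ∈ G, f m := by
          refine sum_le_sum fun m hm => ?_
          rw [hterm m hm]
          have hmB := mem_Ioc.1 (hGB hm)
          refine one_div_le_one_div_of_le ?_ ?_
          · exact_mod_cast lt_of_le_of_lt (Nat.zero_le _) hmB.1
          · exact_mod_cast hmB.2
      _ ≤ _ := sum_le_sum_of_subset_of_nonneg hGB fun m _ _ => shortGapTerm_nonneg k S lam m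
  -- pass from `x` to the largest power of two below it
  have hdiv : Filter.Tendsto (fun J : ℕ => c * Real.log 2 ^ 2 / 8
      * ∑ j ∈ Ico (j₀ + 1) (J + 1), 1 / logProduct k ((2 : ℝ) ^ j)) Filter.atTop Filter.atTop :=
    ((tendsto_sum_inv_logProduct (hj₀ (j₀ + 1) (Nat.le_succ _)).2.1).comp
      (Filter.tendsto_add_atTop_nat 1)).const_mul_atTop (by positivity)
  have hpowsum : Filter.Tendsto (fun J : ℕ => ∑ m ∈ Icc 1 (2 ^ J), f m)
      Filter.atTop Filter.atTop := by
    refine Filter.tendsto_atTop_mono' _ ?_ hdiv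
    filter_upwards [Filter.eventually_ge_atTop j₀] with J hJ
    rw [sum_Icc_two_pow_eq f hJ, ← sum_Ico_add' (fun j => 1 / logProduct k ((2 : ℝ) ^ j)), mul_sum]
    have h1 : 0 ≤ ∑ m ∈ Icc 1 (2 ^ j₀), f m :=
      sum_nonneg fun m _ => shortGapTerm_nonneg k S lam m
    have h2 := sum_le_sum fun j (hj : j ∈ Ico j₀ J) => hblock j (mem_Ico.1 hj).1
    linarith
  refine Filter.tendsto_atTop.2 fun M => ?_
  obtain ⟨J, hJ⟩ := (hpowsum.eventually_ge_atTop M).exists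
  filter_upwards [Filter.eventually_ge_atTop ((2 : ℝ) ^ J)] with x hx
  rw [shortGapSum_eq]
  refine hJ.trans (sum_le_sum_of_subset_of_nonneg (Icc_subset_Icc_right (Nat.le_floor ?_))
    fun m _ _ => shortGapTerm_nonneg k S lam m)
  exact_mod_cast hx

lemma prime_mem_survivors {δ : ℝ} (hδ : δ ≤ 1) {p : ℕ} (hp : p.Prime) : p ∈ survivors δ := by
  refine ⟨hp.one_le, fun q hq hqp => ?_⟩
  rw [(Nat.prime_dvd_prime_iff_eq hq hp).1 hqp]
  have h1 : (1 : ℝ) ≤ p := by exact_mod_cast hp.one_le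
  simpa using Real.rpow_le_rpow_of_exponent_le h1 hδ

lemma eq_one_of_mem_survivors {δ : ℝ} (hδ : 1 < δ) {m : ℕ} (hm : m ∈ survivors δ) : m = 1 := by
  by_contra hne
  obtain ⟨p, hp, hpm⟩ := Nat.exists_prime_and_dvd hne
  have h1 := hm.2 p hp hpm
  have h2 : (p : ℝ) ≤ m := by exact_mod_cast Nat.le_of_dvd hm.1 hpm
  have h3 : (1 : ℝ) < p := by exact_mod_cast hp.one_lt
  have h4 := Real.rpow_lt_rpow_of_exponent_lt (h3.trans_le h2) hδ
  rw [Real.rpow_one] at h4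
  linarith

lemma exists_prime_gt (m : ℕ) : ∃ n, n.Prime ∧ m < n := by
  obtain ⟨p, hmp, hp⟩ := Nat.exists_infinite_primes (m + 1)
  exact ⟨p, hp, hmp⟩

/-- For `δ > 1` the only survivor is `1`, where `log` vanishes, so that the sum is empty. -/
lemma shortGapSum_eq_zero {δ : ℝ} (hδ : 1 < δ) {k : ℕ} (hk : 1 ≤ k) (lam : ℝ → ℝ) (x : ℝ) :
    shortGapSum k (survivors δ) lam x = 0 := by
  rw [shortGapSum_eq]
  refine sum_eq_zero fun m _ => ?_
  unfold shortGapTerm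
  refine if_neg fun h => ?_
  have h1 := h.2.1 1 (mem_Icc.2 ⟨le_rfl, hk⟩)
  rw [eq_one_of_mem_survivors hδ h.1, iterLog_one, Nat.cast_one, Real.log_one] at h1
  exact lt_irrefl _ h1

end ShortGaps

theorem proposition4p1 :
    -- the sifting limit of the two-dimensional sieve is finite; for instance `δ = 1 / 10` is allowed
    siftingLimit 2 < ((10 : ℝ) : EReal) ∧
    ∀ (k : ℕ) (ε : ℝ), 2 ≤ k → 0 < ε →
      (∀ δ : ℝ, 0 < δ → siftingLimit 2 < ((1 / δ : ℝ) : EReal) →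
        Filter.Tendsto
          (fun x : ℝ => shortGapSum k (survivors δ) (fun t => 1 / logorial k t) x)
          Filter.atTop Filter.atTop) ∧
      (∀ δ : ℝ, 0 < δ →
        ∃ C : ℝ, ∀ x : ℝ,
          shortGapSum k (survivors δ)
            (fun t => 1 / (logorial k t * iterLog k t ^ ε)) x ≤ C) ∧
      (∃ C : ℝ, ∀ x : ℝ,
          shortGapSum k {p : ℕ | p.Prime}
            (fun t => 1 / (logorial k t * iterLog k t ^ ε)) x ≤ C) := by
  refine ⟨?_, fun k ε hk hε => ⟨fun δ hδ hlim => ?_, fun δ hδ => ?_, ?_⟩⟩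
  · refine lt_of_le_of_lt (sInf_le ⟨48 / 5, ShortGaps.sievePositiveAt_two, rfl⟩) ?_
    exact EReal.coe_lt_coe_iff.2 (by norm_num)
  · obtain ⟨_, ⟨s, hs, rfl⟩, hlt⟩ := sInf_lt_iff.1 hlim
    have hs1 : s < 1 / δ := EReal.coe_lt_coe_iff.1 hlt
    exact ShortGaps.tendsto_shortGapSum hs hδ ((lt_div_iff₀ hδ).1 hs1) hk
  · rcases le_or_gt δ 1 with h1 | h1
    · refine ShortGaps.exists_shortGapSum_le hδ subset_rfl (fun m => ?_) hk hε
      obtain ⟨n, hn, hmn⟩ := ShortGaps.exists_prime_gt m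
      exact ⟨n, ShortGaps.prime_mem_survivors h1 hn, hmn⟩
    · exact ⟨0, fun x => (ShortGaps.shortGapSum_eq_zero h1 (by omega) _ x).le⟩
  · exact ShortGaps.exists_shortGapSum_le one_pos
      (fun p hp => ShortGaps.prime_mem_survivors le_rfl hp) ShortGaps.exists_prime_gt hk hε
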